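/- **Setting.** Let $D,N,M,K\ge 1$ be integers, let $T,\alpha,\sigma_1,\sigma_2,\sigma_3>0$, $u_{\max}\ge 0$, $E_{\rm des}\in\mathbb R^D$, $\bar V_N,\bar V_\infty\in\mathbb R$, and let $0=t_0<t_1<\dots<t_K=T$, $I_k=[t_{k-1},t_k]$. For potentials $\Phi_1,\Phi_2:\mathbb R^D\to\mathbb R$ put $K_j(x,y)=(\nabla\Phi_j)(x-y)$. For an interval $I$ let $\mathcal U_{ad}(I)$ be the set of $u\in L^2(I,\mathbb R^{MD})$ with $|u_m(t)|\le u_{\max}$ for a.e. $t\in I$ and all $m=1,\dots,M$. Fix initial data $y_0=(x_0,v_0,d_0)\in\mathbb R^{ND}\times\mathbb R^{ND}\times\mathbb R^{MD}$ and a probability density $f_0$ on $\mathbb R^{2D}$, and set $p_0=(f_0,d_0)$. For a Borel probability measure $\mu$ on $\mathbb R^{2D}$ and $d\in\mathbb R^{MD}$ let $$S(\mu)(x,v,d)=-\int K_1(x,\bar x)\,d\mu(\bar x,\bar v)-\frac1M\sum_{m=1}^M K_2(x,d_m)-\alpha v .$$ For $w\in\mathcal U_{ad}([0,T])$ let $d(t)=d_0+\int_0^t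 w$. The *nonlinear flow* $Z:[0,T]\times\mathbb R^{2D}\to\mathbb R^{2D}$ belonging to $w$ is the solution of $\frac{d}{dt}Z=(v,S(\mu_t)(Z,d(t)))$, where $v$ is the velocity component of $Z$, $Z(0,\cdot)=\mathrm{id}$, $\mu_t=Z(t,\cdot)_\#(f_0\,dz)$. **(A)** $\Phi_1,\Phi_2$ are radially symmetric and $C^1$, and $\nabla\Phi_1,\nabla\Phi_2$ are locally Lipschitz and globally bounded. **(B)** $f_0\in L^2(\mathbb R^{2D})$ has compact support and, for every $w\in\mathcal U_{ad}([0,T])$, the nonlinear flow $Z$ is a $C^1$ family (in $t\in[0,T]$) of $C^1$ diffeomorphisms of $\mathbb R^{2D}$ such that the densities $f_t$ of $\mu_t$ define an element $f\in H^1([0,T],L^2(\mathbb R^{2D}))$. Finally, let $\Omega\subset\mathbb R^{2D}$ be a bounded convex open set such that $\mu_t$ is concentrated on $\Omega$ for all $t\in[0,T]$ and all $w\in\mathcal U_{ad}([0,T])$. **Problem 1 on $I_k$ with initial value $y_{k-1}$.** Minimize $$J_N(y,u)=\int_{I_k}\frac{\sigma_1}{4T}|\mathbb V_N(x(t))-\bar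 V_N|^2+\frac{\sigma_2}{2T}|\mathbb E_N(x(t))-E_{\rm des}|^2+\frac{\sigma_3}{2M}|u(t)|^2\,dt$$ over all $y=(x,v,d)\in H^1(I_k,\mathbb R^{ND})^2\times H^1(I_k,\mathbb R^{MD})$ and $u\in\mathcal U_{ad}(I_k)$ with $y(t_{k-1})=y_{k-1}$ and, a.e. on $I_k$, $\dot x_i=v_i$, $\dot v_i=-\frac1N\sum_{j\ne i}K_1(x_i,x_j)-\frac1M\sum_m K_2(x_i,d_m)-\alpha v_i$, $\dot d_m=u_m$. Here $\mathbb E_N(x)=\frac1N\sum_i x_i$ and $\mathbb V_N(x)=\frac1N\sum_i|x_i-\mathbb E_N(x)|^2$. **Problem 2 on $I_k$ with initial value $p_{k-1}$.** Minimize $$J_\infty(p,w)=\int_{I_k}\frac{\sigma_1}{4T}|\mathbb V_\infty(f_t)-\bar V_\infty|^2+\frac{\sigma_2}{2T}|\mathbb E_\infty(f_t)-E_{\rm des}|^2+\frac{\sigma_3}{2M}|w(t)|^2\,dt$$ over all $p=(f,d)\in H^1(I_k,L^2(\Omega))\times H^1(I_k,\mathbb R^{MD})$ ($f_t$ extended by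 $0$ outside $\Omega$) and $w\in\mathcal U_{ad}(I_k)$ with $p(t_{k-1})=p_{k-1}$, $\dot d=w$ a.e. on $I_k$, and $\mu_t=f_t\,dz$ a weak measure solution of $\partial_t\mu_t+v\cdot\nabla_x\mu_t+\nabla_v\cdot(S(\mu_t)\mu_t)=0$ on $I_k$. That is: $t\mapsto\mu_t$ is a continuous curve, in the 1-Wasserstein distance, of probability measures with finite first moment, and for all $h\in C_c^\infty((-\infty,t_k)\times\mathbb R^{2D})$ $$\int_{I_k}\int\big(\partial_t h+v\cdot\nabla_x h+S(\mu_t)(x,v,d(t))\cdot\nabla_v h\big)\,d\mu_t\,dt+\int h(t_{k-1},\cdot)\,d\mu_{t_{k-1}}=0 .$$ Here $\mathbb E_\infty(f)=\iint x f\,dx\,dv$ and $\mathbb V_\infty(f)=\iint|x-\mathbb E_\infty(f)|^2f\,dx\,dv$. The slices are coupled: on $I_1$ the initial values are $y_0$ and $p_0$; for $k\ge2$ they are the values at $t_{k-1}$ of the state components of an optimal pair chosen on $I_{k-1}$. **Theorem.** Assume (A) and (B). Then for every $k=1,\dots,K$ there exist on $I_k$ an optimal state–control pair $(y_k^*,u_k^*)$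 for Problem 1 and an optimal state–control pair $(p_k^*,w_k^*)$ for Problem 2. More precisely, whatever optimal pairs have been chosen successively on $I_1,\dots,I_{k-1}$, an optimal pair on $I_k$ with the resulting initial value exists; in particular there are full sequences of successive optimal pairs on $I_1,\dots,I_K$. -/

import Mathlib

open MeasureTheory Set Filter Topology
open scoped ContDiff

noncomputable section

namespace Herding

/-! ### Spaces -/

/-- The physical space `ℝ^D` with its Euclidean norm. -/
abbrev Space (D : ℕ) := EuclideanSpace ℝ (Fin D)

/-- `(ℝ^D)^n = ℝ^{nD}` with its Euclidean norm. -/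
abbrev Tuple (D n : ℕ) := PiLp 2 (fun _ : Fin n => Space D)

/-- Microscopic states `y = (x, v, d)`: positions and velocities of `N` particles and
positions of `M` external agents. -/
abbrev MicroState (D N M : ℕ) := Tuple D N × Tuple D N × Tuple D M

/-- The phase space `ℝ^{2D}` with points `z = (x, v)`. -/
abbrev Phase (D : ℕ) := Space D × Space D

/-- `L²(ℝ^{2D})` with respect to Lebesgue measure. -/
abbrev PhaseL2 (D : ℕ) := Lp ℝ 2 (volume : Measure (Phase D))

/-- Mean-field states `p = (f, d)`: phase space density and positions of the `M` agents. -/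
abbrev MeanFieldState (D M : ℕ) := PhaseL2 D × Tuple D M

/-! ### `H¹` functions of time with values in a Banach space -/

section Sobolev

variable {X : Type*} [NormedAddCommGroup X] [NormedSpace ℝ X]

/-- `f ∈ H¹([a,b]; X)` (continuous representative), with derivative `f' = g ∈ L²([a,b]; X)`. -/
def HasH1Deriv (a b : ℝ) (f g : ℝ → X) : Prop :=
  MemLp g 2 (volume.restrict (Icc a b)) ∧
    ∀ t ∈ Icc a b, f t = f a + ∫ s in a..t, g s

/-- `f ∈ H¹([a,b]; X)`. -/
def MemH1 (a b : ℝ) (f : ℝ → X) : Prop := ∃ g : ℝ → X, HasH1Deriv a b f g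

end Sobolev

/-! ### Data of the model -/

/-- The data of the control problems: interaction potentials `Φ₁` (between particles) and `Φ₂`
(between particles and agents), friction `α`, time horizon `T`, speed bound `umax`, weights
`σ₁, σ₂, σ₃`, desired destination and desired variances (microscopic and mean-field). -/
structure Model (D : ℕ) where
  Φ₁ : Space D → ℝ
  Φ₂ : Space D → ℝ
  α : ℝ
  T : ℝ
  umax : ℝ
  σ₁ : ℝ
  σ₂ : ℝ
  σ₃ : ℝ
  Edes : Space D
  VbarN : ℝ
  VbarInf : ℝ

/-- Assumption (A) on one potential. -/
structure AssumptionA {D : ℕ} (Φ : Space D → ℝ) : Prop where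
  radial : ∀ x y : Space D, ‖x‖ = ‖y‖ → Φ x = Φ y
  contDiff : ContDiff ℝ 1 Φ
  locallyLipschitz : LocallyLipschitz (gradient Φ)
  bounded : ∃ C : ℝ, ∀ x, ‖gradient Φ x‖ ≤ C

variable {D N M : ℕ}

/-- The interaction force `K(x, y) = (∇Φ)(x - y)`. -/
def force (Φ : Space D → ℝ) (x y : Space D) : Space D := gradient Φ (x - y)

/-- Admissible controls on `[a,b]`: `u ∈ L²([a,b]; ℝ^{MD})`, `|u_m(t)| ≤ umax` for a.e. `t`. -/
def Admissible (P : Model D) (a b : ℝ) (u : ℝ → Tuple D M) : Prop :=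
  MemLp u 2 (volume.restrict (Icc a b)) ∧
    ∀ᵐ t ∂(volume.restrict (Icc a b)), ∀ m : Fin M, ‖u t m‖ ≤ P.umax

/-! ### The microscopic problem -/

/-- `S_i(y) = -(1/N) ∑_{j ≠ i} K₁(x_i, x_j) - (1/M) ∑_m K₂(x_i, d_m) - α v_i`. -/
def microForce (P : Model D) (y : MicroState D N M) : Tuple D N :=
  WithLp.toLp 2 fun i : Fin N =>
    -((1 / (N : ℝ)) • ∑ j ∈ Finset.univ.erase i, force P.Φ₁ (y.1 i) (y.1 j))
      - (1 / (M : ℝ)) • ∑ m : Fin M, force P.Φ₂ (y.1 i) (y.2.2 m)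
      - P.α • y.2.1 i

/-- The right-hand side `F(y, u) = (v, S(y), u)` of the particle system. -/
def microField (P : Model D) (y : MicroState D N M) (u : Tuple D M) : MicroState D N M :=
  (y.2.1, microForce P y, u)

/-- The centre of mass of the particles. -/
def microMean (x : Tuple D N) : Space D := (1 / (N : ℝ)) • ∑ i : Fin N, x i

/-- The variance of the particles. -/
def microVar (x : Tuple D N) : ℝ := (1 / (N : ℝ)) * ∑ i : Fin N, ‖x i - microMean x‖ ^ 2

/-- The cost functional `J_N` on `[a,b]`. -/
def microCost (P : Model D) (a b : ℝ) (y : ℝ → MicroState D N M) (u : ℝ → Tuple D M) : ℝ :=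
  ∫ t in a..b,
    (P.σ₁ / (4 * P.T) * |microVar (y t).1 - P.VbarN| ^ 2
      + P.σ₂ / (2 * P.T) * ‖microMean (y t).1 - P.Edes‖ ^ 2
      + P.σ₃ / (2 * (M : ℝ)) * ‖u t‖ ^ 2)

/-- `y ∈ H¹`, `u` admissible, `y' = F(y, u)` on `[a,b]` and `y(a) = ya`. -/
def MicroFeasible (P : Model D) (a b : ℝ) (ya : MicroState D N M)
    (y : ℝ → MicroState D N M) (u : ℝ → Tuple D M) : Prop :=
  HasH1Deriv a b y (fun t => microField P (y t) (u t)) ∧ y a = ya ∧ Admissible P a b u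

/-- `(y, u)` is an optimal state-control pair of the microscopic problem on `[a,b]` with initial
value `ya`. -/
def MicroOptimal (P : Model D) (a b : ℝ) (ya : MicroState D N M)
    (y : ℝ → MicroState D N M) (u : ℝ → Tuple D M) : Prop :=
  MicroFeasible P a b ya y u ∧
    ∀ y' u', MicroFeasible P a b ya y' u' → microCost P a b y u ≤ microCost P a b y' u'

/-! ### The mean-field problem -/

/-- `S(μ)(x, v, d) = -∫ K₁(x, x̄) dμ(x̄, v̄) - (1/M) ∑_m K₂(x, d_m) - α v`. -/
def meanForce (P : Model D) (μ : Measure (Phase D)) (d : Tuple D M) (z : Phase D) : Space D :=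
  -(∫ w : Phase D, force P.Φ₁ z.1 w.1 ∂μ)
    - (1 / (M : ℝ)) • ∑ m : Fin M, force P.Φ₂ z.1 (d m)
    - P.α • z.2

/-- The measure with Lebesgue density `f`. -/
def densityMeasure (f : PhaseL2 D) : Measure (Phase D) :=
  volume.withDensity fun z => ENNReal.ofReal (f z)

/-- `f` is a probability density on the phase space. -/
def IsProbDensity (f : PhaseL2 D) : Prop :=
  (∀ᵐ z, 0 ≤ f z) ∧ IsProbabilityMeasure (densityMeasure f)

/-- `μ ∈ C([a,b]; P₁(ℝ^{2D}))`: Borel probability measures with finite first moment, continuous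
in the Wasserstein distance, i.e. tested against continuous functions of at most linear growth. -/
def ContinuousInP1 (a b : ℝ) (μ : ℝ → Measure (Phase D)) : Prop :=
  (∀ t ∈ Icc a b, IsProbabilityMeasure (μ t) ∧ Integrable (fun z : Phase D => ‖z‖) (μ t)) ∧
    ∀ φ : Phase D → ℝ, Continuous φ → (∃ C : ℝ, ∀ z, |φ z| ≤ C * (1 + ‖z‖)) →
      ContinuousOn (fun t => ∫ z, φ z ∂(μ t)) (Icc a b)

/-- Weak measure solutions of `∂ₜμ + v·∇ₓμ + ∇ᵥ·(S(μ)μ) = 0` on `[a,b]` with agents at `d`, tested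
with `h ∈ C_c^∞((-∞,b) × ℝ^{2D})`. The number `fderiv ℝ h (t, z) (1, (z.2, S))` is
`∂ₜh + v·∇ₓh + S·∇ᵥh` at `(t, z)`. -/
def IsWeakMeasureSolution (P : Model D) (a b : ℝ) (d : ℝ → Tuple D M)
    (μ : ℝ → Measure (Phase D)) : Prop :=
  ContinuousInP1 a b μ ∧
    ∀ h : ℝ × Phase D → ℝ, ContDiff ℝ ∞ h → HasCompactSupport h →
      tsupport h ⊆ Iio b ×ˢ univ →
      (∫ t in a..b, ∫ z : Phase D,
          fderiv ℝ h (t, z) (1, (z.2, meanForce P (μ t) (d t) z)) ∂(μ t))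
        + ∫ z, h (a, z) ∂(μ a) = 0

/-- The centre of mass of a phase space density. -/
def meanFieldMean (f : PhaseL2 D) : Space D := ∫ z : Phase D, f z • z.1

/-- The variance of a phase space density. -/
def meanFieldVar (f : PhaseL2 D) : ℝ := ∫ z : Phase D, ‖z.1 - meanFieldMean f‖ ^ 2 * f z

/-- The cost functional `J_∞` on `[a,b]`. -/
def meanFieldCost (P : Model D) (a b : ℝ) (p : ℝ → MeanFieldState D M) (w : ℝ → Tuple D M) : ℝ :=
  ∫ t in a..b,
    (P.σ₁ / (4 * P.T) * |meanFieldVar (p t).1 - P.VbarInf| ^ 2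
      + P.σ₂ / (2 * P.T) * ‖meanFieldMean (p t).1 - P.Edes‖ ^ 2
      + P.σ₃ / (2 * (M : ℝ)) * ‖w t‖ ^ 2)

/-- `f ∈ H¹([a,b]; L²(Ω))`, where `L²(Ω)` is the closed subspace of `L²(ℝ^{2D})` of the functions
that vanish a.e. outside `Ω`. -/
def MemH1L2On (Ω : Set (Phase D)) (a b : ℝ) (f : ℝ → PhaseL2 D) : Prop :=
  MemH1 a b f ∧ ∀ t ∈ Icc a b, ∀ᵐ z, z ∉ Ω → f t z = 0

/-- `p = (f, d) ∈ H¹(L²(Ω)) × H¹`, `w` admissible, `f` a probability density solving the Vlasov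
equation weakly, `d' = w` on `[a,b]`, and `p(a) = pa`. -/
def MeanFieldFeasible (P : Model D) (Ω : Set (Phase D)) (a b : ℝ) (pa : MeanFieldState D M)
    (p : ℝ → MeanFieldState D M) (w : ℝ → Tuple D M) : Prop :=
  MemH1L2On Ω a b (fun t => (p t).1) ∧
  (∀ t ∈ Icc a b, IsProbDensity (p t).1) ∧
  IsWeakMeasureSolution P a b (fun t => (p t).2) (fun t => densityMeasure (p t).1) ∧
  HasH1Deriv a b (fun t => (p t).2) w ∧
  p a = pa ∧
  Admissible P a b w

/-- `(p, w)` is an optimal state-control pair of the mean-field problem on `[a,b]` with initial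
value `pa`. -/
def MeanFieldOptimal (P : Model D) (Ω : Set (Phase D)) (a b : ℝ) (pa : MeanFieldState D M)
    (p : ℝ → MeanFieldState D M) (w : ℝ → Tuple D M) : Prop :=
  MeanFieldFeasible P Ω a b pa p w ∧
    ∀ p' w', MeanFieldFeasible P Ω a b pa p' w' →
      meanFieldCost P a b p w ≤ meanFieldCost P a b p' w'

/-! ### Assumption (B) -/

/-- Agent positions `d(t) = d₀ + ∫₀ᵗ w`. -/
def agentPath (d₀ : Tuple D M) (w : ℝ → Tuple D M) (t : ℝ) : Tuple D M :=
  d₀ + ∫ s in (0 : ℝ)..t, w s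

/-- `Z` is the nonlinear characteristic flow on `[0,T]`: `d/dt Z = (v, S(μ_t)(Z, d))`,
`μ_t = Z(t,·)_# μ₀`, `Z(0,·) = id`. -/
def IsNonlinearFlow (P : Model D) (μ₀ : Measure (Phase D)) (d : ℝ → Tuple D M)
    (Z : ℝ → Phase D → Phase D) : Prop :=
  (∀ t ∈ Icc 0 P.T, Measurable (Z t)) ∧
  (∀ z, Z 0 z = z) ∧
  ∀ z, ∀ t ∈ Icc 0 P.T,
    HasDerivWithinAt (fun s => Z s z)
      ((Z t z).2, meanForce P (μ₀.map (Z t)) (d t) (Z t z)) (Icc 0 P.T) t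

/-- `Z` is a `C¹` family, over `t ∈ [0,T]`, of (`C¹`-)diffeomorphisms of `ℝ^{2D}`. -/
def IsC1FamilyOfDiffeos (T : ℝ) (Z : ℝ → Phase D → Phase D) : Prop :=
  ContDiffOn ℝ 1 (fun q : ℝ × Phase D => Z q.1 q.2) (Icc 0 T ×ˢ univ) ∧
  ∀ t ∈ Icc 0 T, ContDiff ℝ 1 (Z t) ∧
    ∃ G : Phase D → Phase D, ContDiff ℝ 1 G ∧
      Function.LeftInverse G (Z t) ∧ Function.RightInverse G (Z t)

/-- Assumption (B): `f₀ ∈ L²` is a compactly supported probability density and, for every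
admissible control on `[0,T]`, the nonlinear flow is a `C¹` family of diffeomorphisms whose
push-forwards of `f₀` have densities `f ∈ H¹([0,T]; L²(ℝ^{2D}))`. The existence of the flow is
not assumed. -/
structure AssumptionB (P : Model D) (f₀ : PhaseL2 D) (d₀ : Tuple D M) : Prop where
  density : IsProbDensity f₀
  compactSupport : ∃ C : Set (Phase D), IsCompact C ∧ ∀ᵐ z, z ∉ C → f₀ z = 0
  flow : ∀ w : ℝ → Tuple D M, Admissible P 0 P.T w →
    ∀ Z : ℝ → Phase D → Phase D,
      IsNonlinearFlow P (densityMeasure f₀) (agentPath d₀ w) Z →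
      IsC1FamilyOfDiffeos P.T Z ∧
      ∃ f : ℝ → PhaseL2 D, MemH1 0 P.T f ∧
        ∀ t ∈ Icc 0 P.T, (∀ᵐ z, 0 ≤ f t z) ∧
          (densityMeasure f₀).map (Z t) = densityMeasure (f t)

/-- `Ω` carries the mean-field dynamics: for every admissible control on `[0,T]`, the
push-forward of `f₀` by the nonlinear flow is concentrated on `Ω` at all times `t ∈ [0,T]`. -/
def ContainsDynamics (P : Model D) (Ω : Set (Phase D)) (f₀ : PhaseL2 D) (d₀ : Tuple D M) : Prop :=
  ∀ w : ℝ → Tuple D M, Admissible P 0 P.T w →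
    ∀ Z : ℝ → Phase D → Phase D,
      IsNonlinearFlow P (densityMeasure f₀) (agentPath d₀ w) Z →
      ∀ t ∈ Icc 0 P.T, (densityMeasure f₀).map (Z t) Ωᶜ = 0

/-! ### Time slices -/

/-- Initial value on the `j`-th slice `[t j, t (j+1)]` (slices counted from `0`): the given initial
value on the first slice, and on later slices the final value on the preceding one. -/
def sliceStart {X : Type*} (t : ℕ → ℝ) (p₀ : X) (p : ℕ → ℝ → X) : ℕ → X
  | 0 => p₀
  | j + 1 => p j (t (j + 1))

/-- Successive optimal pairs `(y j, u j)` for the microscopic problem on the first `k` slices. -/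
def MicroChain (P : Model D) (t : ℕ → ℝ) (y₀ : MicroState D N M) (k : ℕ)
    (y : ℕ → ℝ → MicroState D N M) (u : ℕ → ℝ → Tuple D M) : Prop :=
  ∀ j < k, MicroOptimal P (t j) (t (j + 1)) (sliceStart t y₀ y j) (y j) (u j)

/-- Successive optimal pairs `(p j, w j)` for the mean-field problem on the first `k` slices. -/
def MeanFieldChain (P : Model D) (Ω : Set (Phase D)) (t : ℕ → ℝ) (p₀ : MeanFieldState D M)
    (k : ℕ) (p : ℕ → ℝ → MeanFieldState D M) (w : ℕ → ℝ → Tuple D M) : Prop :=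
  ∀ j < k, MeanFieldOptimal P Ω (t j) (t (j + 1)) (sliceStart t p₀ p j) (p j) (w j)

end Herding

end

noncomputable section

namespace Herding

open scoped NNReal

set_option linter.unusedSectionVars false

section

/-! ### Ordinary differential equations with fields of linear growth -/

section ODE

variable {E : Type*} [NormedAddCommGroup E] [NormedSpace ℝ E]

/-! Both problems are instances of one abstract control problem, solved by the direct method: x' =
F(x, d) in a Banach space, d = d₀ + ∫ u, where u takes values in a bounded closed convex set, with
cost ∫ c(x) + κ|u|². The control acts on the state only through its primitive d. A minimizing
sequence of controls has a weakly convergent subsequence in L². Testing with indicators of intervals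
turns this into pointwise convergence of the primitives, which is uniform because they are
equi-Lipschitz. If F is Lipschitz on balls and of linear growth (`IsTameSystem`), Gronwall's
inequality yields convergence of the states. The state cost then converges by dominated convergence,
and the quadratic control cost is weakly lower semicontinuous: this is `exists_optimal_control`.

For the particles the Banach space is finite dimensional, and (A) makes the system tame.

For the mean-field problem the Banach space is C(X; ℝ^{2D}), where X is a closed ball carrying the
measure ν at the start of the slice. A point β of this space records where the particle with label x
is now, and every particle feels the force of the image measure β_#ν (`meanSystem`). Two
translations connect this system with weak measure solutions.

From densities to labels: a feasible density solves the linear continuity equation whose field is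
frozen along that density. This field is only locally Lipschitz in the phase space point, so the
natural test functions, those constant along trajectories, are merely Lipschitz. They are
nevertheless admissible: mollifications have bounded derivatives that converge Lebesgue-almost
everywhere, hence almost everywhere for measures with densities. So feasible states are transported
by their characteristics (`eq_map_of_weakEquation`, `IsWeakMeasureSolution.exists_isFlow`).

From labels to densities: each control has a nonlinear flow (`exists_isFlow`), but the H¹ regularity
of the densities and their confinement to Ω come from hypotheses on flows of f₀ over all of [0, T].
The induction over slices therefore carries the invariant `IsReached`: the initial value of the
slice is the image of f₀ under the flow of an admissible control. Concatenating that control with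
the one on the slice, and with zero afterwards, makes (B) applicable (`IsReached.exists_feasible`).
Optimal pairs are feasible, and feasible states preserve the invariant. -/

/-- The radial retraction of a normed space onto the closed ball of radius `R`. -/
def radialRetract (R : ℝ) (x : E) : E := (R / max R ‖x‖) • x

lemma radialRetract_of_norm_le {R : ℝ} (hR : 0 < R) {x : E} (hx : ‖x‖ ≤ R) :
    radialRetract R x = x := by
  simp [radialRetract, max_eq_left hx, hR.ne']

lemma norm_radialRetract {R : ℝ} (hR : 0 < R) (x : E) :
    ‖radialRetract R x‖ = R / max R ‖x‖ * ‖x‖ := by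
  have h : 0 ≤ R / max R ‖x‖ := div_nonneg hR.le (hR.le.trans (le_max_left _ _))
  rw [radialRetract, norm_smul, Real.norm_of_nonneg h]

lemma norm_radialRetract_le {R : ℝ} (hR : 0 < R) (x : E) : ‖radialRetract R x‖ ≤ R := by
  have h : 0 < max R ‖x‖ := hR.trans_le (le_max_left _ _)
  rw [norm_radialRetract hR, div_mul_eq_mul_div, div_le_iff₀ h]
  exact mul_le_mul_of_nonneg_left (le_max_right _ _) hR.le

lemma norm_radialRetract_le_norm {R : ℝ} (hR : 0 < R) (x : E) : ‖radialRetract R x‖ ≤ ‖x‖ := by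
  have h : 0 < max R ‖x‖ := hR.trans_le (le_max_left _ _)
  rw [norm_radialRetract hR]
  exact mul_le_of_le_one_left (norm_nonneg _) ((div_le_one h).2 (le_max_left _ _))

/-- The difference of two values splits into a contracted copy of x - y and a change of the scaling
factor applied to y. Each part has norm at most ‖x - y‖, which gives the constant 2 in an arbitrary
normed space. -/
lemma lipschitzWith_radialRetract {R : ℝ} (hR : 0 < R) :
    LipschitzWith 2 (radialRetract R : E → E) := by
  refine LipschitzWith.of_dist_le_mul fun x y => ?_
  rw [dist_eq_norm, dist_eq_norm]
  set p := max R ‖x‖ with hp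
  set q := max R ‖y‖ with hq
  have hp0 : 0 < p := hR.trans_le (le_max_left _ _)
  have hq0 : 0 < q := hR.trans_le (le_max_left _ _)
  have hpq : |q - p| ≤ ‖x - y‖ := by
    calc |q - p| ≤ |‖y‖ - ‖x‖| := by
          have := abs_max_sub_max_le_max R ‖y‖ R ‖x‖
          simpa [hp, hq] using this
      _ ≤ ‖y - x‖ := abs_norm_sub_norm_le _ _
      _ = ‖x - y‖ := norm_sub_rev _ _
  have hdec : radialRetract R x - radialRetract R y
      = (R / p) • (x - y) + (R / p - R / q) • y := by
    simp only [radialRetract, ← hp, ← hq, smul_sub, sub_smul]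
    abel
  have h1 : ‖(R / p) • (x - y)‖ ≤ ‖x - y‖ := by
    rw [norm_smul, Real.norm_of_nonneg (div_nonneg hR.le hp0.le)]
    exact mul_le_of_le_one_left (norm_nonneg _) ((div_le_one hp0).2 (le_max_left _ _))
  have h2 : ‖(R / p - R / q) • y‖ ≤ ‖x - y‖ := by
    have e : R / p - R / q = R / p * ((q - p) / q) := by field_simp
    rw [norm_smul, e, norm_mul, norm_div (q - p) q, Real.norm_of_nonneg (div_nonneg hR.le hp0.le),
      Real.norm_eq_abs, Real.norm_of_nonneg hq0.le]
    have h3 : R / p ≤ 1 := (div_le_one hp0).2 (le_max_left _ _)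
    have h4 : |q - p| / q * ‖y‖ ≤ |q - p| := by
      rw [div_mul_eq_mul_div, div_le_iff₀ hq0]
      exact mul_le_mul_of_nonneg_left (le_max_right _ _) (abs_nonneg _)
    calc R / p * (|q - p| / q) * ‖y‖ = R / p * (|q - p| / q * ‖y‖) := by ring
      _ ≤ 1 * |q - p| := by gcongr
      _ ≤ ‖x - y‖ := by simpa using hpq
  calc ‖radialRetract R x - radialRetract R y‖ ≤ ‖x - y‖ + ‖x - y‖ := by
        rw [hdec]; exact (norm_add_le _ _).trans (add_le_add h1 h2)
    _ = ((2 : ℝ≥0) : ℝ) * ‖x - y‖ := by push_cast; ring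

/-- `x` solves `x' = f(t, x)` on `[a, b]`. -/
def IsSolutionOn (f : ℝ → E → E) (a b : ℝ) (x : ℝ → E) : Prop :=
  ∀ t ∈ Icc a b, HasDerivWithinAt x (f t (x t)) (Icc a b) t

lemma IsSolutionOn.continuousOn {f : ℝ → E → E} {a b : ℝ} {x : ℝ → E}
    (h : IsSolutionOn f a b x) : ContinuousOn x (Icc a b) :=
  fun t ht => (h t ht).continuousWithinAt

lemma IsSolutionOn.mono {f : ℝ → E → E} {a b a' b' : ℝ} {x : ℝ → E}
    (h : IsSolutionOn f a b x) (ha : a ≤ a') (hb : b' ≤ b) : IsSolutionOn f a' b' x :=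
  fun t ht => (h t (Icc_subset_Icc ha hb ht)).mono (Icc_subset_Icc ha hb)

lemma IsSolutionOn.congr {f g : ℝ → E → E} {a b : ℝ} {x : ℝ → E}
    (h : IsSolutionOn f a b x) (hfg : ∀ t ∈ Icc a b, f t (x t) = g t (x t)) :
    IsSolutionOn g a b x :=
  fun t ht => hfg t ht ▸ h t ht

lemma hasDerivWithinAt_Ici_of_Icc {a b t : ℝ} {x : ℝ → E} {x' : E} (ht : t ∈ Ico a b)
    (h : HasDerivWithinAt x x' (Icc a b) t) : HasDerivWithinAt x x' (Ici t) t :=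
  h.mono_of_mem_nhdsWithin (Icc_mem_nhdsGE_of_mem ht)

lemma IsSolutionOn.hasDerivWithinAt_Ici {f : ℝ → E → E} {a b : ℝ} {x : ℝ → E}
    (h : IsSolutionOn f a b x) : ∀ t ∈ Ico a b, HasDerivWithinAt x (f t (x t)) (Ici t) t :=
  fun t ht => hasDerivWithinAt_Ici_of_Icc ht (h t (Ico_subset_Icc_self ht))

/-- Solutions of an equation of linear growth are bounded a priori. -/
lemma norm_le_of_linearGrowth {a b A : ℝ} (hA : 0 ≤ A) {x x' : ℝ → E}
    (hx : ∀ t ∈ Icc a b, HasDerivWithinAt x (x' t) (Icc a b) t)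
    (hg : ∀ t ∈ Icc a b, ‖x' t‖ ≤ A * (1 + ‖x t‖)) {r : ℝ} (hr : ‖x a‖ ≤ r) :
    ∀ t ∈ Icc a b, ‖x t‖ ≤ gronwallBound r A A (b - a) := by
  intro t ht
  have h1 := norm_le_gronwallBound_of_norm_deriv_right_le (K := A) (ε := A)
    (fun t ht => (hx t ht).continuousWithinAt)
    (fun t ht => hasDerivWithinAt_Ici_of_Icc ht (hx t (Ico_subset_Icc_self ht))) hr
    (fun t ht => (hg t (Ico_subset_Icc_self ht)).trans_eq (by ring)) t ht
  exact h1.trans (gronwallBound_mono ((norm_nonneg _).trans hr) hA hA (by linarith [ht.2]))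

/-- Time-dependent fields on `[a, b]` that are Lipschitz on balls, continuous in time and of
linear growth. -/
structure IsTameField (f : ℝ → E → E) (a b : ℝ) : Prop where
  lipschitz : ∀ R : ℝ, ∃ K : ℝ≥0, ∀ t ∈ Icc a b, LipschitzOnWith K (f t) (Metric.closedBall 0 R)
  continuousOn : ∀ x, ContinuousOn (f · x) (Icc a b)
  growth : ∃ A : ℝ, 0 ≤ A ∧ ∀ t ∈ Icc a b, ∀ x, ‖f t x‖ ≤ A * (1 + ‖x‖)

/-- Global existence for bounded Lipschitz fields. -/
lemma exists_isSolutionOn_of_bounded [CompleteSpace E] {f : ℝ → E → E} {a b : ℝ} (hab : a ≤ b)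
    {K L : ℝ≥0} (hK : ∀ t ∈ Icc a b, LipschitzWith K (f t))
    (hc : ∀ x, ContinuousOn (f · x) (Icc a b)) (hL : ∀ t ∈ Icc a b, ∀ x, ‖f t x‖ ≤ L) (x₀ : E) :
    ∃ x : ℝ → E, x a = x₀ ∧ IsSolutionOn f a b x := by
  -- At speed at most L a trajectory cannot leave the ball of radius L(b - a) before time b, so the
  -- local theorem already covers the whole interval.
  have hP : IsPicardLindelof f (⟨a, left_mem_Icc.2 hab⟩ : Icc a b) x₀
      (L * (b - a).toNNReal) 0 L K :=
    { lipschitzOnWith := fun t ht => (hK t ht).lipschitzOnWith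
      continuousOn := fun x _ => hc x
      norm_le := fun t ht x _ => hL t ht x
      mul_max_le := by
        simp only [sub_self, NNReal.coe_mul, NNReal.coe_zero, sub_zero]
        rw [Real.coe_toNNReal _ (sub_nonneg.2 hab), max_eq_left (sub_nonneg.2 hab)] }
  obtain ⟨x, hx, hs⟩ := hP.exists_eq_forall_mem_Icc_hasDerivWithinAt₀
  exact ⟨x, hx, hs⟩

/-- Global existence for tame fields. -/
theorem exists_isSolutionOn [CompleteSpace E] {f : ℝ → E → E} {a b : ℝ} (hab : a ≤ b)
    (hf : IsTameField f a b) (x₀ : E) :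
    ∃ x : ℝ → E, x a = x₀ ∧ IsSolutionOn f a b x := by
  obtain ⟨A, hA, hg⟩ := hf.growth
  -- The field truncated at radius R keeps the growth constant A, so its solutions obey the Gronwall
  -- bound and stay where the truncation does nothing. The absolute value and the added 1 ensure R >
  -- 0.
  set R : ℝ := |gronwallBound ‖x₀‖ A A (b - a)| + 1 with hRdef
  have hR : 0 < R := by positivity
  obtain ⟨K, hK⟩ := hf.lipschitz R
  have hmem : ∀ x : E, radialRetract R x ∈ Metric.closedBall (0 : E) R := fun x => by
    simpa using norm_radialRetract_le hR x
  obtain ⟨x, hx0, hx⟩ := exists_isSolutionOn_of_bounded (f := fun t x => f t (radialRetract R x))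
    hab (K := K * 2) (L := (A * (1 + R)).toNNReal)
    (fun t ht => by
      have := (hK t ht).comp (lipschitzWith_radialRetract hR).lipschitzOnWith
        (s := univ) (fun x _ => hmem x)
      exact lipschitzOnWith_univ.1 this)
    (fun x => hf.continuousOn _)
    (fun t ht x => by
      rw [Real.coe_toNNReal _ (by positivity)]
      exact (hg t ht _).trans (by gcongr; exact norm_radialRetract_le hR x)) x₀
  have hb : ∀ t ∈ Icc a b, ‖x t‖ ≤ R := fun t ht =>
    (norm_le_of_linearGrowth hA hx (fun t ht => (hg t ht _).trans
      (by gcongr; exact norm_radialRetract_le_norm hR _)) (by rw [hx0]) t ht).trans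
      ((le_abs_self _).trans (by rw [hRdef]; linarith))
  exact ⟨x, hx0, hx.congr fun t ht => by rw [radialRetract_of_norm_le hR (hb t ht)]⟩

lemma IsSolutionOn.exists_norm_le {f : ℝ → E → E} {a b : ℝ} {x : ℝ → E}
    (h : IsSolutionOn f a b x) : ∃ R, ∀ t ∈ Icc a b, ‖x t‖ ≤ R :=
  isCompact_Icc.exists_bound_of_continuousOn h.continuousOn

/-- Uniqueness for tame fields. -/
theorem IsSolutionOn.eqOn {f : ℝ → E → E} {a b : ℝ} (hf : IsTameField f a b) {x y : ℝ → E}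
    (hx : IsSolutionOn f a b x) (hy : IsSolutionOn f a b y) (h : x a = y a) :
    EqOn x y (Icc a b) := by
  obtain ⟨R, hR⟩ := hx.exists_norm_le
  obtain ⟨R', hR'⟩ := hy.exists_norm_le
  obtain ⟨K, hK⟩ := hf.lipschitz (max R R')
  exact ODE_solution_unique_of_mem_Icc_right
    (fun t ht => hK t (Ico_subset_Icc_self ht)) hx.continuousOn hx.hasDerivWithinAt_Ici
    (fun t ht => by simpa using Or.inl (hR t (Ico_subset_Icc_self ht))) hy.continuousOn
    hy.hasDerivWithinAt_Ici
    (fun t ht => by simpa using Or.inr (hR' t (Ico_subset_Icc_self ht))) h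

end ODE

end

section

/-! ### Optimal control of systems driven by the primitive of the control -/

section WeakCompactness

variable {H : Type*} [NormedAddCommGroup H] [InnerProductSpace ℝ H] [CompleteSpace H]

/-- A weak limit of points of a closed convex set belongs to the set. -/
lemma mem_of_forall_tendsto_inner {C : Set H} (hC : Convex ℝ C) (hcl : IsClosed C)
    {w : ℕ → H} (hw : ∀ n, w n ∈ C) {v : H}
    (hv : ∀ g, Tendsto (fun n => inner ℝ g (w n)) atTop (𝓝 (inner ℝ g v))) : v ∈ C := by
  -- For the projection p of v onto C, the variational inequality ⟨v - p, w n - p⟩ ≤ 0 survives the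
  -- weak limit and becomes ‖v - p‖² ≤ 0.
  obtain ⟨p, hp, hpm⟩ := exists_norm_eq_iInf_of_complete_convex ⟨w 0, hw 0⟩
    hcl.isComplete hC v
  have h1 := (norm_eq_iInf_iff_real_inner_le_zero hC hp).1 hpm
  have h2 : Tendsto (fun n => inner ℝ (v - p) (w n - p)) atTop (𝓝 (inner ℝ (v - p) (v - p))) := by
    simpa only [inner_sub_right] using (hv (v - p)).sub_const _
  have h3 : inner ℝ (v - p) (v - p) ≤ 0 := le_of_tendsto' h2 fun n => h1 _ (hw n)
  have h4 : v - p = 0 := by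
    rw [real_inner_self_eq_norm_sq] at h3
    have : ‖v - p‖ = 0 := by nlinarith [norm_nonneg (v - p)]
    exact norm_eq_zero.1 this
  rw [sub_eq_zero.1 h4]
  exact hp

/-- Bounded closed convex subsets of a separable Hilbert space are weakly sequentially compact. -/
lemma exists_subseq_tendsto_inner [TopologicalSpace.SeparableSpace H] {C : Set H}
    (hC : Convex ℝ C) (hcl : IsClosed C) (hb : Bornology.IsBounded C)
    {w : ℕ → H} (hw : ∀ n, w n ∈ C) :
    ∃ v ∈ C, ∃ φ : ℕ → ℕ, StrictMono φ ∧
      ∀ g, Tendsto (fun n => inner ℝ g (w (φ n))) atTop (𝓝 (inner ℝ g v)) := by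
  obtain ⟨R, hR⟩ := hb.exists_norm_le
  -- The Riesz isomorphism turns weak into weak-* convergence, for which closed balls are
  -- sequentially compact by separability.
  let ℓ : ℕ → WeakDual ℝ H := fun n =>
    StrongDual.toWeakDual (InnerProductSpace.toDual ℝ H (w n))
  obtain ⟨L, -, φ, hφ, hL⟩ := (WeakDual.isSeqCompact_closedBall ℝ H 0 R)
    (x := ℓ) (fun n => by
      simpa [ℓ] using hR _ (hw n))
  set v : H := (InnerProductSpace.toDual ℝ H).symm (WeakDual.toStrongDual L) with hv
  have key : ∀ g, Tendsto (fun n => inner ℝ g (w (φ n))) atTop (𝓝 (inner ℝ g v)) := fun g => by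
    have h1 := ((WeakDual.eval_continuous (𝕜 := ℝ) g).tendsto L).comp hL
    have h2 : L g = inner ℝ g v := by
      rw [real_inner_comm, hv, InnerProductSpace.toDual_symm_apply]; rfl
    rw [← h2]
    refine h1.congr fun n => ?_
    show inner ℝ (w (φ n)) g = _
    rw [real_inner_comm]
  exact ⟨v, mem_of_forall_tendsto_inner hC hcl (fun n => hw (φ n)) key, φ, hφ, key⟩

end WeakCompactness

/-! ### Tame control systems and continuous dependence on the parameter path -/

section Control

variable {E : Type*} [NormedAddCommGroup E] [NormedSpace ℝ E]
variable {U : Type*} [NormedAddCommGroup U] [InnerProductSpace ℝ U] [FiniteDimensional ℝ U]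

/-- Systems `x' = F(x, d)` whose right-hand side is Lipschitz on balls and of linear growth in `x`,
uniformly in the parameter `d`. -/
structure IsTameSystem (F : E → U → E) : Prop where
  lipschitz : ∀ R : ℝ, ∃ K : ℝ≥0, ∀ x y : E, ∀ d e : U, ‖x‖ ≤ R → ‖y‖ ≤ R → ‖d‖ ≤ R → ‖e‖ ≤ R →
    ‖F x d - F y e‖ ≤ K * (‖x - y‖ + ‖d - e‖)
  growth : ∃ A : ℝ, 0 ≤ A ∧ ∀ x d, ‖F x d‖ ≤ A * (1 + ‖x‖)

lemma IsTameSystem.continuous {F : E → U → E} (hF : IsTameSystem F) :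
    Continuous fun q : E × U => F q.1 q.2 := by
  refine continuous_iff_continuousAt.2 fun q => ?_
  obtain ⟨K, hK⟩ := hF.lipschitz (‖q‖ + 1)
  rw [ContinuousAt, tendsto_iff_norm_sub_tendsto_zero]
  have h1 : Tendsto (fun p : E × U => (K : ℝ) * (‖p.1 - q.1‖ + ‖p.2 - q.2‖)) (𝓝 q) (𝓝 0) := by
    have : Continuous (fun p : E × U => (K : ℝ) * (‖p.1 - q.1‖ + ‖p.2 - q.2‖)) := by fun_prop
    simpa using this.tendsto q
  refine squeeze_zero' (Eventually.of_forall fun _ => norm_nonneg _) ?_ h1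
  have h2 : ∀ᶠ p in 𝓝 q, ‖p‖ < ‖q‖ + 1 :=
    continuous_norm.continuousAt.eventually_lt continuousAt_const (by linarith)
  filter_upwards [h2] with p hp
  have b1 := norm_fst_le p
  have b2 := norm_snd_le p
  have b3 := norm_fst_le q
  have b4 := norm_snd_le q
  exact hK _ _ _ _ (by linarith) (by linarith) (by linarith) (by linarith)

lemma IsTameSystem.isTameField {F : E → U → E} (hF : IsTameSystem F) {a b : ℝ} {d : ℝ → U}
    (hd : ContinuousOn d (Icc a b)) : IsTameField (fun t x => F x (d t)) a b where
  lipschitz R := by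
    obtain ⟨R', hR'⟩ := isCompact_Icc.exists_bound_of_continuousOn hd
    obtain ⟨K, hK⟩ := hF.lipschitz (max R R')
    refine ⟨K, fun t ht => LipschitzOnWith.of_dist_le_mul fun x hx y hy => ?_⟩
    have := hK x y (d t) (d t) (le_max_of_le_left (by simpa using hx))
      (le_max_of_le_left (by simpa using hy)) (le_max_of_le_right (hR' t ht))
      (le_max_of_le_right (hR' t ht))
    simpa [dist_eq_norm] using this
  continuousOn x := hF.continuous.comp_continuousOn (continuousOn_const.prodMk hd)
  growth := by
    obtain ⟨A, hA, h⟩ := hF.growth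
    exact ⟨A, hA, fun t _ x => h x (d t)⟩

/-- Continuous dependence of solutions on the parameter path. -/
lemma tendsto_of_tendstoUniformlyOn {F : E → U → E} (hF : IsTameSystem F) {a b : ℝ}
    {d : ℝ → U} {dn : ℕ → ℝ → U} (hd : ContinuousOn d (Icc a b))
    (hlim : TendstoUniformlyOn dn d atTop (Icc a b))
    {x : ℝ → E} {xn : ℕ → ℝ → E} (hx : IsSolutionOn (fun t x => F x (d t)) a b x)
    (hxn : ∀ n, IsSolutionOn (fun t x => F x (dn n t)) a b (xn n))
    (h0 : ∀ n, xn n a = x a) :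
    (∃ R, ∀ t ∈ Icc a b, ‖x t‖ ≤ R ∧ ∀ n, ‖xn n t‖ ≤ R) ∧
      ∀ t ∈ Icc a b, Tendsto (fun n => xn n t) atTop (𝓝 (x t)) := by
  obtain ⟨A, hA, hg⟩ := hF.growth
  set R := gronwallBound ‖x a‖ A A (b - a) with hR
  have hbx : ∀ t ∈ Icc a b, ‖x t‖ ≤ R :=
    norm_le_of_linearGrowth hA hx (fun t _ => hg _ _) le_rfl
  have hbn : ∀ n, ∀ t ∈ Icc a b, ‖xn n t‖ ≤ R := fun n =>
    norm_le_of_linearGrowth hA (hxn n) (fun t _ => hg _ _) (by rw [h0])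
  refine ⟨⟨R, fun t ht => ⟨hbx t ht, fun n => hbn n t ht⟩⟩, fun t ht => ?_⟩
  obtain ⟨D, hD⟩ := isCompact_Icc.exists_bound_of_continuousOn hd
  -- All trajectories stay in the ball of radius R. Parameter paths within distance 1 of d stay in
  -- the ball of radius D + 1.
  obtain ⟨K, hK⟩ := hF.lipschitz (max R (D + 1))
  rw [Metric.tendsto_atTop]
  intro η hη
  -- If the parameter paths differ by less than ε, then `xn n` solves the limit equation up to a
  -- defect K * ε, while `x` solves it exactly (the summand 0) and the initial values agree. The
  -- resulting Gronwall bound vanishes as ε → 0.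
  have hcont : Tendsto (fun ε : ℝ => gronwallBound 0 K (K * ε + 0) (t - a)) (𝓝[>] 0) (𝓝 0) := by
    have h1 : Continuous fun ε : ℝ => gronwallBound 0 K (K * ε + 0) (t - a) :=
      (gronwallBound_continuous_ε 0 K (t - a)).comp (by fun_prop)
    have h2 := h1.tendsto 0
    simp only [mul_zero, add_zero, gronwallBound_ε0_δ0] at h2
    simpa using h2.mono_left nhdsWithin_le_nhds
  obtain ⟨ε, hε1, hε0, hε2⟩ : ∃ ε : ℝ, gronwallBound 0 K (K * ε + 0) (t - a) < η ∧ 0 < ε ∧ ε < 1 := by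
    have h3 := (hcont.eventually (gt_mem_nhds hη)).and
      (Ioo_mem_nhdsGT (show (0 : ℝ) < 1 by norm_num))
    obtain ⟨ε, h⟩ := h3.exists
    exact ⟨ε, h.1, h.2.1, h.2.2⟩
  obtain ⟨N, hN⟩ := eventually_atTop.1 (Metric.tendstoUniformlyOn_iff.1 hlim ε hε0)
  refine ⟨N, fun n hn => lt_of_le_of_lt ?_ hε1⟩
  have hsub : ∀ s ∈ Ico a b, s ∈ Icc a b := fun s hs => Ico_subset_Icc_self hs
  refine dist_le_of_approx_trajectories_ODE_of_mem (v := fun t x => F x (d t))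
    (s := fun _ => Metric.closedBall 0 R) (K := K) ?_ (hxn n).continuousOn
    (hxn n).hasDerivWithinAt_Ici ?_ ?_ hx.continuousOn hx.hasDerivWithinAt_Ici ?_ ?_ ?_ t ht
  · intro s hs
    refine LipschitzOnWith.of_dist_le_mul fun y hy z hz => ?_
    have hds : ‖d s‖ ≤ max R (D + 1) := le_max_of_le_right (by linarith [hD s (hsub s hs)])
    have := hK y z (d s) (d s) (le_max_of_le_left (by simpa using hy))
      (le_max_of_le_left (by simpa using hz)) hds hds
    simpa [dist_eq_norm] using this
  · intro s hs
    have h1 := hN n hn s (hsub s hs)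
    rw [dist_eq_norm] at h1 ⊢
    have h2 : ‖dn n s‖ ≤ D + 1 := by
      have := norm_le_norm_add_norm_sub (d s) (dn n s)
      have h3 := hD s (hsub s hs)
      linarith
    have h4 := hK (xn n s) (xn n s) (dn n s) (d s) (le_max_of_le_left (hbn n s (hsub s hs)))
      (le_max_of_le_left (hbn n s (hsub s hs))) (le_max_of_le_right h2)
      (le_max_of_le_right (by linarith [hD s (hsub s hs)]))
    rw [sub_self, norm_zero, zero_add, norm_sub_rev (dn n s)] at h4
    exact h4.trans (by gcongr)
  · intro s hs
    simpa using hbn n s (hsub s hs)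
  · intro s hs
    simp
  · intro s hs
    simpa using hbx s (hsub s hs)
  · simp [h0]

end Control

end

/-! ### Weak compactness of controls and existence of minimizers -/

section

/-- Pointwise convergence of equi-Lipschitz functions on a compact interval is uniform. -/
lemma tendstoUniformlyOn_of_lipschitzOnWith {V : Type*} [PseudoMetricSpace V] {a b : ℝ} {C : ℝ≥0}
    {f : ℕ → ℝ → V} {g : ℝ → V} (hf : ∀ n, LipschitzOnWith C (f n) (Icc a b))
    (h : ∀ t ∈ Icc a b, Tendsto (fun n => f n t) atTop (𝓝 (g t))) :
    TendstoUniformlyOn f g atTop (Icc a b) := by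
  have heq : EquicontinuousOn f (Icc a b) :=
    (LipschitzOnWith.uniformEquicontinuousOn f C hf).equicontinuousOn
  -- On a compact set, uniform and pointwise convergence of an equicontinuous family are the same.
  have key := EquicontinuousOn.tendsto_uniformOnFun_iff_pi' (𝔖 := {Icc a b})
    (by rintro K rfl; exact isCompact_Icc) (by rintro K rfl; exact heq) (atTop : Filter ℕ) g
  rw [UniformOnFun.tendsto_iff_tendstoUniformlyOn] at key
  refine key.2 ?_ (Icc a b) rfl
  rw [tendsto_pi_nhds]
  rintro ⟨t, ht⟩
  exact h t (by simpa using ht)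

section Control

variable {U : Type*} [NormedAddCommGroup U] [InnerProductSpace ℝ U] [FiniteDimensional ℝ U]

/-- Square integrable controls on `[a, b]` with values in `S`. -/
def IsControl (S : Set U) (a b : ℝ) (u : ℝ → U) : Prop :=
  MemLp u 2 (volume.restrict (Icc a b)) ∧ ∀ᵐ t ∂(volume.restrict (Icc a b)), u t ∈ S

/-- The primitive of a control. -/
def controlPath (a : ℝ) (d₀ : U) (u : ℝ → U) (t : ℝ) : U := d₀ + ∫ s in a..t, u s

lemma integrableOn_of_memLp {V : Type*} [NormedAddCommGroup V] {a b : ℝ} {u : ℝ → V}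
    (hu : MemLp u 2 (volume.restrict (Icc a b))) : IntegrableOn u (Icc a b) :=
  hu.integrable (by norm_num)

lemma intervalIntegrable_of_memLp {V : Type*} [NormedAddCommGroup V] {a b s t : ℝ} {u : ℝ → V}
    (hu : MemLp u 2 (volume.restrict (Icc a b))) (hs : s ∈ Icc a b) (ht : t ∈ Icc a b) :
    IntervalIntegrable u volume s t :=
  ((integrableOn_of_memLp hu).mono_set (uIcc_subset_Icc hs ht)).intervalIntegrable

lemma lipschitzOnWith_controlPath {S : Set U} {C : ℝ≥0} (hC : ∀ x ∈ S, ‖x‖ ≤ C) {a b : ℝ}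
    {u : ℝ → U} (hu : IsControl S a b u) (d₀ : U) :
    LipschitzOnWith C (controlPath a d₀ u) (Icc a b) := by
  refine LipschitzOnWith.of_dist_le_mul fun t ht s hs => ?_
  have ha : a ∈ Icc a b := left_mem_Icc.2 (ht.1.trans ht.2)
  rw [dist_eq_norm, controlPath, controlPath, add_sub_add_left_eq_sub,
    intervalIntegral.integral_interval_sub_left (intervalIntegrable_of_memLp hu.1 ha ht)
      (intervalIntegrable_of_memLp hu.1 ha hs), Real.dist_eq]
  refine intervalIntegral.norm_integral_le_of_norm_le_const_ae ?_
  have := (ae_restrict_iff' measurableSet_Icc).1 hu.2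
  filter_upwards [this] with r hr hr'
  exact hC _ (hr (uIcc_subset_Icc hs ht (uIoc_subset_uIcc hr')))

/-- An L² limit is an almost everywhere limit along a subsequence, and the closed set S keeps
pointwise limits. Together with convexity this makes the constraint stable under weak limits. -/
lemma isClosed_ae_mem {X : Type*} [MeasurableSpace X] {μ : Measure X} {S : Set U}
    (hS : IsClosed S) : IsClosed {f : Lp U 2 μ | ∀ᵐ t ∂μ, f t ∈ S} := by
  refine isClosed_of_closure_subset fun f hf => ?_
  obtain ⟨fn, hfn, hlim⟩ := mem_closure_iff_seq_limit.1 hf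
  obtain ⟨ns, -, hns⟩ := (tendstoInMeasure_of_tendsto_Lp hlim).exists_seq_tendsto_ae
  filter_upwards [hns, ae_all_iff.2 hfn] with t h1 h2
  exact hS.mem_of_tendsto h1 (Eventually.of_forall fun n => h2 _)

lemma convex_ae_mem {X : Type*} [MeasurableSpace X] {μ : Measure X} {S : Set U}
    (hS : Convex ℝ S) : Convex ℝ {f : Lp U 2 μ | ∀ᵐ t ∂μ, f t ∈ S} := by
  intro f hf g hg p q hp hq hpq
  show ∀ᵐ t ∂μ, (p • f + q • g : Lp U 2 μ) t ∈ S
  filter_upwards [hf, hg, Lp.coeFn_add (p • f) (q • g), Lp.coeFn_smul p f, Lp.coeFn_smul q g]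
    with t h1 h2 h3 h4 h5
  rw [h3, Pi.add_apply, h4, h5]
  exact hS h1 h2 hp hq hpq

lemma isBounded_ae_mem {X : Type*} [MeasurableSpace X] {μ : Measure X} [IsFiniteMeasure μ]
    {S : Set U} (hS : Bornology.IsBounded S) :
    Bornology.IsBounded {f : Lp U 2 μ | ∀ᵐ t ∂μ, f t ∈ S} := by
  obtain ⟨C, hC⟩ := hS.exists_norm_le
  have h : ∀ f ∈ {f : Lp U 2 μ | ∀ᵐ t ∂μ, f t ∈ S}, ‖f‖ ≤
      (measureUnivNNReal μ : ℝ) ^ (ENNReal.toReal 2)⁻¹ * max C 0 := fun f hf => by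
    refine Lp.norm_le_of_ae_bound (le_max_right _ _) ?_
    filter_upwards [hf] with t ht using (hC _ ht).trans (le_max_left _ _)
  exact isBounded_iff_forall_norm_le.2 ⟨_, h⟩

lemma setIntegral_Icc_sq_eq {a b : ℝ} {u : ℝ → U} (hu : MemLp u 2 (volume.restrict (Icc a b))) :
    ∫ t in Icc a b, ‖u t‖ ^ 2 = ‖hu.toLp u‖ ^ 2 := by
  rw [← real_inner_self_eq_norm_sq, L2.inner_def]
  refine integral_congr_ae ?_
  filter_upwards [hu.coeFn_toLp] with t ht
  rw [ht, real_inner_self_eq_norm_sq]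

lemma tendsto_of_forall_tendsto_inner {u : ℕ → U} {v : U}
    (h : ∀ e, Tendsto (fun n => inner ℝ e (u n)) atTop (𝓝 (inner ℝ e v))) :
    Tendsto u atTop (𝓝 v) := by
  let e := stdOrthonormalBasis ℝ U
  have h1 : Tendsto (fun n => ∑ i, inner ℝ (e i) (u n) • e i) atTop
      (𝓝 (∑ i, inner ℝ (e i) v • e i)) :=
    tendsto_finsetSum _ fun i _ => (h (e i)).smul_const _
  simpa only [e.sum_repr'] using h1

/-- Weak sequential compactness of the square integrable functions with values in a bounded closed
convex set. -/
lemma exists_subseq_tendsto_inner_Lp {S : Set U} (hSc : Convex ℝ S) (hScl : IsClosed S)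
    (hSb : Bornology.IsBounded S) {μ : Measure ℝ} [IsFiniteMeasure μ] {w : ℕ → Lp U 2 μ}
    (hw : ∀ n, ∀ᵐ t ∂μ, w n t ∈ S) :
    ∃ v : Lp U 2 μ, (∀ᵐ t ∂μ, v t ∈ S) ∧ ∃ φ : ℕ → ℕ, StrictMono φ ∧
      ∀ g : Lp U 2 μ, Tendsto (fun n => inner ℝ g (w (φ n))) atTop (𝓝 (inner ℝ g v)) := by
  have : Fact ((2 : ENNReal) ≠ ⊤) := ⟨by norm_num⟩
  obtain ⟨v, hv, φ, hφ, hlim⟩ := exists_subseq_tendsto_inner (H := Lp U 2 μ)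
    (convex_ae_mem (μ := μ) hSc) (isClosed_ae_mem hScl) (isBounded_ae_mem hSb) (w := w) hw
  exact ⟨v, hv, φ, hφ, hlim⟩

/-- Weak L² convergence tested with these functions is convergence of each component of the
primitive at time t. -/
lemma inner_indicatorConstLp_eq_inner_intervalIntegral {a b t : ℝ} (ht : t ∈ Icc a b) (e : U)
    (g : Lp U 2 (volume.restrict (Icc a b))) :
    inner ℝ (indicatorConstLp 2 (measurableSet_Ioc (a := a) (b := t)) (measure_ne_top _ _) e) g
      = inner ℝ e (∫ s in a..t, g s) := by
  have hsub : Ioc a t ⊆ Icc a b := fun s hs => ⟨hs.1.le, hs.2.trans ht.2⟩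
  rw [L2.inner_indicatorConstLp_eq_inner_setIntegral, intervalIntegral.integral_of_le ht.1,
    Measure.restrict_restrict measurableSet_Ioc, inter_eq_self_of_subset_left hsub]

lemma intervalIntegral_coeFn_toLp {a b t : ℝ} (ht : t ∈ Icc a b) {u : ℝ → U}
    (hu : MemLp u 2 (volume.restrict (Icc a b))) :
    ∫ s in a..t, hu.toLp u s = ∫ s in a..t, u s := by
  have hsub : Ioc a t ⊆ Icc a b := fun s hs => ⟨hs.1.le, hs.2.trans ht.2⟩
  rw [intervalIntegral.integral_of_le ht.1, intervalIntegral.integral_of_le ht.1]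
  exact integral_congr_ae (ae_restrict_of_ae_restrict_of_subset hsub hu.coeFn_toLp)

/-- Weak sequential compactness of bounded controls, with uniform convergence of the primitives
and lower semicontinuity of the control cost. -/
lemma exists_subseq_control {S : Set U} (hSc : Convex ℝ S) (hScl : IsClosed S)
    (hSb : Bornology.IsBounded S) {a b : ℝ} {u : ℕ → ℝ → U} (hu : ∀ n, IsControl S a b (u n))
    (d₀ : U) :
    ∃ v : ℝ → U, IsControl S a b v ∧ ∃ φ : ℕ → ℕ, StrictMono φ ∧
      TendstoUniformlyOn (fun n => controlPath a d₀ (u (φ n))) (controlPath a d₀ v) atTop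
        (Icc a b) ∧
      ∃ l : ℕ → ℝ, (∀ n, l n ≤ ∫ t in Icc a b, ‖u (φ n) t‖ ^ 2) ∧
        Tendsto l atTop (𝓝 (∫ t in Icc a b, ‖v t‖ ^ 2)) := by
  obtain ⟨C, hC⟩ := hSb.exists_norm_le
  obtain ⟨v, hv, φ, hφ, hlim⟩ := exists_subseq_tendsto_inner_Lp hSc hScl hSb
    (w := fun n => (hu n).1.toLp (u n)) (fun n => by
      filter_upwards [(hu n).1.coeFn_toLp, (hu n).2] with t h1 h2
      rwa [h1])
  refine ⟨v, ⟨Lp.memLp v, hv⟩, φ, hφ, ?_, ?_⟩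
  · refine tendstoUniformlyOn_of_lipschitzOnWith (C := C.toNNReal)
      (fun n => lipschitzOnWith_controlPath (fun x hx => (hC x hx).trans (Real.le_coe_toNNReal C))
        (hu _) d₀) fun t ht => ?_
    refine Tendsto.const_add _ (tendsto_of_forall_tendsto_inner fun e => ?_)
    have h1 := hlim (indicatorConstLp 2 (measurableSet_Ioc (a := a) (b := t))
      (measure_ne_top _ _) e)
    simp only [inner_indicatorConstLp_eq_inner_intervalIntegral ht,
      intervalIntegral_coeFn_toLp ht] at h1
    exact h1
  -- Weak lower semicontinuity in explicit form: ‖v - uₙ‖² ≥ 0 bounds ‖uₙ‖² from below by 2⟨v, uₙ⟩ -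
  -- ‖v‖², which is affine in uₙ and so converges, with limit ‖v‖².
  · refine ⟨fun n => 2 * inner ℝ v ((hu (φ n)).1.toLp (u (φ n))) - ‖v‖ ^ 2, fun n => ?_, ?_⟩
    · rw [setIntegral_Icc_sq_eq (hu (φ n)).1]
      have h1 := norm_sub_sq_real v ((hu (φ n)).1.toLp (u (φ n)))
      nlinarith [sq_nonneg ‖v - (hu (φ n)).1.toLp (u (φ n))‖]
    · have h1 : ∫ t in Icc a b, ‖v t‖ ^ 2 = 2 * inner ℝ v v - ‖v‖ ^ 2 := by
        have h2 := setIntegral_Icc_sq_eq (Lp.memLp v)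
        rw [Lp.toLp_coeFn] at h2
        rw [h2, real_inner_self_eq_norm_sq]
        ring
      rw [h1]
      exact ((hlim v).const_mul 2).sub_const _

variable {E : Type*} [NormedAddCommGroup E] [NormedSpace ℝ E] [CompleteSpace E]

/-- The cost of a state-control pair. -/
def controlCost (c : E → ℝ) (κ a b : ℝ) (x : ℝ → E) (u : ℝ → U) : ℝ :=
  ∫ t in a..b, (c (x t) + κ * ‖u t‖ ^ 2)

lemma controlCost_eq {c : E → ℝ} (hc : Continuous c) {κ a b : ℝ} (hab : a ≤ b) {x : ℝ → E}
    (hx : ContinuousOn x (Icc a b)) {u : ℝ → U} (hu : MemLp u 2 (volume.restrict (Icc a b))) :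
    controlCost c κ a b x u
      = (∫ t in Icc a b, c (x t)) + κ * ∫ t in Icc a b, ‖u t‖ ^ 2 := by
  rw [controlCost, intervalIntegral.integral_of_le hab, ← integral_Icc_eq_integral_Ioc,
    integral_add, integral_const_mul]
  · exact (hc.comp_continuousOn hx).integrableOn_compact isCompact_Icc
  · exact hu.integrable_norm_pow (by norm_num) |>.const_mul κ

/-- The state equation `x' = F(x, d)`, `d = d₀ + ∫ u`, `x(a) = x₀`. -/
def IsState (F : E → U → E) (a b : ℝ) (x₀ : E) (d₀ : U) (x : ℝ → E) (u : ℝ → U) : Prop :=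
  x a = x₀ ∧ IsSolutionOn (fun t x => F x (controlPath a d₀ u t)) a b x

lemma IsControl.continuousOn_controlPath {S : Set U} {a b : ℝ} {u : ℝ → U}
    (hu : IsControl S a b u) (d₀ : U) : ContinuousOn (controlPath a d₀ u) (Icc a b) := by
  intro t ht
  refine (continuousOn_const.add ((intervalIntegral.continuousOn_primitive_interval ?_).mono
    Icc_subset_uIcc)) t ht
  rw [uIcc_of_le (ht.1.trans ht.2)]
  exact integrableOn_of_memLp hu.1

/-- Existence of optimal controls. -/
theorem exists_optimal_control {F : E → U → E} (hF : IsTameSystem F) {c : E → ℝ}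
    (hc : Continuous c) (hc0 : ∀ x, 0 ≤ c x) (hcb : ∀ R : ℝ, ∃ B, ∀ x, ‖x‖ ≤ R → c x ≤ B)
    {κ : ℝ} (hκ : 0 ≤ κ) {S : Set U} (hSc : Convex ℝ S) (hScl : IsClosed S)
    (hSb : Bornology.IsBounded S) (hSne : S.Nonempty) {a b : ℝ} (hab : a ≤ b) (x₀ : E) (d₀ : U) :
    ∃ u : ℝ → U, IsControl S a b u ∧ ∀ x, IsState F a b x₀ d₀ x u →
      ∀ x' u', IsControl S a b u' → IsState F a b x₀ d₀ x' u' →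
        controlCost c κ a b x u ≤ controlCost c κ a b x' u' := by
  set V : Set ℝ := {r | ∃ x u, IsControl S a b u ∧ IsState F a b x₀ d₀ x u ∧
    controlCost c κ a b x u = r} with hV
  have hstate : ∀ u, IsControl S a b u → ∃ x, IsState F a b x₀ d₀ x u := fun u hu =>
    exists_isSolutionOn hab (hF.isTameField (hu.continuousOn_controlPath d₀)) x₀
  have hVne : V.Nonempty := by
    obtain ⟨s, hs⟩ := hSne
    have hu : IsControl S a b (fun _ => s) := ⟨memLp_const s, Eventually.of_forall fun _ => hs⟩
    obtain ⟨x, hx⟩ := hstate _ hu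
    exact ⟨_, x, _, hu, hx, rfl⟩
  have hVb : BddBelow V := by
    refine ⟨0, ?_⟩
    rintro _ ⟨x, u, -, -, rfl⟩
    exact intervalIntegral.integral_nonneg hab fun t _ => add_nonneg (hc0 _) (by positivity)
  obtain ⟨r, -, hrlim, hrV⟩ := exists_seq_tendsto_sInf hVne hVb
  choose xs us hus hxs hr using hrV
  obtain ⟨v, hv, φ, hφ, hunif, l, hl, hllim⟩ := exists_subseq_control hSc hScl hSb hus d₀
  refine ⟨v, hv, fun x hx x' u' hu' hx' => ?_⟩
  have hle : sInf V ≤ controlCost c κ a b x' u' := csInf_le hVb ⟨x', u', hu', hx', rfl⟩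
  refine le_trans ?_ hle
  -- The states converge pointwise within a common ball of radius R. The bound B of the running cost
  -- on that ball is the dominating constant below.
  obtain ⟨⟨R, hR⟩, hptw⟩ := tendsto_of_tendstoUniformlyOn hF (hv.continuousOn_controlPath d₀) hunif
    hx.2 (fun n => (hxs (φ n)).2) (fun n => by rw [(hxs (φ n)).1, hx.1])
  obtain ⟨B, hB⟩ := hcb R
  have hstatelim : Tendsto (fun n => ∫ t in Icc a b, c (xs (φ n) t)) atTop
      (𝓝 (∫ t in Icc a b, c (x t))) := by
    refine tendsto_integral_of_dominated_convergence (fun _ => B) (fun n => ?_)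
      (integrable_const B) (fun n => ?_) ?_
    · exact (hc.comp_continuousOn (hxs (φ n)).2.continuousOn).aestronglyMeasurable
        measurableSet_Icc
    · filter_upwards [ae_restrict_mem measurableSet_Icc] with t ht
      rw [Real.norm_of_nonneg (hc0 _)]
      exact hB _ ((hR t ht).2 n)
    · filter_upwards [ae_restrict_mem measurableSet_Icc] with t ht
      exact (hc.tendsto _).comp (hptw t ht)
  rw [controlCost_eq hc hab hx.2.continuousOn hv.1]
  -- The control costs along the subsequence need not converge to that of the limit control; their
  -- convergent minorants `l n` are enough for the comparison with the infimum.
  refine le_of_tendsto_of_tendsto' (hstatelim.add (hllim.const_mul κ))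
    (hrlim.comp hφ.tendsto_atTop) fun n => ?_
  rw [Function.comp_apply, ← hr (φ n),
    controlCost_eq hc hab (hxs (φ n)).2.continuousOn (hus (φ n)).1]
  gcongr
  exact hl n

end Control

end

section

/-! ### `H¹` functions -/

section Sobolev

variable {X Y : Type*} [NormedAddCommGroup X] [NormedSpace ℝ X]
  [NormedAddCommGroup Y] [NormedSpace ℝ Y]

lemma HasH1Deriv.clm_comp [CompleteSpace X] [CompleteSpace Y] {a b : ℝ} {f g : ℝ → X}
    (h : HasH1Deriv a b f g) (L : X →L[ℝ] Y) :
    HasH1Deriv a b (fun t => L (f t)) (fun t => L (g t)) := by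
  refine ⟨L.comp_memLp' h.1, fun t ht => ?_⟩
  have ha : a ∈ Icc a b := left_mem_Icc.2 (ht.1.trans ht.2)
  rw [L.intervalIntegral_comp_comm (intervalIntegrable_of_memLp h.1 ha ht), ← map_add, ← h.2 t ht]

lemma HasH1Deriv.prodMk [CompleteSpace X] [CompleteSpace Y] {a b : ℝ} {f g : ℝ → X} {p q : ℝ → Y}
    (h : HasH1Deriv a b f g) (h' : HasH1Deriv a b p q) :
    HasH1Deriv a b (fun t => (f t, p t)) (fun t => (g t, q t)) := by
  have hm : MemLp (fun t => (g t, q t)) 2 (volume.restrict (Icc a b)) := by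
    have h1 := ((ContinuousLinearMap.inl ℝ X Y).comp_memLp' h.1).add
      ((ContinuousLinearMap.inr ℝ X Y).comp_memLp' h'.1)
    refine (memLp_congr_ae (Eventually.of_forall fun t => ?_)).1 h1
    simp
  refine ⟨hm, fun t ht => ?_⟩
  have ha : a ∈ Icc a b := left_mem_Icc.2 (ht.1.trans ht.2)
  have hi := intervalIntegrable_of_memLp hm ha ht
  refine Prod.ext ?_ ?_
  · have := (ContinuousLinearMap.fst ℝ X Y).intervalIntegral_comp_comm hi
    simp only [ContinuousLinearMap.coe_fst'] at this
    rw [Prod.fst_add, ← this]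
    exact h.2 t ht
  · have := (ContinuousLinearMap.snd ℝ X Y).intervalIntegral_comp_comm hi
    simp only [ContinuousLinearMap.coe_snd'] at this
    rw [Prod.snd_add, ← this]
    exact h'.2 t ht

lemma HasH1Deriv.continuousOn {a b : ℝ} {f g : ℝ → X} (h : HasH1Deriv a b f g) :
    ContinuousOn f (Icc a b) := by
  intro t ht
  have hle := ht.1.trans ht.2
  have h1 : ContinuousOn (fun t => f a + ∫ s in a..t, g s) (Icc a b) := by
    refine continuousOn_const.add ((intervalIntegral.continuousOn_primitive_interval ?_).mono
      Icc_subset_uIcc)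
    rw [uIcc_of_le hle]
    exact integrableOn_of_memLp h.1
  exact (h1.congr fun s hs => h.2 s hs) t ht

/-- Restriction of `H¹` functions to subintervals. -/
lemma HasH1Deriv.mono {a b a' b' : ℝ} {f g : ℝ → X} (h : HasH1Deriv a b f g)
    (ha : a ≤ a') (hb : b' ≤ b) : HasH1Deriv a' b' f g := by
  refine ⟨h.1.mono_measure (Measure.restrict_mono (Icc_subset_Icc ha hb) le_rfl), fun t ht => ?_⟩
  have h1 : a' ∈ Icc a b := ⟨ha, ht.1.trans (ht.2.trans hb)⟩
  have h2 : t ∈ Icc a b := ⟨ha.trans ht.1, ht.2.trans hb⟩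
  have h0 : a ∈ Icc a b := ⟨le_rfl, h1.1.trans h1.2⟩
  rw [h.2 t h2, h.2 a' h1, add_assoc, intervalIntegral.integral_add_adjacent_intervals
    (intervalIntegrable_of_memLp h.1 h0 h1) (intervalIntegrable_of_memLp h.1 h1 h2)]

/-- Solutions of the integral equation solve the differential equation. -/
lemma isSolutionOn_of_integral_eq [CompleteSpace X] {f : ℝ → X → X} {a b : ℝ} {x : ℝ → X}
    (hf : ContinuousOn (Function.uncurry f) (Icc a b ×ˢ univ)) (hx : ContinuousOn x (Icc a b))
    (h : ∀ t ∈ Icc a b, x t = x a + ∫ s in a..t, f s (x s)) : IsSolutionOn f a b x := by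
  intro t ht
  have ha : a ∈ Icc a b := left_mem_Icc.2 (ht.1.trans ht.2)
  exact (ODE.hasDerivWithinAt_picard_Icc ha hf hx (fun _ _ => mem_univ _) (x a) ht).congr
    (fun s hs => h s hs) (h t ht)

/-- The derivative of a solution is continuous on a compact interval, hence bounded and square
integrable, and the fundamental theorem of calculus recovers the solution from it. -/
lemma IsSolutionOn.hasH1Deriv [CompleteSpace X] {f : ℝ → X → X} {a b : ℝ} {x : ℝ → X}
    (hf : ContinuousOn (Function.uncurry f) (Icc a b ×ˢ univ)) (h : IsSolutionOn f a b x) :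
    HasH1Deriv a b x (fun t => f t (x t)) := by
  have hc : ContinuousOn (fun t => f t (x t)) (Icc a b) :=
    hf.comp (continuousOn_id.prodMk h.continuousOn) (fun t ht => ⟨ht, mem_univ _⟩)
  refine ⟨?_, fun t ht => ?_⟩
  · obtain ⟨B, hB⟩ := isCompact_Icc.exists_bound_of_continuousOn hc
    exact MemLp.of_bound (hc.aestronglyMeasurable measurableSet_Icc) B
      ((ae_restrict_iff' measurableSet_Icc).2 (Eventually.of_forall hB))
  · have hs : uIcc a t ⊆ Icc a b := by
      rw [uIcc_of_le ht.1]; exact Icc_subset_Icc_right ht.2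
    exact (ODE.picard_eq_of_hasDerivAt (hf.mono (prod_mono_left hs))
      (fun s hs' => (h s (hs hs')).mono hs) (fun _ _ => mem_univ _)).symm

end Sobolev

lemma IsTameSystem.continuousOn_uncurry {E U : Type*} [NormedAddCommGroup E] [NormedSpace ℝ E]
    [NormedAddCommGroup U] [InnerProductSpace ℝ U] [FiniteDimensional ℝ U] {F : E → U → E}
    (hF : IsTameSystem F) {a b : ℝ} {d : ℝ → U} (hd : ContinuousOn d (Icc a b)) :
    ContinuousOn (Function.uncurry fun t x => F x (d t)) (Icc a b ×ˢ univ) := by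
  refine hF.continuous.comp_continuousOn (continuousOn_snd.prodMk (hd.comp continuousOn_fst ?_))
  exact fun q hq => hq.1

/-! ### The interaction forces -/

variable {D N M : ℕ}

lemma AssumptionA.continuous_gradient {Φ : Space D → ℝ} (h : AssumptionA Φ) :
    Continuous (gradient Φ) := h.locallyLipschitz.continuous

lemma AssumptionA.continuous_force {Φ : Space D → ℝ} (h : AssumptionA Φ) :
    Continuous fun q : Space D × Space D => force Φ q.1 q.2 :=
  h.continuous_gradient.comp (continuous_fst.sub continuous_snd)

lemma AssumptionA.exists_norm_force_le {Φ : Space D → ℝ} (h : AssumptionA Φ) :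
    ∃ C : ℝ, 0 ≤ C ∧ ∀ x y, ‖force Φ x y‖ ≤ C := by
  obtain ⟨C, hC⟩ := h.bounded
  exact ⟨C, (norm_nonneg _).trans (hC 0), fun x y => hC _⟩

/-- The differences x - y lie in the compact ball of radius R + R, on which the locally Lipschitz
gradient is Lipschitz with a single constant. -/
lemma AssumptionA.exists_lipschitz_force {Φ : Space D → ℝ} (h : AssumptionA Φ) (R : ℝ) :
    ∃ K : ℝ≥0, ∀ x y x' y', ‖x‖ ≤ R → ‖y‖ ≤ R → ‖x'‖ ≤ R → ‖y'‖ ≤ R →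
      ‖force Φ x y - force Φ x' y'‖ ≤ K * (‖x - x'‖ + ‖y - y'‖) := by
  obtain ⟨K, hK⟩ := (h.locallyLipschitz.locallyLipschitzOn
    (s := Metric.closedBall 0 (R + R))).exists_lipschitzOnWith_of_compact
    (isCompact_closedBall _ _)
  refine ⟨K, fun x y x' y' hx hy hx' hy' => ?_⟩
  have h1 := hK.norm_sub_le (x := x - y) (y := x' - y')
    (by simpa using (norm_sub_le x y).trans (add_le_add hx hy))
    (by simpa using (norm_sub_le x' y').trans (add_le_add hx' hy'))
  refine h1.trans ?_
  gcongr
  rw [sub_sub_sub_comm]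
  exact norm_sub_le _ _

/-- At most n terms are summed, so dividing by n restores the bound. The subset `s` accommodates the
omitted index j = i in the particle force. -/
lemma norm_one_div_smul_sum_le {V : Type*} [NormedAddCommGroup V] [NormedSpace ℝ V] {n : ℕ}
    (s : Finset (Fin n)) {g : Fin n → V} {B : ℝ} (hB : 0 ≤ B) (h : ∀ i, ‖g i‖ ≤ B) :
    ‖(1 / (n : ℝ)) • ∑ i ∈ s, g i‖ ≤ B := by
  rcases Nat.eq_zero_or_pos n with rfl | hn
  · simpa using hB
  · have hn' : (0 : ℝ) < n := by exact_mod_cast hn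
    rw [norm_smul, Real.norm_of_nonneg (by positivity)]
    have h1 : ‖∑ i ∈ s, g i‖ ≤ n * B := by
      calc ‖∑ i ∈ s, g i‖ ≤ ∑ i ∈ s, B := norm_sum_le_of_le _ fun i _ => h i
        _ = s.card * B := by rw [Finset.sum_const, nsmul_eq_mul]
        _ ≤ n * B := by
          gcongr
          simpa using Finset.card_le_univ s
    calc 1 / (n : ℝ) * ‖∑ i ∈ s, g i‖ ≤ 1 / (n : ℝ) * (n * B) := by gcongr
      _ = B := by field_simp

/-- The factor n is a crude substitute for √n that suffices for all uses. -/
lemma norm_toLp_le {n : ℕ} {f : Fin n → Space D} {B : ℝ} (hB : 0 ≤ B) (h : ∀ i, ‖f i‖ ≤ B) :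
    ‖(WithLp.toLp 2 f : Tuple D n)‖ ≤ n * B := by
  rw [PiLp.norm_eq_of_L2]
  refine (Real.sqrt_le_left (by positivity)).2 ?_
  calc ∑ i, ‖(WithLp.toLp 2 f : Tuple D n) i‖ ^ 2 ≤ ∑ _i : Fin n, B ^ 2 :=
        Finset.sum_le_sum fun i _ => by
          have := h i
          gcongr
    _ = n * B ^ 2 := by simp
    _ ≤ (n * B) ^ 2 := by
      rw [mul_pow]
      gcongr
      exact_mod_cast Nat.le_self_pow two_ne_zero n

end

section

variable {D N M : ℕ}

/-! ### The microscopic problem -/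

/-- The positions and velocities of a microscopic state evolve by this field. -/
def microSystem (P : Model D) (x : Tuple D N × Tuple D N) (d : Tuple D M) :
    Tuple D N × Tuple D N :=
  (x.2, microForce P (x.1, x.2, d))

lemma exists_norm_microForce_le (P : Model D) (hα : 0 < P.α) (hA₁ : AssumptionA P.Φ₁)
    (hA₂ : AssumptionA P.Φ₂) :
    ∃ A : ℝ, 0 ≤ A ∧ ∀ y : MicroState D N M, ‖microForce P y‖ ≤ A * (1 + ‖y.2.1‖) := by
  obtain ⟨C₁, hC₁, h₁⟩ := hA₁.exists_norm_force_le
  obtain ⟨C₂, hC₂, h₂⟩ := hA₂.exists_norm_force_le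
  refine ⟨N * (C₁ + C₂ + P.α), by positivity, fun y => ?_⟩
  have key : ∀ i, ‖(microForce P y) i‖ ≤ C₁ + C₂ + P.α * ‖y.2.1‖ := fun i => by
    have e₁ : ‖(1 / (N : ℝ)) • ∑ j ∈ Finset.univ.erase i, force P.Φ₁ (y.1 i) (y.1 j)‖ ≤ C₁ :=
      norm_one_div_smul_sum_le _ hC₁ fun j => h₁ _ _
    have e₂ : ‖(1 / (M : ℝ)) • ∑ m : Fin M, force P.Φ₂ (y.1 i) (y.2.2 m)‖ ≤ C₂ :=
      norm_one_div_smul_sum_le _ hC₂ fun j => h₂ _ _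
    have e₃ : ‖P.α • y.2.1 i‖ ≤ P.α * ‖y.2.1‖ := by
      rw [norm_smul, Real.norm_of_nonneg hα.le]
      gcongr
      exact PiLp.norm_apply_le _ _
    refine (norm_sub_le _ _).trans (add_le_add ((norm_sub_le _ _).trans ?_) e₃)
    rw [norm_neg]
    exact add_le_add e₁ e₂
  refine (norm_toLp_le (by positivity) key).trans ?_
  rw [mul_assoc]
  gcongr
  nlinarith [norm_nonneg y.2.1]

lemma exists_lipschitz_microForce (P : Model D) (hα : 0 < P.α) (hA₁ : AssumptionA P.Φ₁)
    (hA₂ : AssumptionA P.Φ₂) (R : ℝ) :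
    ∃ K : ℝ, 0 ≤ K ∧ ∀ y z : MicroState D N M, ‖y‖ ≤ R → ‖z‖ ≤ R →
      ‖microForce P y - microForce P z‖
        ≤ K * (‖y.1 - z.1‖ + ‖y.2.1 - z.2.1‖ + ‖y.2.2 - z.2.2‖) := by
  obtain ⟨K₁, h₁⟩ := hA₁.exists_lipschitz_force R
  obtain ⟨K₂, h₂⟩ := hA₂.exists_lipschitz_force R
  -- The force between two particles depends on two positions, each displaced by at most p, whence 2
  -- * K₁. The factor N passes from components to the tuple.
  refine ⟨N * (2 * K₁ + K₂ + P.α), by positivity, fun y z hy hz => ?_⟩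
  have b1 : ∀ y : MicroState D N M, ‖y‖ ≤ R → ∀ i, ‖y.1 i‖ ≤ R := fun y hy i =>
    (PiLp.norm_apply_le _ _).trans ((norm_fst_le _).trans hy)
  have b2 : ∀ y : MicroState D N M, ‖y‖ ≤ R → ∀ i, ‖y.2.2 i‖ ≤ R := fun y hy i =>
    (PiLp.norm_apply_le _ _).trans ((norm_snd_le _).trans ((norm_snd_le _).trans hy))
  have c1 : ∀ i, ‖y.1 i - z.1 i‖ ≤ ‖y.1 - z.1‖ := fun i => PiLp.norm_apply_le (y.1 - z.1) i
  have c2 : ∀ i, ‖y.2.1 i - z.2.1 i‖ ≤ ‖y.2.1 - z.2.1‖ := fun i =>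
    PiLp.norm_apply_le (y.2.1 - z.2.1) i
  have c3 : ∀ i, ‖y.2.2 i - z.2.2 i‖ ≤ ‖y.2.2 - z.2.2‖ := fun i =>
    PiLp.norm_apply_le (y.2.2 - z.2.2) i
  set p := ‖y.1 - z.1‖
  set q := ‖y.2.1 - z.2.1‖
  set r := ‖y.2.2 - z.2.2‖
  have hp : 0 ≤ p := norm_nonneg _
  have hq : 0 ≤ q := norm_nonneg _
  have hr : 0 ≤ r := norm_nonneg _
  have key : ∀ i, ‖microForce P y i - microForce P z i‖ ≤
      K₁ * (p + p) + K₂ * (p + r) + P.α * q := fun i => by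
    have e₁ : ‖(1 / (N : ℝ)) • ∑ j ∈ Finset.univ.erase i,
        (force P.Φ₁ (y.1 i) (y.1 j) - force P.Φ₁ (z.1 i) (z.1 j))‖ ≤ K₁ * (p + p) :=
      norm_one_div_smul_sum_le _ (by positivity) fun j =>
        (h₁ _ _ _ _ (b1 y hy i) (b1 y hy j) (b1 z hz i) (b1 z hz j)).trans
          (by gcongr <;> exact c1 _)
    have e₂ : ‖(1 / (M : ℝ)) • ∑ m : Fin M,
        (force P.Φ₂ (y.1 i) (y.2.2 m) - force P.Φ₂ (z.1 i) (z.2.2 m))‖ ≤ K₂ * (p + r) :=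
      norm_one_div_smul_sum_le _ (by positivity) fun j =>
        (h₂ _ _ _ _ (b1 y hy i) (b2 y hy j) (b1 z hz i) (b2 z hz j)).trans
          (by gcongr <;> [exact c1 _; exact c3 _])
    have e₃ : ‖P.α • (y.2.1 i - z.2.1 i)‖ ≤ P.α * q := by
      rw [norm_smul, Real.norm_of_nonneg hα.le]
      gcongr
      exact c2 i
    have e : microForce P y i - microForce P z i =
        -((1 / (N : ℝ)) • ∑ j ∈ Finset.univ.erase i,
          (force P.Φ₁ (y.1 i) (y.1 j) - force P.Φ₁ (z.1 i) (z.1 j)))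
        - (1 / (M : ℝ)) • ∑ m : Fin M,
          (force P.Φ₂ (y.1 i) (y.2.2 m) - force P.Φ₂ (z.1 i) (z.2.2 m))
        - P.α • (y.2.1 i - z.2.1 i) := by
      simp only [microForce, Finset.sum_sub_distrib, smul_sub]
      abel
    rw [e]
    refine (norm_sub_le _ _).trans (add_le_add ((norm_sub_le _ _).trans ?_) e₃)
    rw [norm_neg]
    exact add_le_add e₁ e₂
  have h3 := norm_toLp_le (f := fun i => microForce P y i - microForce P z i)
    (by positivity) key
  refine h3.trans ?_
  rw [mul_assoc]
  gcongr
  nlinarith [mul_nonneg K₁.2 hp, mul_nonneg K₁.2 hq, mul_nonneg K₁.2 hr, mul_nonneg K₂.2 hq,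
    mul_nonneg K₂.2 hp, mul_nonneg K₂.2 hr, mul_nonneg hα.le hp, mul_nonneg hα.le hq,
    mul_nonneg hα.le hr]

lemma isTameSystem_microSystem (P : Model D) (hα : 0 < P.α) (hA₁ : AssumptionA P.Φ₁)
    (hA₂ : AssumptionA P.Φ₂) :
    IsTameSystem (microSystem P : Tuple D N × Tuple D N → Tuple D M → _) where
  lipschitz R := by
    obtain ⟨K, hK, h⟩ := exists_lipschitz_microForce (N := N) (M := M) P hα hA₁ hA₂ R
    refine ⟨1 + 2 * K.toNNReal, fun x y d e hx hy hd he => ?_⟩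
    have h1 := h (x.1, x.2, d) (y.1, y.2, e)
      (max_le ((norm_fst_le x).trans hx) (max_le ((norm_snd_le x).trans hx) hd))
      (max_le ((norm_fst_le y).trans hy) (max_le ((norm_snd_le y).trans hy) he))
    have a1 := norm_fst_le (x - y)
    have a2 := norm_snd_le (x - y)
    simp only [Prod.fst_sub, Prod.snd_sub] at a1 a2 h1
    have hde := norm_nonneg (d - e)
    have hxy := norm_nonneg (x - y)
    push_cast
    rw [Real.coe_toNNReal _ hK]
    refine max_le ?_ ?_
    · show ‖x.2 - y.2‖ ≤ _
      nlinarith [mul_nonneg hK hde, mul_nonneg hK hxy]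
    · show ‖microForce P (x.1, x.2, d) - microForce P (y.1, y.2, e)‖ ≤ _
      refine h1.trans ?_
      have : K * (‖x.1 - y.1‖ + ‖x.2 - y.2‖ + ‖d - e‖)
          ≤ K * (‖x - y‖ + ‖x - y‖ + ‖d - e‖) := by gcongr
      nlinarith [mul_nonneg hK hde]
  growth := by
    obtain ⟨A, hA, h⟩ := exists_norm_microForce_le (N := N) (M := M) P hα hA₁ hA₂
    refine ⟨1 + A, by positivity, fun x d => ?_⟩
    have a2 := norm_snd_le x
    have hx := norm_nonneg x
    refine max_le ?_ ?_
    · show ‖x.2‖ ≤ _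
      nlinarith [mul_nonneg hA hx]
    · refine (h (x.1, x.2, d)).trans ?_
      show A * (1 + ‖x.2‖) ≤ _
      have : A * (1 + ‖x.2‖) ≤ A * (1 + ‖x‖) := by gcongr
      nlinarith

/-- The part of the running cost that depends on the microscopic state. -/
def microStateCost (P : Model D) (x : Tuple D N × Tuple D N) : ℝ :=
  P.σ₁ / (4 * P.T) * |microVar x.1 - P.VbarN| ^ 2
    + P.σ₂ / (2 * P.T) * ‖microMean x.1 - P.Edes‖ ^ 2

lemma continuous_microMean : Continuous (microMean : Tuple D N → Space D) := by
  unfold microMean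
  fun_prop

lemma continuous_microVar : Continuous (microVar : Tuple D N → ℝ) := by
  have := continuous_microMean (D := D) (N := N)
  unfold microVar
  fun_prop

lemma continuous_microStateCost (P : Model D) :
    Continuous (microStateCost P : Tuple D N × Tuple D N → ℝ) := by
  have h1 := continuous_microMean (D := D) (N := N)
  have h2 := continuous_microVar (D := D) (N := N)
  unfold microStateCost
  fun_prop

/-- The values allowed for the controls. -/
def controlSet (P : Model D) (M : ℕ) : Set (Tuple D M) := {u | ∀ m, ‖u m‖ ≤ P.umax}

lemma controlSet_eq (P : Model D) :
    controlSet P M = ⋂ m, (PiLp.proj 2 (fun _ : Fin M => Space D) m : Tuple D M →L[ℝ] Space D) ⁻¹'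
      Metric.closedBall 0 P.umax := by
  ext u
  simp [controlSet]

lemma isClosed_controlSet (P : Model D) : IsClosed (controlSet P M) := by
  rw [controlSet_eq]
  exact isClosed_iInter fun m => Metric.isClosed_closedBall.preimage (ContinuousLinearMap.continuous _)

lemma convex_controlSet (P : Model D) : Convex ℝ (controlSet P M) := by
  rw [controlSet_eq]
  exact convex_iInter fun m => (convex_closedBall _ _).linear_preimage
    (PiLp.proj 2 (fun _ : Fin M => Space D) m : Tuple D M →L[ℝ] Space D).toLinearMap

lemma isBounded_controlSet (P : Model D) (humax : 0 ≤ P.umax) :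
    Bornology.IsBounded (controlSet P M) :=
  isBounded_iff_forall_norm_le.2 ⟨M * P.umax, fun _ hu => norm_toLp_le humax hu⟩

lemma zero_mem_controlSet (P : Model D) (humax : 0 ≤ P.umax) : 0 ∈ controlSet P M := fun m => by
  simpa using humax

lemma admissible_iff_isControl {P : Model D} {a b : ℝ} {u : ℝ → Tuple D M} :
    Admissible P a b u ↔ IsControl (controlSet P M) a b u := Iff.rfl

/-- Feasible pairs of the microscopic problem are state-control pairs of the microscopic system. -/
lemma MicroFeasible.isState {P : Model D} (hα : 0 < P.α) (hA₁ : AssumptionA P.Φ₁)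
    (hA₂ : AssumptionA P.Φ₂) {a b : ℝ} {ya : MicroState D N M}
    {y : ℝ → MicroState D N M} {u : ℝ → Tuple D M} (h : MicroFeasible P a b ya y u) :
    IsState (microSystem P) a b (ya.1, ya.2.1) ya.2.2 (fun t => ((y t).1, (y t).2.1)) u := by
  obtain ⟨hy, h0, hu⟩ := h
  have hF := isTameSystem_microSystem (N := N) (M := M) P hα hA₁ hA₂
  have hd := IsControl.continuousOn_controlPath (admissible_iff_isControl.1 hu) ya.2.2
  have h1 := hy.clm_comp (ContinuousLinearMap.fst ℝ (Tuple D N) (Tuple D N × Tuple D M))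
  have h2' := hy.clm_comp (ContinuousLinearMap.snd ℝ (Tuple D N) (Tuple D N × Tuple D M))
  have h2 := h2'.clm_comp (ContinuousLinearMap.fst ℝ (Tuple D N) (Tuple D M))
  have h3 := h2'.clm_comp (ContinuousLinearMap.snd ℝ (Tuple D N) (Tuple D M))
  have hx := h1.prodMk h2
  -- The agent equation integrates explicitly, so the agents can be eliminated from the state and
  -- kept as a parameter path.
  have hpath : ∀ t ∈ Icc a b, (y t).2.2 = controlPath a ya.2.2 u t := fun t ht => by
    have := h3.2 t ht
    simpa [h0, controlPath, microField] using this
  refine ⟨by simp [h0], isSolutionOn_of_integral_eq (hF.continuousOn_uncurry hd)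
    hx.continuousOn fun t ht => ?_⟩
  refine (hx.2 t ht).trans ?_
  congr 1
  refine intervalIntegral.integral_congr fun s hs => ?_
  rw [uIcc_of_le ht.1] at hs
  show _ = microSystem P ((y s).1, (y s).2.1) (controlPath a ya.2.2 u s)
  rw [← hpath s ⟨hs.1, hs.2.trans ht.2⟩]
  rfl

/-- State-control pairs of the microscopic system are feasible for the microscopic problem. -/
lemma IsState.microFeasible {P : Model D} (hα : 0 < P.α) (hA₁ : AssumptionA P.Φ₁)
    (hA₂ : AssumptionA P.Φ₂) {a b : ℝ} {ya : MicroState D N M}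
    {x : ℝ → Tuple D N × Tuple D N} {u : ℝ → Tuple D M} (hu : Admissible P a b u)
    (h : IsState (microSystem P) a b (ya.1, ya.2.1) ya.2.2 x u) :
    MicroFeasible P a b ya (fun t => ((x t).1, (x t).2, controlPath a ya.2.2 u t)) u := by
  have hF := isTameSystem_microSystem (N := N) (M := M) P hα hA₁ hA₂
  have hd := IsControl.continuousOn_controlPath (admissible_iff_isControl.1 hu) ya.2.2
  have hx := h.2.hasH1Deriv (hF.continuousOn_uncurry hd)
  have h1 := hx.clm_comp (ContinuousLinearMap.fst ℝ (Tuple D N) (Tuple D N))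
  have h2 := hx.clm_comp (ContinuousLinearMap.snd ℝ (Tuple D N) (Tuple D N))
  have h3 : HasH1Deriv a b (controlPath a ya.2.2 u) u :=
    ⟨hu.1, fun t _ => by simp [controlPath]⟩
  refine ⟨h1.prodMk (h2.prodMk h3), ?_, hu⟩
  simp [h.1, controlPath]

lemma microCost_eq (P : Model D) (a b : ℝ) (y : ℝ → MicroState D N M) (u : ℝ → Tuple D M) :
    microCost P a b y u = controlCost (microStateCost P) (P.σ₃ / (2 * (M : ℝ))) a b
      (fun t => ((y t).1, (y t).2.1)) u := rfl

/-- Existence of optimal pairs for the microscopic problem on one time slice. -/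
theorem exists_microOptimal (P : Model D) (hα : 0 < P.α) (hT : 0 < P.T) (humax : 0 ≤ P.umax)
    (hσ₁ : 0 < P.σ₁) (hσ₂ : 0 < P.σ₂) (hσ₃ : 0 < P.σ₃) (hA₁ : AssumptionA P.Φ₁)
    (hA₂ : AssumptionA P.Φ₂) {a b : ℝ} (hab : a ≤ b) (ya : MicroState D N M) :
    ∃ y u, MicroOptimal P a b ya y u := by
  have hF := isTameSystem_microSystem (N := N) (M := M) P hα hA₁ hA₂
  have hc0 : ∀ x : Tuple D N × Tuple D N, 0 ≤ microStateCost P x := fun x => by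
    unfold microStateCost; positivity
  have hcb : ∀ R : ℝ, ∃ B, ∀ x : Tuple D N × Tuple D N, ‖x‖ ≤ R → microStateCost P x ≤ B :=
    fun R => by
      obtain ⟨B, hB⟩ := (isCompact_closedBall (0 : Tuple D N × Tuple D N)
        R).exists_bound_of_continuousOn (continuous_microStateCost P).continuousOn
      exact ⟨B, fun x hx => (le_abs_self _).trans (hB x (by simpa using hx))⟩
  have hκ : 0 ≤ P.σ₃ / (2 * (M : ℝ)) := by positivity
  obtain ⟨u, hu, hopt⟩ := exists_optimal_control hF (continuous_microStateCost P) hc0 hcb hκ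
    (convex_controlSet P) (isClosed_controlSet P) (isBounded_controlSet P humax)
    ⟨0, zero_mem_controlSet P humax⟩ hab (ya.1, ya.2.1) ya.2.2
  obtain ⟨x, hx⟩ : ∃ x, IsState (microSystem P) a b (ya.1, ya.2.1) ya.2.2 x u :=
    exists_isSolutionOn hab (hF.isTameField (hu.continuousOn_controlPath _)) _
  have hu' := admissible_iff_isControl.2 hu
  refine ⟨_, u, hx.microFeasible hα hA₁ hA₂ hu', fun y' u' h' => ?_⟩
  rw [microCost_eq, microCost_eq]
  exact hopt x hx _ u' (admissible_iff_isControl.1 h'.2.2) (h'.isState hα hA₁ hA₂)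

/-! ### Chains of optimal pairs -/

/-- The initial value on slice k sees only the earlier slices, so a chain may be overwritten from
slice k on without changing it. -/
lemma sliceStart_congr {X : Type*} {t : ℕ → ℝ} {p₀ : X} {p q : ℕ → ℝ → X} {k : ℕ}
    (h : ∀ j < k, p j = q j) : sliceStart t p₀ p k = sliceStart t p₀ q k := by
  cases k with
  | zero => rfl
  | succ j => simp [sliceStart, h j (Nat.lt_succ_self j)]

/-- If every chain of optimal pairs can be continued, then there are complete chains. -/
lemma exists_chain {X Y : Type*} [Nonempty Y] (t : ℕ → ℝ) (p₀ : X)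
    (Opt : ℕ → X → (ℝ → X) → Y → Prop) (K : ℕ)
    (h : ∀ k < K, ∀ (p : ℕ → ℝ → X) (w : ℕ → Y), (∀ j < k, Opt j (sliceStart t p₀ p j) (p j) (w j)) →
      ∃ p' w', Opt k (sliceStart t p₀ p k) p' w') :
    ∃ (p : ℕ → ℝ → X) (w : ℕ → Y), ∀ j < K, Opt j (sliceStart t p₀ p j) (p j) (w j) := by
  suffices H : ∀ k ≤ K, ∃ (p : ℕ → ℝ → X) (w : ℕ → Y), ∀ j < k, Opt j (sliceStart t p₀ p j) (p j) (w j) from H K le_rfl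
  intro k
  induction k with
  | zero => exact fun _ => ⟨fun _ _ => p₀, fun _ => Classical.arbitrary Y, by simp⟩
  | succ k ih =>
    intro hk
    obtain ⟨p, w, hpw⟩ := ih (by omega)
    obtain ⟨p', w', hnew⟩ := h k (by omega) p w hpw
    have hs : ∀ j ≤ k, sliceStart t p₀ (Function.update p k p') j = sliceStart t p₀ p j :=
      fun j hj => sliceStart_congr fun i hi => Function.update_of_ne (by omega) _ _
    refine ⟨Function.update p k p', Function.update w k w', fun j hj => ?_⟩
    rcases Nat.lt_succ_iff_lt_or_eq.1 hj with hj | rfl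
    · rw [hs j hj.le, Function.update_of_ne hj.ne, Function.update_of_ne hj.ne]
      exact hpw j hj
    · rw [hs j le_rfl, Function.update_self, Function.update_self]
      exact hnew

end

section

/-! ### Flows of tame fields -/

section Lift

variable {E : Type*} [NormedAddCommGroup E] [NormedSpace ℝ E]

/-- Near (t, x) the field is continuous in time and Lipschitz in space with one constant for all
times, on the ball of radius ‖x‖ + 1. These two properties combine to joint continuity. -/
lemma IsTameField.continuousOn_uncurry {f : ℝ → E → E} {a b : ℝ} (hf : IsTameField f a b) :
    ContinuousOn (Function.uncurry f) (Icc a b ×ˢ univ) := by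
  rintro ⟨t, x⟩ ⟨ht, -⟩
  obtain ⟨K, hK⟩ := hf.lipschitz (‖x‖ + 1)
  have h1 := continuousOn_prod_of_continuousOn_lipschitzOnWith' (Function.uncurry f) K hK
    (fun y _ => hf.continuousOn y)
  refine (h1 (t, x) ⟨ht, by simp⟩).mono_of_mem_nhdsWithin ?_
  rw [nhdsWithin_prod_eq, nhdsWithin_univ]
  refine prod_mem_prod self_mem_nhdsWithin ?_
  filter_upwards [Metric.ball_mem_nhds x one_pos] with y hy
  rw [mem_closedBall_zero_iff]
  rw [mem_ball_iff_norm] at hy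
  have := norm_le_norm_add_norm_sub x y
  rw [norm_sub_rev] at this
  linarith

/-- A tame field generates a flow that moves compact families of points continuously in the
supremum norm. -/
lemma exists_continuousMap_flow [CompleteSpace E] {X : Type*} [TopologicalSpace X] [CompactSpace X]
    {f : ℝ → E → E} {a b : ℝ} (hab : a ≤ b) (hf : IsTameField f a b) (i : C(X, E)) :
    ∃ γ γ' : ℝ → C(X, E), γ a = i ∧
      ∀ t ∈ Icc a b, HasDerivWithinAt γ (γ' t) (Icc a b) t ∧ ∀ x, γ' t x = f t (γ t x) := by
  set g : ℝ → E → E := fun t => f (projIcc a b hab t) with hg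
  have hgf : ∀ t ∈ Icc a b, g t = f t := fun t ht => by rw [hg]; simp only [projIcc_of_mem hab ht]
  have hcont : Continuous (Function.uncurry g) := by
    have h1 : Continuous fun q : ℝ × E => (((projIcc a b hab q.1 : Icc a b) : ℝ), q.2) := by
      fun_prop
    exact hf.continuousOn_uncurry.comp_continuous h1 fun q =>
      ⟨(projIcc a b hab q.1).2, mem_univ _⟩
  -- All initial points are moved at once by a single equation in C(X, E). Freezing time outside [a,
  -- b] makes `g` continuous everywhere, so composition with it is defined for every t and inherits
  -- tameness.
  let G : ℝ → C(X, E) → C(X, E) := fun t γ =>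
    ⟨fun x => g t (γ x), hcont.comp (continuous_const.prodMk γ.continuous)⟩
  have hG : IsTameField G a b := by
    refine ⟨fun R => ?_, fun γ => ?_, ?_⟩
    · obtain ⟨K, hK⟩ := hf.lipschitz R
      refine ⟨K, fun t ht => LipschitzOnWith.of_dist_le_mul fun γ hγ δ hδ => ?_⟩
      rw [mem_closedBall_zero_iff] at hγ hδ
      refine (ContinuousMap.dist_le (by positivity)).2 fun x => ?_
      show dist (g t (γ x)) (g t (δ x)) ≤ _
      rw [hgf t ht]
      refine ((hK t ht).dist_le_mul _ ?_ _ ?_).trans ?_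
      · rw [mem_closedBall_zero_iff]; exact (γ.norm_coe_le_norm x).trans hγ
      · rw [mem_closedBall_zero_iff]; exact (δ.norm_coe_le_norm x).trans hδ
      · gcongr
        exact ContinuousMap.dist_apply_le_dist x
    · refine Continuous.continuousOn ?_
      refine ContinuousMap.continuous_of_continuous_uncurry _ ?_
      show Continuous fun q : ℝ × X => g q.1 (γ q.2)
      exact hcont.comp (continuous_fst.prodMk (γ.continuous.comp continuous_snd))
    · obtain ⟨A, hA, h⟩ := hf.growth
      refine ⟨A, hA, fun t ht γ => (ContinuousMap.norm_le _ (by positivity)).2 fun x => ?_⟩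
      show ‖g t (γ x)‖ ≤ _
      rw [hgf t ht]
      refine (h t ht _).trans ?_
      gcongr
      exact γ.norm_coe_le_norm x
  obtain ⟨γ, hγ0, hγ⟩ := exists_isSolutionOn hab hG i
  exact ⟨γ, fun t => G t (γ t), hγ0, fun t ht => ⟨hγ t ht, fun x => by
    show g t (γ t x) = _
    rw [hgf t ht]⟩⟩

lemma hasDerivWithinAt_continuousMap_apply {X : Type*} [TopologicalSpace X] [CompactSpace X]
    {γ : ℝ → C(X, E)} {γ' : C(X, E)} {s : Set ℝ} {t : ℝ} (h : HasDerivWithinAt γ γ' s t) (x : X) :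
    HasDerivWithinAt (fun r => γ r x) (γ' x) s t :=
  (ContinuousMap.evalCLM ℝ x : C(X, E) →L[ℝ] E).hasFDerivAt.comp_hasDerivWithinAt t h

/-- The flow of a tame field is continuous in the initial value. -/
lemma continuous_flow [CompleteSpace E] [ProperSpace E] {f : ℝ → E → E} {a b : ℝ} (hab : a ≤ b)
    (hf : IsTameField f a b) {Z : ℝ → E → E} (h0 : ∀ z, Z a z = z)
    (hZ : ∀ z, IsSolutionOn f a b (fun t => Z t z)) {t : ℝ} (ht : t ∈ Icc a b) :
    Continuous (Z t) := by
  refine continuous_iff_continuousAt.2 fun z => ?_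
  have : CompactSpace (Metric.closedBall z 1) := isCompact_iff_compactSpace.1 (isCompact_closedBall z 1)
  -- Near z the flow coincides, by uniqueness, with the curve in C(X, E) that starts at the
  -- inclusion of a closed ball; the values of that curve are continuous functions of the initial
  -- point.
  obtain ⟨γ, γ', hγ0, hγ⟩ := exists_continuousMap_flow hab hf
    (⟨Subtype.val, continuous_subtype_val⟩ : C(Metric.closedBall z 1, E))
  have heq : ∀ x, γ t x = Z t x := fun x =>
    IsSolutionOn.eqOn hf (x := fun s => γ s x)
      (fun s hs => by
        have := hasDerivWithinAt_continuousMap_apply (hγ s hs).1 x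
        rwa [(hγ s hs).2 x] at this) (hZ x)
      (by rw [hγ0, h0]; rfl) ht
  have hcont : ContinuousOn (Z t) (Metric.closedBall z 1) := by
    rw [continuousOn_iff_continuous_domRestrict]
    exact (γ t).continuous.congr heq
  exact hcont.continuousAt (Metric.closedBall_mem_nhds z one_pos)

end Lift

/-! ### The mean-field force -/

variable {D N M : ℕ}

section Force

variable {P : Model D}

lemma integrable_force (hA₁ : AssumptionA P.Φ₁) (μ : Measure (Phase D)) [IsFiniteMeasure μ]
    (x : Space D) : Integrable (fun w : Phase D => force P.Φ₁ x w.1) μ := by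
  obtain ⟨C, -, hC⟩ := hA₁.exists_norm_force_le
  refine Integrable.of_bound ?_ C (Eventually.of_forall fun w => hC _ _)
  exact (hA₁.continuous_force.comp (continuous_const.prodMk continuous_fst)).aestronglyMeasurable

lemma continuous_meanForce (hA₁ : AssumptionA P.Φ₁) (hA₂ : AssumptionA P.Φ₂)
    (μ : Measure (Phase D)) [IsFiniteMeasure μ] (d : Tuple D M) :
    Continuous (meanForce P μ d) := by
  have h1 : Continuous fun z : Phase D => ∫ w : Phase D, force P.Φ₁ z.1 w.1 ∂μ := by
    obtain ⟨C, -, hC⟩ := hA₁.exists_norm_force_le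
    refine continuous_of_dominated (bound := fun _ => C)
      (fun z => (integrable_force hA₁ μ z.1).aestronglyMeasurable)
      (fun z => Eventually.of_forall fun w => hC _ _) (integrable_const C)
      (Eventually.of_forall fun w => ?_)
    exact hA₁.continuous_force.comp (continuous_fst.prodMk continuous_const)
  have h2 : ∀ m, Continuous fun z : Phase D => force P.Φ₂ z.1 (d m) := fun m =>
    hA₂.continuous_force.comp (continuous_fst.prodMk continuous_const)
  unfold meanForce
  fun_prop

lemma exists_norm_meanForce_le (hα : 0 < P.α) (hA₁ : AssumptionA P.Φ₁) (hA₂ : AssumptionA P.Φ₂) :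
    ∃ A : ℝ, 0 ≤ A ∧ ∀ (μ : Measure (Phase D)) [IsProbabilityMeasure μ] (d : Tuple D M)
      (z : Phase D), ‖meanForce P μ d z‖ ≤ A * (1 + ‖z‖) := by
  obtain ⟨C₁, hC₁, h₁⟩ := hA₁.exists_norm_force_le
  obtain ⟨C₂, hC₂, h₂⟩ := hA₂.exists_norm_force_le
  refine ⟨C₁ + C₂ + P.α, by positivity, fun μ _ d z => ?_⟩
  have e₁ : ‖∫ w : Phase D, force P.Φ₁ z.1 w.1 ∂μ‖ ≤ C₁ := by
    simpa using norm_integral_le_of_norm_le_const (μ := μ) (Eventually.of_forall fun w => h₁ z.1 w.1)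
  have e₂ : ‖(1 / (M : ℝ)) • ∑ m : Fin M, force P.Φ₂ z.1 (d m)‖ ≤ C₂ :=
    norm_one_div_smul_sum_le _ hC₂ fun j => h₂ _ _
  have e₃ : ‖P.α • z.2‖ ≤ P.α * ‖z‖ := by
    rw [norm_smul, Real.norm_of_nonneg hα.le]
    gcongr
    exact norm_snd_le z
  have h : ‖meanForce P μ d z‖ ≤ C₁ + C₂ + P.α * ‖z‖ := by
    refine (norm_sub_le _ _).trans (add_le_add ((norm_sub_le _ _).trans ?_) e₃)
    rw [norm_neg]
    exact add_le_add e₁ e₂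
  nlinarith [norm_nonneg z]

/-- The force is Lipschitz in the measure, the agents and the phase space point, as long as all of
them stay in a ball; measures are compared through maps that push a common measure to them. -/
lemma exists_lipschitz_meanForce (hα : 0 < P.α) (hA₁ : AssumptionA P.Φ₁) (hA₂ : AssumptionA P.Φ₂)
    (R : ℝ) : ∃ K : ℝ, 0 ≤ K ∧ ∀ {X : Type} [MeasurableSpace X] (ν : Measure X)
      [IsProbabilityMeasure ν] (g g' : X → Phase D) (δ : ℝ), Measurable g → Measurable g' → 0 ≤ δ →
      (∀ᵐ x ∂ν, ‖g x‖ ≤ R ∧ ‖g' x‖ ≤ R ∧ ‖g x - g' x‖ ≤ δ) →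
      ∀ (z z' : Phase D) (d e : Tuple D M), ‖z‖ ≤ R → ‖z'‖ ≤ R → ‖d‖ ≤ R → ‖e‖ ≤ R →
      ‖meanForce P (ν.map g) d z - meanForce P (ν.map g') e z'‖
        ≤ K * (δ + ‖z - z'‖ + ‖d - e‖) := by
  obtain ⟨K₁, h₁⟩ := hA₁.exists_lipschitz_force R
  obtain ⟨K₂, h₂⟩ := hA₂.exists_lipschitz_force R
  refine ⟨K₁ + K₂ + P.α, by positivity, ?_⟩
  intro X _ ν _ g g' δ hg hg' hδ hb z z' d e hz hz' hd he
  have cf : ∀ x, Continuous fun w : Phase D => force P.Φ₁ x w.1 := fun x =>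
    hA₁.continuous_force.comp (continuous_const.prodMk continuous_fst)
  have := Measure.isProbabilityMeasure_map (μ := ν) hg.aemeasurable
  have := Measure.isProbabilityMeasure_map (μ := ν) hg'.aemeasurable
  have i1 : Integrable (fun x => force P.Φ₁ z.1 (g x).1) ν :=
    (integrable_map_measure (cf z.1).aestronglyMeasurable hg.aemeasurable).1
      (integrable_force hA₁ (ν.map g) z.1)
  have i2 : Integrable (fun x => force P.Φ₁ z'.1 (g' x).1) ν :=
    (integrable_map_measure (cf z'.1).aestronglyMeasurable hg'.aemeasurable).1
      (integrable_force hA₁ (ν.map g') z'.1)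
  have n1 : ∀ z : Phase D, ‖z.1‖ ≤ ‖z‖ := norm_fst_le
  have dn : ∀ (d : Tuple D M) m, ‖d m‖ ≤ ‖d‖ := fun d m => PiLp.norm_apply_le d m
  have hzz := norm_nonneg (z - z')
  have hde := norm_nonneg (d - e)
  have a1 : ‖z.1 - z'.1‖ ≤ ‖z - z'‖ := n1 (z - z')
  have e₁ : ‖∫ x, (force P.Φ₁ z.1 (g x).1 - force P.Φ₁ z'.1 (g' x).1) ∂ν‖
      ≤ K₁ * (‖z - z'‖ + δ) := by
    have := norm_integral_le_of_norm_le_const (μ := ν) (C := K₁ * (‖z - z'‖ + δ))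
      (f := fun x => force P.Φ₁ z.1 (g x).1 - force P.Φ₁ z'.1 (g' x).1) (by
        filter_upwards [hb] with x hx
        refine (h₁ _ _ _ _ ((n1 _).trans hz) ((n1 _).trans hx.1) ((n1 _).trans hz')
          ((n1 _).trans hx.2.1)).trans ?_
        gcongr
        exact (n1 (g x - g' x)).trans hx.2.2)
    simpa using this
  have e₂ : ‖(1 / (M : ℝ)) • ∑ m : Fin M, (force P.Φ₂ z.1 (d m) - force P.Φ₂ z'.1 (e m))‖
      ≤ K₂ * (‖z - z'‖ + ‖d - e‖) :=
    norm_one_div_smul_sum_le _ (by positivity) fun m =>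
      (h₂ _ _ _ _ ((n1 _).trans hz) ((dn _ _).trans hd) ((n1 _).trans hz')
        ((dn _ _).trans he)).trans (by gcongr; exact dn (d - e) m)
  have e₃ : ‖P.α • (z.2 - z'.2)‖ ≤ P.α * ‖z - z'‖ := by
    rw [norm_smul, Real.norm_of_nonneg hα.le]
    gcongr
    exact norm_snd_le (z - z')
  have heq : meanForce P (ν.map g) d z - meanForce P (ν.map g') e z' =
      -(∫ x, (force P.Φ₁ z.1 (g x).1 - force P.Φ₁ z'.1 (g' x).1) ∂ν)
      - (1 / (M : ℝ)) • ∑ m : Fin M, (force P.Φ₂ z.1 (d m) - force P.Φ₂ z'.1 (e m))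
      - P.α • (z.2 - z'.2) := by
    rw [integral_sub i1 i2, meanForce, meanForce,
      integral_map hg.aemeasurable (cf z.1).aestronglyMeasurable,
      integral_map hg'.aemeasurable (cf z'.1).aestronglyMeasurable]
    simp only [Finset.sum_sub_distrib, smul_sub]
    abel
  rw [heq]
  have h := (norm_sub_le (-(∫ x, (force P.Φ₁ z.1 (g x).1 - force P.Φ₁ z'.1 (g' x).1) ∂ν)
      - (1 / (M : ℝ)) • ∑ m : Fin M, (force P.Φ₂ z.1 (d m) - force P.Φ₂ z'.1 (e m)))
      (P.α • (z.2 - z'.2))).trans (add_le_add ((norm_sub_le _ _).trans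
        (add_le_add ((norm_neg _).trans_le e₁) e₂)) e₃)
  refine h.trans ?_
  nlinarith [mul_nonneg K₁.2 hde, mul_nonneg K₂.2 hδ, mul_nonneg hα.le hδ, mul_nonneg hα.le hde]

/-- The phase space field `(v, S(μ))`. -/
def meanField (P : Model D) (μ : Measure (Phase D)) (d : Tuple D M) (z : Phase D) : Phase D :=
  (z.2, meanForce P μ d z)

lemma continuous_meanField (hA₁ : AssumptionA P.Φ₁) (hA₂ : AssumptionA P.Φ₂)
    (μ : Measure (Phase D)) [IsFiniteMeasure μ] (d : Tuple D M) :
    Continuous (meanField P μ d) :=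
  continuous_snd.prodMk (continuous_meanForce hA₁ hA₂ μ d)

lemma exists_norm_meanField_le (hα : 0 < P.α) (hA₁ : AssumptionA P.Φ₁) (hA₂ : AssumptionA P.Φ₂) :
    ∃ A : ℝ, 0 ≤ A ∧ ∀ (μ : Measure (Phase D)) [IsProbabilityMeasure μ] (d : Tuple D M)
      (z : Phase D), ‖meanField P μ d z‖ ≤ A * (1 + ‖z‖) := by
  obtain ⟨A, hA, h⟩ := exists_norm_meanForce_le (M := M) hα hA₁ hA₂
  refine ⟨1 + A, by positivity, fun μ _ d z => max_le ?_ ?_⟩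
  · have h2 := norm_snd_le z
    have h3 := norm_nonneg z
    show ‖z.2‖ ≤ _
    nlinarith
  · refine (h μ d z).trans ?_
    gcongr
    linarith

lemma exists_lipschitz_meanField (hα : 0 < P.α) (hA₁ : AssumptionA P.Φ₁) (hA₂ : AssumptionA P.Φ₂)
    (R : ℝ) : ∃ K : ℝ, 0 ≤ K ∧ ∀ {X : Type} [MeasurableSpace X] (ν : Measure X)
      [IsProbabilityMeasure ν] (g g' : X → Phase D) (δ : ℝ), Measurable g → Measurable g' → 0 ≤ δ →
      (∀ᵐ x ∂ν, ‖g x‖ ≤ R ∧ ‖g' x‖ ≤ R ∧ ‖g x - g' x‖ ≤ δ) →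
      ∀ (z z' : Phase D) (d e : Tuple D M), ‖z‖ ≤ R → ‖z'‖ ≤ R → ‖d‖ ≤ R → ‖e‖ ≤ R →
      ‖meanField P (ν.map g) d z - meanField P (ν.map g') e z'‖
        ≤ K * (δ + ‖z - z'‖ + ‖d - e‖) := by
  obtain ⟨K, hK, h⟩ := exists_lipschitz_meanForce (M := M) hα hA₁ hA₂ R
  refine ⟨1 + K, by positivity, ?_⟩
  intro X _ ν _ g g' δ hg hg' hδ hb z z' d e hz hz' hd he
  refine max_le ?_ ?_
  · show ‖z.2 - z'.2‖ ≤ _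
    have h2 : ‖z.2 - z'.2‖ ≤ ‖z - z'‖ := norm_snd_le (z - z')
    have h3 := norm_nonneg (z - z')
    have h4 := norm_nonneg (d - e)
    nlinarith [mul_nonneg hK h3, mul_nonneg hK h4, mul_nonneg hK hδ]
  · refine (h ν g g' δ hg hg' hδ hb z z' d e hz hz' hd he).trans ?_
    gcongr
    linarith

end Force

end

section

variable {D N M : ℕ}

/-! ### The mean-field system on a compact label space -/

section System

variable {P : Model D} {X : Type} [TopologicalSpace X] [CompactSpace X] [MeasurableSpace X]
  [BorelSpace X]

/-- The mean-field dynamics as a system in the Banach space `C(X; ℝ^{2D})`: the point with label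
`x` moves in the force field of the image of the measure `ν` on the labels. -/
def meanSystem (hA₁ : AssumptionA P.Φ₁) (hA₂ : AssumptionA P.Φ₂) (ν : Measure X)
    [IsProbabilityMeasure ν] (β : C(X, Phase D)) (d : Tuple D M) : C(X, Phase D) :=
  ⟨fun x => meanField P (ν.map β) d (β x),
    (continuous_meanField hA₁ hA₂ _ d).comp β.continuous⟩

/-- Two image measures of ν are compared through their common labels, with displacement δ = ‖β - γ‖.
The dependence on the measure thus costs one more ‖β - γ‖ beside that of the point itself, hence the
factor 2. -/
lemma isTameSystem_meanSystem (hα : 0 < P.α) (hA₁ : AssumptionA P.Φ₁) (hA₂ : AssumptionA P.Φ₂)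
    (ν : Measure X) [IsProbabilityMeasure ν] :
    IsTameSystem (meanSystem (M := M) hA₁ hA₂ ν) where
  lipschitz R := by
    obtain ⟨K, hK, h⟩ := exists_lipschitz_meanField (M := M) hα hA₁ hA₂ R
    refine ⟨2 * K.toNNReal, fun β γ d e hβ hγ hd he => ?_⟩
    push_cast
    rw [Real.coe_toNNReal _ hK]
    refine (ContinuousMap.norm_le _ (by positivity)).2 fun x => ?_
    have hb : ∀ x, ‖β x - γ x‖ ≤ ‖β - γ‖ := fun x => (β - γ).norm_coe_le_norm x
    have hβ' : ∀ x, ‖β x‖ ≤ R := fun x => (β.norm_coe_le_norm x).trans hβ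
    have hγ' : ∀ x, ‖γ x‖ ≤ R := fun x => (γ.norm_coe_le_norm x).trans hγ
    refine (h ν β γ ‖β - γ‖ β.continuous.measurable γ.continuous.measurable (norm_nonneg _)
      (Eventually.of_forall fun x => ⟨hβ' x, hγ' x, hb x⟩) (β x) (γ x) d e (hβ' x) (hγ' x)
      hd he).trans ?_
    have := mul_le_mul_of_nonneg_left (hb x) hK
    nlinarith [mul_nonneg hK (norm_nonneg (d - e))]
  growth := by
    obtain ⟨A, hA, h⟩ := exists_norm_meanField_le (M := M) hα hA₁ hA₂
    refine ⟨A, hA, fun β d => (ContinuousMap.norm_le _ (by positivity)).2 fun x => ?_⟩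
    have := Measure.isProbabilityMeasure_map (μ := ν) β.continuous.measurable.aemeasurable
    refine (h _ d (β x)).trans ?_
    gcongr
    exact β.norm_coe_le_norm x

end System

/-! ### Curves of measures carried by a ball -/

/-- Weakly continuous curves of probability measures that are carried by a fixed ball. -/
structure CarriedCurve (a b R : ℝ) (μ : ℝ → Measure (Phase D)) : Prop where
  prob : ∀ t ∈ Icc a b, IsProbabilityMeasure (μ t)
  carried : ∀ t ∈ Icc a b, ∀ᵐ z ∂(μ t), ‖z‖ ≤ R
  cont : ∀ φ : Phase D → ℝ, Continuous φ → (∃ C, ∀ z, |φ z| ≤ C) →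
    ContinuousOn (fun t => ∫ z, φ z ∂(μ t)) (Icc a b)

lemma CarriedCurve.continuousOn_integral {a b R : ℝ} {μ : ℝ → Measure (Phase D)}
    (h : CarriedCurve a b R μ) {φ : Phase D → Space D} (hφ : Continuous φ)
    (hb : ∃ C, ∀ z, ‖φ z‖ ≤ C) : ContinuousOn (fun t => ∫ z, φ z ∂(μ t)) (Icc a b) := by
  obtain ⟨C, hC⟩ := hb
  have hcomp : ∀ i : Fin D, ContinuousOn (fun t => (∫ z, φ z ∂(μ t)) i) (Icc a b) := fun i => by
    have h1 := h.cont (fun z => φ z i) (by fun_prop)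
      ⟨C, fun z => (PiLp.norm_apply_le (φ z) i).trans (hC z)⟩
    refine h1.congr fun t ht => ?_
    have := h.prob t ht
    have hi : Integrable φ (μ t) :=
      Integrable.of_bound hφ.aestronglyMeasurable C (Eventually.of_forall hC)
    exact ((EuclideanSpace.proj i : Space D →L[ℝ] ℝ).integral_comp_comm hi).symm
  have h2 : ContinuousOn (fun t => WithLp.ofLp (∫ z, φ z ∂(μ t))) (Icc a b) :=
    continuousOn_pi.2 hcomp
  exact (PiLp.continuous_toLp 2 (fun _ : Fin D => ℝ)).comp_continuousOn h2

/-- At a fixed time the measure is compared with itself through the identity map, with displacement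
δ = 0; the common ball makes the constant independent of time. -/
lemma CarriedCurve.exists_lipschitzOnWith {P : Model D} (hα : 0 < P.α) (hA₁ : AssumptionA P.Φ₁)
    (hA₂ : AssumptionA P.Φ₂) {a b R : ℝ} {μ : ℝ → Measure (Phase D)} (h : CarriedCurve a b R μ)
    {d : ℝ → Tuple D M} (hd : ContinuousOn d (Icc a b)) (R' : ℝ) :
    ∃ K : ℝ≥0, ∀ t ∈ Icc a b,
      LipschitzOnWith K (meanField P (μ t) (d t)) (Metric.closedBall 0 R') := by
  obtain ⟨B, hB⟩ := isCompact_Icc.exists_bound_of_continuousOn hd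
  obtain ⟨K, hK, hL⟩ := exists_lipschitz_meanField (M := M) hα hA₁ hA₂ (max R' (max R B))
  refine ⟨K.toNNReal, fun t ht => LipschitzOnWith.of_dist_le_mul fun z hz z' hz' => ?_⟩
  rw [mem_closedBall_zero_iff] at hz hz'
  have := h.prob t ht
  have hdt : ‖d t‖ ≤ max R' (max R B) := ((hB t ht).trans (le_max_right _ _)).trans
    (le_max_right _ _)
  have hcar : ∀ᵐ x ∂(μ t), ‖id x‖ ≤ max R' (max R B) ∧ ‖id x‖ ≤ max R' (max R B) ∧
      ‖id x - id x‖ ≤ 0 := by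
    filter_upwards [h.carried t ht] with x hx
    have : ‖x‖ ≤ max R' (max R B) := (hx.trans (le_max_left _ _)).trans (le_max_right _ _)
    exact ⟨this, this, by simp⟩
  have key := hL (μ t) id id 0 measurable_id measurable_id le_rfl hcar z z' (d t) (d t)
    (hz.trans (le_max_left _ _)) (hz'.trans (le_max_left _ _)) hdt hdt
  rw [Measure.map_id, sub_self, norm_zero, zero_add, add_zero] at key
  rw [dist_eq_norm, dist_eq_norm, Real.coe_toNNReal _ hK]
  exact key

/-- At a fixed point z the measure enters only through the integral of a bounded continuous
function, which weak continuity controls. -/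
lemma CarriedCurve.continuousOn_meanField {P : Model D} (hA₁ : AssumptionA P.Φ₁)
    (hA₂ : AssumptionA P.Φ₂) {a b R : ℝ} {μ : ℝ → Measure (Phase D)} (h : CarriedCurve a b R μ)
    {d : ℝ → Tuple D M} (hd : ContinuousOn d (Icc a b)) (z : Phase D) :
    ContinuousOn (fun t => meanField P (μ t) (d t) z) (Icc a b) := by
  obtain ⟨C, -, hC⟩ := hA₁.exists_norm_force_le
  have hcont : Continuous fun w : Phase D => force P.Φ₁ z.1 w.1 :=
    hA₁.continuous_force.comp (continuous_const.prodMk continuous_fst)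
  have h1 := h.continuousOn_integral hcont ⟨C, fun w => hC _ _⟩
  have h3 : ∀ m, Continuous fun e : Tuple D M => force P.Φ₂ z.1 (e m) := fun m =>
    hA₂.continuous_force.comp
      (continuous_const.prodMk (PiLp.continuous_apply 2 (fun _ : Fin M => Space D) m))
  have h2 : Continuous fun e : Tuple D M =>
      (1 / (M : ℝ)) • ∑ m : Fin M, force P.Φ₂ z.1 (e m) := by fun_prop
  have h4 : ContinuousOn (fun t => (1 / (M : ℝ)) • ∑ m : Fin M, force P.Φ₂ z.1 (d t m))
      (Icc a b) := h2.comp_continuousOn hd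
  have h6 : ContinuousOn (fun t => meanForce P (μ t) (d t) z) (Icc a b) := by
    unfold meanForce
    exact ContinuousOn.sub (ContinuousOn.sub (ContinuousOn.neg h1) h4) continuousOn_const
  exact continuousOn_const.prodMk h6

lemma CarriedCurve.isTameField {P : Model D} (hα : 0 < P.α) (hA₁ : AssumptionA P.Φ₁)
    (hA₂ : AssumptionA P.Φ₂) {a b R : ℝ} {μ : ℝ → Measure (Phase D)} (h : CarriedCurve a b R μ)
    {d : ℝ → Tuple D M} (hd : ContinuousOn d (Icc a b)) :
    IsTameField (fun t => meanField P (μ t) (d t)) a b where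
  lipschitz := h.exists_lipschitzOnWith hα hA₁ hA₂ hd
  continuousOn := h.continuousOn_meanField hA₁ hA₂ hd
  growth := by
    obtain ⟨A, hA, hg⟩ := exists_norm_meanField_le (M := M) hα hA₁ hA₂
    refine ⟨A, hA, fun t ht z => ?_⟩
    have := h.prob t ht
    exact hg (μ t) (d t) z

/-- Pointwise continuity in time of the maps suffices for weak continuity, by dominated convergence
with the bound of the test function. -/
lemma carriedCurve_map {X : Type*} [MeasurableSpace X] (ν : Measure X) [IsProbabilityMeasure ν]
    {a b R : ℝ} {g : ℝ → X → Phase D} (hg : ∀ t ∈ Icc a b, Measurable (g t))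
    (hc : ∀ x, ContinuousOn (fun t => g t x) (Icc a b))
    (hb : ∀ t ∈ Icc a b, ∀ᵐ x ∂ν, ‖g t x‖ ≤ R) :
    CarriedCurve a b R (fun t => ν.map (g t)) where
  prob t ht := Measure.isProbabilityMeasure_map (hg t ht).aemeasurable
  carried t ht := (ae_map_iff (hg t ht).aemeasurable
    (measurableSet_le measurable_norm measurable_const)).2 (hb t ht)
  cont φ hφ hφb := by
    obtain ⟨C, hC⟩ := hφb
    have h1 : ContinuousOn (fun t => ∫ x, φ (g t x) ∂ν) (Icc a b) := by
      refine continuousOn_of_dominated (bound := fun _ => C)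
        (fun t ht => (hφ.measurable.comp (hg t ht)).aestronglyMeasurable)
        (fun t _ => Eventually.of_forall fun x => hC _) (integrable_const C)
        (Eventually.of_forall fun x => hφ.comp_continuousOn (hc x))
    exact h1.congr fun t ht => integral_map (hg t ht).aemeasurable hφ.aestronglyMeasurable

/-! ### Nonlinear flows -/

/-- `Z` is the nonlinear characteristic flow on `[a, b]` of the measure `ν`, started at `a`. -/
structure IsFlow (P : Model D) (a b : ℝ) (d : ℝ → Tuple D M) (ν : Measure (Phase D))
    (Z : ℝ → Phase D → Phase D) : Prop where
  measurable : ∀ t ∈ Icc a b, Measurable (Z t)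
  init : ∀ z, Z a z = z
  deriv : ∀ z, IsSolutionOn (fun t => meanField P (ν.map (Z t)) (d t)) a b (fun t => Z t z)

lemma isFlow_iff_isNonlinearFlow {P : Model D} {d : ℝ → Tuple D M} {ν : Measure (Phase D)}
    {Z : ℝ → Phase D → Phase D} : IsFlow P 0 P.T d ν Z ↔ IsNonlinearFlow P ν d Z :=
  ⟨fun h => ⟨h.measurable, h.init, h.deriv⟩, fun h => ⟨h.1, h.2.1, h.2.2⟩⟩

lemma IsFlow.congr {P : Model D} {a b : ℝ} {d e : ℝ → Tuple D M} {ν : Measure (Phase D)}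
    {Z : ℝ → Phase D → Phase D} (h : IsFlow P a b d ν Z) (hde : ∀ t ∈ Icc a b, d t = e t) :
    IsFlow P a b e ν Z :=
  ⟨h.measurable, h.init, fun z => (h.deriv z).congr fun t ht => by rw [hde t ht]⟩

/-- The flow that does nothing for no time. -/
lemma isFlow_id (P : Model D) (a : ℝ) (d : ℝ → Tuple D M) (ν : Measure (Phase D)) :
    IsFlow P a a d ν (fun _ z => z) where
  measurable _ _ := measurable_id
  init _ := rfl
  deriv z t ht := by
    rw [Icc_self, mem_singleton_iff] at ht
    subst ht
    rw [Icc_self]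
    exact hasDerivWithinAt_iff_hasFDerivWithinAt.2 HasFDerivWithinAt.singleton

/-- Concatenation of nonlinear flows. -/
lemma IsFlow.trans {P : Model D} {a c b : ℝ} (hac : a ≤ c) (hcb : c ≤ b) {d : ℝ → Tuple D M}
    {ν : Measure (Phase D)} {Z Z' : ℝ → Phase D → Phase D} (h : IsFlow P a c d ν Z)
    (h' : IsFlow P c b d (ν.map (Z c)) Z') :
    IsFlow P a b d ν (fun t z => if t ≤ c then Z t z else Z' t (Z c z)) := by
  set W : ℝ → Phase D → Phase D := fun t z => if t ≤ c then Z t z else Z' t (Z c z) with hW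
  have hc : c ∈ Icc a c := right_mem_Icc.2 hac
  have hl : ∀ t ≤ c, W t = Z t := fun t ht => by
    funext z; simp only [hW, if_pos ht]
  have hr : ∀ t, c ≤ t → W t = fun z => Z' t (Z c z) := fun t ht => by
    funext z
    rcases ht.eq_or_lt with rfl | ht
    · simp only [hW, if_pos le_rfl, h'.init]
    · simp only [hW, if_neg (not_le.2 ht)]
  have hmap : ∀ t ∈ Icc c b, ν.map (W t) = (ν.map (Z c)).map (Z' t) := fun t ht => by
    rw [hr t ht.1, Measure.map_map (h'.measurable t ht) (h.measurable c hc)]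
    rfl
  refine ⟨fun t ht => ?_, fun z => by rw [hl a hac]; exact h.init z, fun z t ht => ?_⟩
  · rcases le_total t c with htc | htc
    · rw [hl t htc]; exact h.measurable t ⟨ht.1, htc⟩
    · rw [hr t htc]; exact (h'.measurable t ⟨htc, ht.2⟩).comp (h.measurable c hc)
  · have e1 : t ≤ c → HasDerivWithinAt (fun s => W s z) (meanField P (ν.map (W t)) (d t) (W t z))
        (Icc a c) t := fun htc => by
      rw [hl t htc]
      exact (h.deriv z t ⟨ht.1, htc⟩).congr (fun s hs => by rw [hl s hs.2]) (by rw [hl t htc])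
    have e2 : c ≤ t → HasDerivWithinAt (fun s => W s z) (meanField P (ν.map (W t)) (d t) (W t z))
        (Icc c b) t := fun htc => by
      rw [hmap t ⟨htc, ht.2⟩, hr t htc]
      exact (h'.deriv (Z c z) t ⟨htc, ht.2⟩).congr (fun s hs => by rw [hr s hs.1])
        (by rw [hr t htc])
    rw [← Icc_union_Icc_eq_Icc hac hcb]
    -- Away from c only one of the two closed intervals contains t, and differentiability relative
    -- to the other is vacuous. At c both one-sided equations hold with the same right-hand side.
    rcases lt_trichotomy t c with htc | rfl | htc
    · refine (e1 htc.le).union (hasDerivWithinAt_iff_hasFDerivWithinAt.2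
        (HasFDerivWithinAt.of_notMem_closure ?_))
      rw [isClosed_Icc.closure_eq]
      exact fun h => absurd h.1 (not_le.2 htc)
    · exact (e1 le_rfl).union (e2 le_rfl)
    · refine HasDerivWithinAt.union (hasDerivWithinAt_iff_hasFDerivWithinAt.2
        (HasFDerivWithinAt.of_notMem_closure ?_)) (e2 htc.le)
      rw [isClosed_Icc.closure_eq]
      exact fun h => absurd h.2 (not_le.2 htc)

/-- The restriction of a measure to a closed ball, as a measure on the ball. -/
def ballMeasure (ν : Measure (Phase D)) (R : ℝ) : Measure (Metric.closedBall (0 : Phase D) R) :=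
  ν.comap Subtype.val

lemma map_val_ballMeasure {ν : Measure (Phase D)} {R : ℝ} (hν : ∀ᵐ z ∂ν, ‖z‖ ≤ R) :
    (ballMeasure ν R).map Subtype.val = ν := by
  rw [ballMeasure, map_comap_subtype_coe Metric.isClosed_closedBall.measurableSet]
  refine Measure.restrict_eq_self_of_ae_mem ?_
  filter_upwards [hν] with z hz using by simpa using hz

lemma isProbabilityMeasure_ballMeasure {ν : Measure (Phase D)} [IsProbabilityMeasure ν] {R : ℝ}
    (hν : ∀ᵐ z ∂ν, ‖z‖ ≤ R) : IsProbabilityMeasure (ballMeasure ν R) := by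
  refine ⟨?_⟩
  have h := congrArg (fun m => m univ) (map_val_ballMeasure hν)
  simp only [Measure.map_apply measurable_subtype_coe MeasurableSet.univ, preimage_univ,
    measure_univ] at h
  exact h

lemma map_ballMeasure {ν : Measure (Phase D)} {R : ℝ} (hν : ∀ᵐ z ∂ν, ‖z‖ ≤ R)
    {Z : Phase D → Phase D} (hZ : Measurable Z) :
    (ballMeasure ν R).map (fun x : Metric.closedBall (0 : Phase D) R => Z x) = ν.map Z := by
  conv_rhs => rw [← map_val_ballMeasure hν, Measure.map_map hZ measurable_subtype_coe]
  rfl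

instance compactSpace_closedBall (R : ℝ) : CompactSpace (Metric.closedBall (0 : Phase D) R) :=
  isCompact_iff_compactSpace.1 (isCompact_closedBall 0 R)

/-- The inclusion of a ball. -/
def ballInclusion (D : ℕ) (R : ℝ) : C(Metric.closedBall (0 : Phase D) R, Phase D) :=
  ⟨Subtype.val, continuous_subtype_val⟩

/-- Existence of nonlinear flows. -/
theorem exists_isFlow {P : Model D} (hα : 0 < P.α) (hA₁ : AssumptionA P.Φ₁)
    (hA₂ : AssumptionA P.Φ₂) {a b : ℝ} (hab : a ≤ b) {d : ℝ → Tuple D M}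
    (hd : ContinuousOn d (Icc a b)) {ν : Measure (Phase D)} [IsProbabilityMeasure ν] {R : ℝ}
    (hν : ∀ᵐ z ∂ν, ‖z‖ ≤ R) : ∃ Z, IsFlow P a b d ν Z := by
  have := isProbabilityMeasure_ballMeasure hν
  -- Moving only the labels that carry ν already determines the curve of measures.
  obtain ⟨β, hβ0, hβ⟩ := exists_isSolutionOn hab
    ((isTameSystem_meanSystem (M := M) hα hA₁ hA₂ (ballMeasure ν R)).isTameField hd)
    (ballInclusion D R)
  obtain ⟨R', hR'⟩ := hβ.exists_norm_le
  have hcurve : CarriedCurve a b R' (fun t => (ballMeasure ν R).map (β t)) :=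
    carriedCurve_map _ (fun t _ => (β t).continuous.measurable)
      (fun x t ht => (hasDerivWithinAt_continuousMap_apply (hβ t ht) x).continuousWithinAt)
      (fun t ht => Eventually.of_forall fun x => ((β t).norm_coe_le_norm x).trans (hR' t ht))
  -- With the measures known, the field is prescribed on all of phase space and every point has a
  -- trajectory. On the ball these agree with β by uniqueness, so they push ν forward to the same
  -- measures and the flow is consistent.
  have htame := hcurve.isTameField hα hA₁ hA₂ hd
  have hex := fun z => exists_isSolutionOn hab htame z
  choose Y hY0 hY using hex
  have hmeas : ∀ t ∈ Icc a b, Measurable fun z => Y z t := fun t ht =>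
    (continuous_flow hab htame (Z := fun t z => Y z t) hY0 hY ht).measurable
  have heq : ∀ t ∈ Icc a b, ν.map (fun z => Y z t) = (ballMeasure ν R).map (β t) := fun t ht => by
    rw [← map_ballMeasure hν (hmeas t ht)]
    have : (fun x : Metric.closedBall (0 : Phase D) R => Y x t) = β t := funext fun x =>
      IsSolutionOn.eqOn htame (hY x)
        (fun s hs => hasDerivWithinAt_continuousMap_apply (hβ s hs) x)
        (by rw [hY0, hβ0]; rfl) ht
    rw [this]
  exact ⟨fun t z => Y z t, hmeas, hY0, fun z => (hY z).congr fun t ht => by rw [heq t ht]⟩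

/-- A nonlinear flow moves compactly supported measures within a ball. -/
lemma IsFlow.exists_carriedCurve {P : Model D} (hα : 0 < P.α) (hA₁ : AssumptionA P.Φ₁)
    (hA₂ : AssumptionA P.Φ₂) {a b : ℝ} {d : ℝ → Tuple D M}
    {ν : Measure (Phase D)} [IsProbabilityMeasure ν] {R : ℝ} (hν : ∀ᵐ z ∂ν, ‖z‖ ≤ R)
    {Z : ℝ → Phase D → Phase D} (h : IsFlow P a b d ν Z) :
    ∃ R', CarriedCurve a b R' (fun t => ν.map (Z t)) := by
  obtain ⟨A, hA, hg⟩ := exists_norm_meanField_le (M := M) hα hA₁ hA₂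
  refine ⟨gronwallBound R A A (b - a), carriedCurve_map ν h.measurable
    (fun z => (h.deriv z).continuousOn) fun t ht => ?_⟩
  filter_upwards [hν] with z hz
  refine norm_le_of_linearGrowth hA (h.deriv z) (fun s hs => ?_) (by rwa [h.init]) t ht
  have := Measure.isProbabilityMeasure_map (μ := ν) (h.measurable s hs).aemeasurable
  exact hg _ _ _

/-- On the support of its measure, a nonlinear flow is a solution of the mean-field system. -/
lemma IsFlow.exists_isSolutionOn {P : Model D} (hα : 0 < P.α) (hA₁ : AssumptionA P.Φ₁)
    (hA₂ : AssumptionA P.Φ₂) {a b : ℝ} (hab : a ≤ b) {d : ℝ → Tuple D M}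
    (hd : ContinuousOn d (Icc a b))
    {ν : Measure (Phase D)} [IsProbabilityMeasure ν] {R : ℝ} (hν : ∀ᵐ z ∂ν, ‖z‖ ≤ R)
    [IsProbabilityMeasure (ballMeasure ν R)]
    {Z : ℝ → Phase D → Phase D} (h : IsFlow P a b d ν Z) :
    ∃ β : ℝ → C(Metric.closedBall (0 : Phase D) R, Phase D), β a = ballInclusion D R ∧
      IsSolutionOn (fun t β => meanSystem hA₁ hA₂ (ballMeasure ν R) β (d t)) a b β ∧
      ∀ t ∈ Icc a b, ∀ x, β t x = Z t x := by
  obtain ⟨R', hcurve⟩ := h.exists_carriedCurve hα hA₁ hA₂ hν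
  have htame := hcurve.isTameField hα hA₁ hA₂ hd
  obtain ⟨β, β', hβ0, hβ⟩ := exists_continuousMap_flow hab htame (ballInclusion D R)
  have heq : ∀ t ∈ Icc a b, ∀ x, β t x = Z t x := fun t ht x =>
    IsSolutionOn.eqOn htame (x := fun s => β s x)
      (fun s hs => by
        have := hasDerivWithinAt_continuousMap_apply (hβ s hs).1 x
        rwa [(hβ s hs).2 x] at this) (h.deriv x)
      (by rw [hβ0, h.init]; rfl) ht
  refine ⟨β, hβ0, fun t ht => ?_, heq⟩
  -- Along β the image of the label measure is the measure moved by the nonlinear flow, so the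
  -- prescribed field is the mean-field system itself.
  have hfield : meanSystem hA₁ hA₂ (ballMeasure ν R) (β t) (d t) = β' t := by
    ext1 x
    rw [(hβ t ht).2 x, ← map_ballMeasure hν (h.measurable t ht)]
    show meanField P ((ballMeasure ν R).map (β t)) (d t) (β t x) = _
    rw [show (β t : Metric.closedBall (0 : Phase D) R → Phase D) =
      fun x : Metric.closedBall (0 : Phase D) R => Z t x from funext (heq t ht)]
  show HasDerivWithinAt β (meanSystem hA₁ hA₂ (ballMeasure ν R) (β t) (d t)) _ _
  rw [hfield]
  exact (hβ t ht).1

end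

section

/-! ### Mollification of Lipschitz functions -/

section Mollify

open scoped Convolution

variable {V : Type*} [NormedAddCommGroup V] [NormedSpace ℝ V] [FiniteDimensional ℝ V]
  [MeasurableSpace V] [BorelSpace V] (μ : Measure V) [μ.IsAddHaarMeasure]

/-- The derivative of a mollification of a Lipschitz function is the mollification of its almost
everywhere defined derivative. -/
lemma hasFDerivAt_normed_convolution {H : V → ℝ} {C : ℝ≥0} (hH : LipschitzWith C H)
    (φ : ContDiffBump (0 : V)) (p : V) :
    HasFDerivAt (φ.normed μ ⋆[ContinuousLinearMap.lsmul ℝ ℝ, μ] H)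
      ((φ.normed μ ⋆[ContinuousLinearMap.lsmul ℝ ℝ, μ] (fderiv ℝ H)) p) p := by
  have hfin : ∀ x, Continuous fun t => φ.normed μ t • H (x - t) := fun x =>
    φ.continuous_normed.smul (hH.continuous.comp (continuous_const.sub continuous_id))
  have hsupp : ∀ x, HasCompactSupport fun t => φ.normed μ t • H (x - t) := fun x =>
    φ.hasCompactSupport_normed.smul_right
  have hmeas : StronglyMeasurable (fderiv ℝ H) := (measurable_fderiv ℝ H).stronglyMeasurable
  -- No continuous differentiability of H is needed: Rademacher's theorem provides differentiability
  -- at p - t for almost every t, and the Lipschitz constant dominates the difference quotients.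
  have key := hasFDerivAt_integral_of_dominated_loc_of_lip (μ := μ) (𝕜 := ℝ)
    (F := fun x t => φ.normed μ t • H (x - t)) (F' := fun t => φ.normed μ t • fderiv ℝ H (p - t))
    (x₀ := p) (s := univ) (bound := fun t => φ.normed μ t * C) univ_mem
    (Eventually.of_forall fun x => (hfin x).aestronglyMeasurable)
    ((hfin p).integrable_of_hasCompactSupport (hsupp p))
    (φ.continuous_normed.aestronglyMeasurable.smul
      (hmeas.comp_measurable (measurable_const.sub measurable_id)).aestronglyMeasurable)
    (Eventually.of_forall fun t => by
      rw [lipschitzOnWith_univ]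
      refine LipschitzWith.of_dist_le_mul fun x y => ?_
      have h1 := hH.dist_le_mul (x - t) (y - t)
      rw [dist_sub_right] at h1
      rw [dist_smul₀, Real.coe_nnabs, abs_mul, NNReal.abs_eq, mul_assoc, Real.norm_eq_abs]
      gcongr)
    (φ.integrable_normed.mul_const _)
    (by
      have h2 : ∀ᵐ t ∂μ, DifferentiableAt ℝ H (p - t) :=
        (quasiMeasurePreserving_sub_left_of_right_invariant μ p).ae hH.ae_differentiableAt
      filter_upwards [h2] with t ht
      have h3 : HasFDerivAt (fun x => H (x - t)) (fderiv ℝ H (p - t)) p := by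
        have := ht.hasFDerivAt.comp p ((hasFDerivAt_id p).sub_const t)
        rwa [ContinuousLinearMap.comp_id] at this
      exact h3.const_smul (φ.normed μ t))
  exact key.2

/-- Lipschitz functions of compact support are limits of test functions whose derivatives are
bounded and converge almost everywhere. -/
lemma exists_mollification {H : V → ℝ} {C : ℝ≥0} (hH : LipschitzWith C H)
    (hHc : HasCompactSupport H) :
    ∃ h : ℕ → V → ℝ, (∀ n, ContDiff ℝ ∞ (h n)) ∧ (∀ n, HasCompactSupport (h n)) ∧
      (∀ (n : ℕ) (x : V), (∀ y ∈ Metric.ball x (2 / (n + 1 : ℝ)), H y = 0) → h n x = 0) ∧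
      (∀ (n : ℕ) (x : V), |h n x - H x| ≤ C * (2 / (n + 1 : ℝ))) ∧
      (∀ n x, ‖fderiv ℝ (h n) x‖ ≤ C) ∧
      ∀ᵐ x ∂μ, Tendsto (fun n => fderiv ℝ (h n) x) atTop (𝓝 (fderiv ℝ H x)) := by
  -- The outer radius is twice the inner one for every n; this bounded ratio is what Lebesgue
  -- differentiation asks for in the almost everywhere convergence of the derivatives.
  let φ : ℕ → ContDiffBump (0 : V) := fun n =>
    ⟨1 / (n + 1 : ℝ), 2 / (n + 1 : ℝ), by positivity, by gcongr; norm_num⟩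
  have hfd : ∀ n x, fderiv ℝ ((φ n).normed μ ⋆[ContinuousLinearMap.lsmul ℝ ℝ, μ] H) x
      = ((φ n).normed μ ⋆[ContinuousLinearMap.lsmul ℝ ℝ, μ] (fderiv ℝ H)) x := fun n x =>
    (hasFDerivAt_normed_convolution μ hH (φ n) x).fderiv
  have hbd : ∀ x, ‖fderiv ℝ H x‖ ≤ C := fun x => norm_fderiv_le_of_lipschitz ℝ hH
  have hmeas : StronglyMeasurable (fderiv ℝ H) := (measurable_fderiv ℝ H).stronglyMeasurable
  refine ⟨fun n => (φ n).normed μ ⋆[ContinuousLinearMap.lsmul ℝ ℝ, μ] H, fun n => ?_, fun n => ?_,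
    fun n x hx => ?_, fun n x => ?_, fun n x => ?_, ?_⟩
  · exact (φ n).hasCompactSupport_normed.contDiff_convolution_left _ (φ n).contDiff_normed
      hH.continuous.locallyIntegrable
  · exact (φ n).hasCompactSupport_normed.convolution _ hHc
  · have h0 : H x = 0 := hx x (Metric.mem_ball_self (by positivity))
    exact ((φ n).normed_convolution_eq_right (fun y hy => by rw [h0, hx y hy])).trans h0
  · rw [← Real.dist_eq]
    refine (φ n).dist_normed_convolution_le hH.continuous.aestronglyMeasurable fun y hy => ?_
    refine (hH.dist_le_mul _ _).trans ?_
    gcongr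
    exact (Metric.mem_ball.1 hy).le
  · rw [hfd, convolution_def]
    refine (norm_integral_le_of_norm_le (g := fun t => (φ n).normed μ t * C)
      ((φ n).integrable_normed.mul_const _) (Eventually.of_forall fun t => ?_)).trans_eq ?_
    · simp only [ContinuousLinearMap.lsmul_apply, norm_smul,
        Real.norm_of_nonneg ((φ n).nonneg_normed t)]
      exact mul_le_mul_of_nonneg_left (hbd _) ((φ n).nonneg_normed t)
    · rw [integral_mul_const, (φ n).integral_normed, one_mul]
  · have hloc : LocallyIntegrable (fderiv ℝ H) μ :=
      (memLp_top_of_bound hmeas.aestronglyMeasurable C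
        (Eventually.of_forall hbd)).locallyIntegrable le_top
    have hlim : Tendsto (fun n => (φ n).rOut) atTop (𝓝 0) := by
      have := (tendsto_one_div_add_atTop_nhds_zero_nat (𝕜 := ℝ)).const_mul 2
      simpa [φ, mul_one_div, div_eq_mul_inv] using this
    filter_upwards [ContDiffBump.ae_convolution_tendsto_right_of_locallyIntegrable (K := 2) hlim
      (Eventually.of_forall fun n => by
        show 2 / (n + 1 : ℝ) ≤ 2 * (1 / (n + 1 : ℝ))
        rw [mul_one_div]) hloc] with x hx
    exact hx.congr fun n => (hfd n x).symm

end Mollify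

/-! ### Weak solutions tested with Lipschitz functions -/

variable {D : ℕ}

/-- Integrals of continuous functions depending on time along a carried curve. -/
lemma CarriedCurve.continuousOn_integral_uncurry {a b R : ℝ} {μ : ℝ → Measure (Phase D)}
    (h : CarriedCurve a b R μ) {g : ℝ → Phase D → ℝ}
    (hg : ContinuousOn (Function.uncurry g) (Icc a b ×ˢ univ)) :
    ContinuousOn (fun t => ∫ z, g t z ∂(μ t)) (Icc a b) := by
  -- Retracting onto a ball of positive radius that carries all the measures changes no integral,
  -- but makes the integrands bounded and uniformly continuous in time.
  set r := max R 1 with hr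
  have hr0 : 0 < r := zero_lt_one.trans_le (le_max_right _ _)
  have hcomp : IsCompact (Icc a b ×ˢ Metric.closedBall (0 : Phase D) r) :=
    isCompact_Icc.prod (isCompact_closedBall _ _)
  have hg' := hg.mono (prod_mono_right (subset_univ (Metric.closedBall (0 : Phase D) r)))
  have huc := hcomp.uniformContinuousOn_of_continuous hg'
  have hret : ∀ z : Phase D, radialRetract r z ∈ Metric.closedBall (0 : Phase D) r := fun z => by
    simpa using norm_radialRetract_le hr0 z
  have hcar : ∀ t ∈ Icc a b, ∀ᵐ z ∂(μ t), radialRetract r z = z := fun t ht => by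
    filter_upwards [h.carried t ht] with z hz
    exact radialRetract_of_norm_le hr0 (hz.trans (le_max_left _ _))
  have hgt : ∀ t ∈ Icc a b, Continuous fun z => g t (radialRetract r z) := fun t ht =>
    hg.comp_continuous (continuous_const.prodMk (lipschitzWith_radialRetract hr0).continuous)
      fun z => ⟨ht, mem_univ _⟩
  obtain ⟨B, hB⟩ := hcomp.exists_bound_of_continuousOn hg'
  have hbd : ∀ t ∈ Icc a b, ∀ z, |g t (radialRetract r z)| ≤ B := fun t ht z =>
    hB (t, radialRetract r z) ⟨ht, hret z⟩
  have heq : ∀ s ∈ Icc a b, ∀ t ∈ Icc a b,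
      ∫ z, g s z ∂(μ t) = ∫ z, g s (radialRetract r z) ∂(μ t) := fun s _ t ht => by
    refine integral_congr_ae ?_
    filter_upwards [hcar t ht] with z hz
    rw [hz]
  intro t₀ ht₀
  have hc0 := h.cont _ (hgt t₀ ht₀) ⟨B, hbd t₀ ht₀⟩ t₀ ht₀
  rw [ContinuousWithinAt, Metric.tendsto_nhdsWithin_nhds] at hc0 ⊢
  intro ε hε
  obtain ⟨δ, hδ, h1⟩ := hc0 (ε / 2) (by linarith)
  obtain ⟨δ', hδ', h2⟩ := Metric.uniformContinuousOn_iff.1 huc (ε / 2) (by linarith)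
  refine ⟨min δ δ', lt_min hδ hδ', fun t ht hd => ?_⟩
  have := h.prob t ht
  have hi : ∀ s ∈ Icc a b, Integrable (fun z => g s (radialRetract r z)) (μ t) := fun s hs =>
    Integrable.of_bound (hgt s hs).aestronglyMeasurable B (Eventually.of_forall (hbd s hs))
  have h3 : dist (∫ z, g t (radialRetract r z) ∂(μ t)) (∫ z, g t₀ (radialRetract r z) ∂(μ t))
      ≤ ε / 2 := by
    rw [dist_eq_norm, ← integral_sub (hi t ht) (hi t₀ ht₀)]
    refine (norm_integral_le_of_norm_le_const (C := ε / 2) (Eventually.of_forall fun z => ?_)).trans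
      (by simp)
    rw [← dist_eq_norm]
    refine (h2 (t, radialRetract r z) ⟨ht, hret z⟩ (t₀, radialRetract r z) ⟨ht₀, hret z⟩ ?_).le
    rw [Prod.dist_eq, dist_self]
    exact max_lt (hd.trans_le (min_le_right _ _)) hδ'
  have h4 := h1 ht (hd.trans_le (min_le_left _ _))
  rw [heq t ht t ht, heq t₀ ht₀ t₀ ht₀]
  exact (dist_triangle _ _ _).trans_lt (by linarith)

/-- The weak formulation of the continuity equation with field `B`, tested with functions from a
class `T` on `ℝ × ℝ^{2D}`. -/
def WeakEquation (B : ℝ → Phase D → Phase D) (a b : ℝ) (μ : ℝ → Measure (Phase D))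
    (h : ℝ × Phase D → ℝ) : Prop :=
  (∫ t in a..b, ∫ z, fderiv ℝ h (t, z) (1, B t z) ∂(μ t)) + ∫ z, h (a, z) ∂(μ a) = 0

/-- If the measures have densities, the weak formulation extends to Lipschitz test functions. -/
lemma weakEquation_of_lipschitz {B : ℝ → Phase D → Phase D} {a b R L : ℝ} (hab : a ≤ b)
    {μ : ℝ → Measure (Phase D)} (hμ : CarriedCurve a b R μ)
    (hac : ∀ t ∈ Icc a b, μ t ≪ volume)
    (hB : ContinuousOn (Function.uncurry B) (Icc a b ×ˢ univ))
    (hL : ∀ t ∈ Icc a b, ∀ z, ‖B t z‖ ≤ L)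
    (hw : ∀ h : ℝ × Phase D → ℝ, ContDiff ℝ ∞ h → HasCompactSupport h →
      tsupport h ⊆ Iio b ×ˢ univ → WeakEquation B a b μ h)
    {H : ℝ × Phase D → ℝ} {C : ℝ≥0} (hH : LipschitzWith C H) (hHc : HasCompactSupport H) {σ : ℝ}
    (hσ : σ < b) (hH0 : ∀ t z, σ ≤ t → H (t, z) = 0) : WeakEquation B a b μ H := by
  have hhaar : (volume : Measure (Phase D)).IsAddHaarMeasure :=
    Measure.prod.instIsAddHaarMeasure _ _
  have hhaar' : (volume : Measure (ℝ × Phase D)).IsAddHaarMeasure :=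
    Measure.prod.instIsAddHaarMeasure _ _
  obtain ⟨h, hsm, hcs, hvan, hclose, hbd, hlim⟩ := exists_mollification (volume : Measure (ℝ × Phase D)) hH hHc
  have htends : Tendsto (fun n : ℕ => 2 / (n + 1 : ℝ)) atTop (𝓝 0) := by
    have := (tendsto_one_div_add_atTop_nhds_zero_nat (𝕜 := ℝ)).const_mul 2
    simpa [mul_one_div, div_eq_mul_inv] using this
  have hev : ∀ᶠ n : ℕ in atTop, WeakEquation B a b μ (h n) := by
    -- Mollification spreads the support by at most 2/(n + 1), which must be smaller than b - σ to
    -- keep the test function supported before b.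
    filter_upwards [htends.eventually (gt_mem_nhds (sub_pos.2 hσ))] with n hn
    refine hw _ (hsm n) (hcs n) ?_
    have hsub : tsupport (h n) ⊆ Iic (σ + 2 / (n + 1 : ℝ)) ×ˢ univ := by
      refine closure_minimal (fun x hx => ⟨?_, mem_univ _⟩) (isClosed_Iic.prod isClosed_univ)
      by_contra hcon
      refine hx (hvan n x fun y hy => ?_)
      have h1 : dist y.1 x.1 < 2 / (n + 1 : ℝ) := lt_of_le_of_lt (le_max_left _ _) hy
      rw [Real.dist_eq, abs_lt] at h1
      rw [mem_Iic, not_le] at hcon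
      exact hH0 y.1 y.2 (by linarith)
    exact hsub.trans (prod_mono_left (fun t ht => lt_of_le_of_lt (mem_Iic.1 ht) (by linarith)))
  have hnorm : ∀ t ∈ Icc a b, ∀ z, ‖((1 : ℝ), B t z)‖ ≤ max 1 L := fun t ht z =>
    max_le_max (by simp) (hL t ht z)
  have hpt : ∀ n, ∀ t ∈ Icc a b, ∀ z, ‖fderiv ℝ (h n) (t, z) (1, B t z)‖ ≤ C * max 1 L :=
    fun n t ht z => (ContinuousLinearMap.le_opNorm _ _).trans
      (mul_le_mul (hbd n _) (hnorm t ht z) (norm_nonneg _) C.2)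
  have hcn : ∀ n, ContinuousOn
      (Function.uncurry fun t z => fderiv ℝ (h n) (t, z) (1, B t z)) (Icc a b ×ˢ univ) := fun n => by
    have h1 : Continuous (fderiv ℝ (h n)) := (hsm n).continuous_fderiv (by simp)
    exact h1.continuousOn.clm_apply (continuousOn_const.prodMk hB)
  have hslice : ∀ t ∈ Icc a b, Continuous (B t) := fun t ht =>
    hB.comp_continuous (continuous_const.prodMk continuous_id) fun z => ⟨ht, mem_univ _⟩
  -- By Fubini, almost every time slice of the exceptional set is Lebesgue null, hence also null for
  -- the absolutely continuous `μ t`.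
  have hae : ∀ᵐ t : ℝ, ∀ᵐ z : Phase D,
      Tendsto (fun n => fderiv ℝ (h n) (t, z)) atTop (𝓝 (fderiv ℝ H (t, z))) := by
    rw [Measure.volume_eq_prod] at hlim
    exact Measure.ae_ae_of_ae_prod hlim
  have ha : a ∈ Icc a b := left_mem_Icc.2 hab
  have hpa := hμ.prob a ha
  have l1 : Tendsto (fun n => ∫ t in a..b, ∫ z, fderiv ℝ (h n) (t, z) (1, B t z) ∂(μ t)) atTop
      (𝓝 (∫ t in a..b, ∫ z, fderiv ℝ H (t, z) (1, B t z) ∂(μ t))) := by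
    refine intervalIntegral.tendsto_integral_filter_of_dominated_convergence
      (fun _ => C * max 1 L) (Eventually.of_forall fun n => ?_)
      (Eventually.of_forall fun n => Eventually.of_forall fun t ht => ?_)
      intervalIntegrable_const ?_
    · rw [uIoc_of_le hab]
      exact ((hμ.continuousOn_integral_uncurry (hcn n)).mono
        Ioc_subset_Icc_self).aestronglyMeasurable measurableSet_Ioc
    · rw [uIoc_of_le hab] at ht
      have ht' := Ioc_subset_Icc_self ht
      have := hμ.prob t ht'
      exact (norm_integral_le_of_norm_le_const (Eventually.of_forall (hpt n t ht'))).trans (by simp)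
    · filter_upwards [hae] with t ht htI
      rw [uIoc_of_le hab] at htI
      have ht' := Ioc_subset_Icc_self htI
      have := hμ.prob t ht'
      refine tendsto_integral_of_dominated_convergence (fun _ => C * max 1 L) (fun n => ?_)
        (integrable_const _) (fun n => Eventually.of_forall (hpt n t ht')) ?_
      · have : Continuous fun z => fderiv ℝ (h n) (t, z) (1, B t z) :=
          (hcn n).comp_continuous (f := fun z : Phase D => (t, z))
            (continuous_const.prodMk continuous_id) fun z => ⟨ht', mem_univ _⟩
        exact this.aestronglyMeasurable
      · filter_upwards [(hac t ht').ae_le ht] with z hz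
        exact ((ContinuousLinearMap.apply ℝ ℝ ((1 : ℝ), B t z)).continuous.tendsto _).comp hz
  have l2 : Tendsto (fun n => ∫ z, h n (a, z) ∂(μ a)) atTop (𝓝 (∫ z, H (a, z) ∂(μ a))) := by
    have hca : Continuous fun z : Phase D => (a, z) := continuous_const.prodMk continuous_id
    have hi : ∀ {g : ℝ × Phase D → ℝ}, Continuous g → HasCompactSupport g →
        Integrable (fun z => g (a, z)) (μ a) := fun {g} hg hgc => by
      obtain ⟨K, hK⟩ := hgc.exists_bound_of_continuous hg
      exact Integrable.of_bound (hg.comp hca).aestronglyMeasurable K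
        (Eventually.of_forall fun z => hK _)
    rw [tendsto_iff_norm_sub_tendsto_zero]
    refine squeeze_zero (fun _ => norm_nonneg _) (fun n => ?_)
      (by simpa using htends.const_mul (C : ℝ))
    rw [← integral_sub (hi (hsm n).continuous (hcs n)) (hi hH.continuous hHc)]
    exact (norm_integral_le_of_norm_le_const (Eventually.of_forall fun z => hclose n _)).trans
      (by simp)
  have l3 := l1.add l2
  have l4 : Tendsto (fun n => (∫ t in a..b, ∫ z, fderiv ℝ (h n) (t, z) (1, B t z) ∂(μ t))
      + ∫ z, h n (a, z) ∂(μ a)) atTop (𝓝 0) :=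
    tendsto_const_nhds.congr' (hev.mono fun n hn => hn.symm)
  exact tendsto_nhds_unique l3 l4

end

section

/-! ### The linear continuity equation -/

/-- Finite measures are determined by the integrals of bounded Lipschitz functions. -/
lemma measure_ext_of_lipschitz {X : Type*} [PseudoEMetricSpace X] [MeasurableSpace X] [BorelSpace X]
    {μ ν : Measure X} [IsProbabilityMeasure μ] [IsProbabilityMeasure ν]
    (h : ∀ (ψ : X → ℝ) (C : ℝ≥0), LipschitzWith C ψ → (∀ x, |ψ x| ≤ 1) →
      ∫ x, ψ x ∂μ = ∫ x, ψ x ∂ν) : μ = ν := by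
  refine ext_of_generate_finite _ (BorelSpace.measurable_eq.trans borel_eq_generateFrom_isClosed)
    isPiSystem_isClosed (fun F hF => ?_) (by simp)
  -- The indicator of a closed set is the limit of thickened indicators, which are bounded and
  -- Lipschitz; closed sets form a generating π-system.
  have hpos : ∀ n : ℕ, (0 : ℝ) < 1 / (n + 1 : ℝ) := fun n => by positivity
  have e : ∀ n, ∫ x, (thickenedIndicator (hpos n) F x : ℝ) ∂μ
      = ∫ x, (thickenedIndicator (hpos n) F x : ℝ) ∂ν := fun n =>
    h _ _ (lipschitzWith_thickenedIndicator (hpos n) F) fun x => by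
      rw [NNReal.abs_eq]
      exact_mod_cast thickenedIndicator_le_one (hpos n) F x
  have t1 := tendsto_integral_thickenedIndicator_of_isClosed μ hF hpos
    tendsto_one_div_add_atTop_nhds_zero_nat
  have t2 := tendsto_integral_thickenedIndicator_of_isClosed ν hF hpos
    tendsto_one_div_add_atTop_nhds_zero_nat
  have := tendsto_nhds_unique (t1.congr e) t2
  rwa [measureReal_def, measureReal_def,
    ENNReal.toReal_eq_toReal_iff' (measure_ne_top _ _) (measure_ne_top _ _)] at this

/-! ### Dependence of the final state on the starting time and point -/

section Transport

variable {E : Type*} [NormedAddCommGroup E] [NormedSpace ℝ E]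

lemma isSolutionOn_singleton (f : ℝ → E → E) (τ : ℝ) (x : ℝ → E) : IsSolutionOn f τ τ x := by
  intro t ht
  rw [Icc_self, mem_singleton_iff] at ht
  subst ht
  rw [Icc_self]
  exact hasDerivWithinAt_iff_hasFDerivWithinAt.2 HasFDerivWithinAt.singleton

/-- The final value of the trajectory through a point is a Lipschitz function of that point and
the time. -/
lemma exists_lipschitz_final [CompleteSpace E] {f : ℝ → E → E} {a τ : ℝ} (haτ : a ≤ τ) {K L : ℝ≥0}
    (hK : ∀ t ∈ Icc a τ, LipschitzWith K (f t)) (hc : ∀ x, ContinuousOn (f · x) (Icc a τ))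
    (hL : ∀ t ∈ Icc a τ, ∀ x, ‖f t x‖ ≤ L) :
    ∃ (G : ℝ × E → E) (C : ℝ≥0), LipschitzWith C G ∧
      ∀ s ∈ Icc a τ, ∀ x, IsSolutionOn f s τ x → G (s, x s) = x τ := by
  -- The starting time is clamped to [a, τ], which defines the final value on all of ℝ × E and
  -- preserves its Lipschitz bound.
  have hex : ∀ q : ℝ × E, ∃ x : ℝ → E, x (projIcc a τ haτ q.1) = q.2 ∧
      IsSolutionOn f (projIcc a τ haτ q.1) τ x := fun q => by
    have hs := (projIcc a τ haτ q.1).2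
    have hsub := Icc_subset_Icc_left (b := τ) hs.1
    exact exists_isSolutionOn_of_bounded hs.2 (fun t ht => hK t (hsub ht))
      (fun x => (hc x).mono hsub) (fun t ht => hL t (hsub ht)) q.2
  choose Y hY0 hY using hex
  set c := Real.exp (K * (τ - a)) with hcdef
  have hstab : ∀ s ∈ Icc a τ, ∀ x y, IsSolutionOn f s τ x → IsSolutionOn f s τ y →
      dist (x τ) (y τ) ≤ dist (x s) (y s) * c := fun s hs x y hx hy => by
    have := dist_le_of_trajectories_ODE_of_mem (s := fun _ => univ) (v := f) (K := K)
      (fun t ht => (hK t ⟨hs.1.trans ht.1, ht.2.le⟩).lipschitzOnWith) hx.continuousOn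
      hx.hasDerivWithinAt_Ici (fun _ _ => trivial) hy.continuousOn hy.hasDerivWithinAt_Ici
      (fun _ _ => trivial) le_rfl τ ⟨hs.2, le_rfl⟩
    refine this.trans ?_
    rw [hcdef]
    gcongr
    exact hs.1
  have hmove : ∀ s ∈ Icc a τ, ∀ x, IsSolutionOn f s τ x → ∀ t ∈ Icc s τ,
      ‖x t - x s‖ ≤ L * (t - s) := fun s hs x hx t ht =>
    norm_image_sub_le_of_norm_deriv_le_segment' hx
      (fun r hr => hL r ⟨hs.1.trans hr.1, hr.2.le⟩ _) t ht
  have main : ∀ s ∈ Icc a τ, ∀ s' ∈ Icc a τ, s ≤ s' → ∀ x y, IsSolutionOn f s τ x →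
      IsSolutionOn f s' τ y → dist (x τ) (y τ) ≤ (L * (s' - s) + dist (x s) (y s')) * c :=
    fun s hs s' hs' hss x y hx hy => by
      refine (hstab s' hs' x y (hx.mono hss le_rfl) hy).trans ?_
      gcongr
      refine (dist_triangle (x s') (x s) (y s')).trans ?_
      gcongr
      rw [dist_eq_norm]
      exact hmove s hs x hx s' ⟨hss, hs'.2⟩
  -- Shifting the starting time moves the starting point at speed at most L, which adds to the 1 for
  -- the point itself; c is the Gronwall factor up to τ.
  refine ⟨fun q => Y q τ, (L + 1) * c.toNNReal,
    LipschitzWith.of_dist_le_mul fun q q' => ?_, fun s hs x hx => ?_⟩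
  · have hp : |(projIcc a τ haτ q'.1 : ℝ) - projIcc a τ haτ q.1| ≤ dist q q' := by
      have h1 := (LipschitzWith.projIcc haτ).dist_le_mul q'.1 q.1
      rw [NNReal.coe_one, one_mul, Subtype.dist_eq, Real.dist_eq] at h1
      refine h1.trans ?_
      rw [dist_comm]
      exact le_max_left _ _
    have h2 : dist q.2 q'.2 ≤ dist q q' := le_max_right _ _
    have hc0 : 0 ≤ c := (Real.exp_pos _).le
    push_cast
    rw [Real.coe_toNNReal _ hc0, mul_right_comm]
    rcases le_total (projIcc a τ haτ q.1 : ℝ) (projIcc a τ haτ q'.1) with h | h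
    · refine (main _ (projIcc a τ haτ q.1).2 _ (projIcc a τ haτ q'.1).2 h _ _ (hY q) (hY q')).trans
        ?_
      rw [hY0, hY0]
      gcongr
      have := mul_le_mul_of_nonneg_left ((le_abs_self _).trans hp) L.2
      linarith!
    · rw [dist_comm]
      refine (main _ (projIcc a τ haτ q'.1).2 _ (projIcc a τ haτ q.1).2 h _ _ (hY q') (hY q)).trans
        ?_
      rw [hY0, hY0, dist_comm q'.2]
      gcongr
      rw [abs_sub_comm] at hp
      have := mul_le_mul_of_nonneg_left ((le_abs_self _).trans hp) L.2
      linarith!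
  · have hp : (projIcc a τ haτ s : ℝ) = s := by rw [projIcc_of_mem haτ hs]
    have h1 := hY (s, x s)
    have h0 := hY0 (s, x s)
    simp only [hp] at h1 h0
    have := hstab s hs _ _ h1 hx
    rw [h0, dist_self, zero_mul] at this
    exact dist_le_zero.1 this

end Transport

lemma lipschitzWith_mul_of_bounded {X : Type*} [PseudoMetricSpace X] {f g : X → ℝ}
    {C C' : ℝ≥0} (hf : LipschitzWith C f) (hg : LipschitzWith C' g) {B B' : ℝ≥0}
    (hfB : ∀ x, |f x| ≤ B) (hgB : ∀ x, |g x| ≤ B') :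
    LipschitzWith (B * C' + C * B') fun x => f x * g x := by
  refine LipschitzWith.of_dist_le_mul fun x y => ?_
  have h1 := hf.dist_le_mul x y
  have h2 := hg.dist_le_mul x y
  rw [Real.dist_eq] at h1 h2 ⊢
  rw [show f x * g x - f y * g y = f x * (g x - g y) + (f x - f y) * g y by ring]
  refine (abs_add_le _ _).trans ?_
  rw [abs_mul, abs_mul]
  push_cast
  have := mul_le_mul (hfB x) h2 (abs_nonneg _) B.2
  have := mul_le_mul h1 (hgB y) (abs_nonneg _) (by positivity)
  linarith!

/-! ### Transport of weak solutions along characteristics -/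

variable {D : ℕ}

/-- Lipschitz functions that are constant along trajectories have constant integrals along weak
solutions. -/
lemma integral_eq_of_constant_along {B : ℝ → Phase D → Phase D} {a b R L : ℝ}
    {μ : ℝ → Measure (Phase D)} (hμ : CarriedCurve a b R μ)
    (hac : ∀ t ∈ Icc a b, μ t ≪ volume)
    (hB : ContinuousOn (Function.uncurry B) (Icc a b ×ˢ univ))
    (hL : ∀ t ∈ Icc a b, ∀ z, ‖B t z‖ ≤ L)
    (hw : ∀ h : ℝ × Phase D → ℝ, ContDiff ℝ ∞ h → HasCompactSupport h →
      tsupport h ⊆ Iio b ×ˢ univ → WeakEquation B a b μ h)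
    {τ : ℝ} (haτ : a < τ) (hτb : τ ≤ b) {g : ℝ × Phase D → ℝ} {C : ℝ≥0} (hg : LipschitzWith C g)
    (hgb : ∀ q, |g q| ≤ 1)
    (hconst : ∀ t ∈ Ico a τ, ∀ z, ∃ x, x t = z ∧ HasDerivWithinAt x (B t z) (Ici t) t ∧
      ∀ s ∈ Icc t τ, g (s, x s) = g (t, z)) :
    ∫ z, g (τ, z) ∂(μ τ) = ∫ z, g (a, z) ∂(μ a) := by
  have hab : a ≤ b := haτ.le.trans hτb
  set m : ℝ → ℝ := fun t => ∫ z, g (t, z) ∂(μ t) with hm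
  have hmc : ContinuousOn m (Icc a b) :=
    hμ.continuousOn_integral_uncurry (g := fun t z => g (t, z)) hg.continuous.continuousOn
  -- The test function is H = χηg. The tent χ equals σ - t on [a, σ], and the cutoff η equals 1 on
  -- the ball of radius R + 1. Near the carrier H = (σ - t)g, with g constant along trajectories, so
  -- its derivative along the field is -g before time σ. The weak equation then reads ∫_a^σ m = (σ -
  -- a) m(a).
  have key : ∀ σ ∈ Ioo a τ, ∫ t in a..σ, m t = (σ - a) * m a := by
    intro σ hσ
    set χ : ℝ × Phase D → ℝ := fun q => max 0 (σ - a - |q.1 - a|) with hχ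
    set η : ℝ × Phase D → ℝ := fun q => max 0 (min 1 (R + 2 - ‖q.2‖)) with hη
    have hχL : LipschitzWith 1 χ := by
      refine LipschitzWith.of_dist_le_mul fun q q' => ?_
      have h1 : |q.1 - q'.1| ≤ dist q q' := le_max_left _ _
      have h2 := abs_abs_sub_abs_le_abs_sub (q.1 - a) (q'.1 - a)
      rw [sub_sub_sub_cancel_right] at h2
      have h3 := abs_max_sub_max_le_abs (σ - a - |q.1 - a|) (σ - a - |q'.1 - a|) 0
      rw [max_comm, max_comm _ (0 : ℝ), sub_sub_sub_cancel_left, abs_sub_comm |q'.1 - a|] at h3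
      rw [Real.dist_eq, NNReal.coe_one, one_mul]
      exact h3.trans (h2.trans h1)
    have hηL : LipschitzWith 1 η := by
      have h1 : LipschitzWith 1 fun q : ℝ × Phase D => R + 2 - ‖q.2‖ := by
        refine LipschitzWith.of_dist_le_mul fun q q' => ?_
        have h1 : ‖q.2 - q'.2‖ ≤ dist q q' := by
          rw [← dist_eq_norm]; exact le_max_right _ _
        rw [Real.dist_eq, NNReal.coe_one, one_mul, sub_sub_sub_cancel_left, abs_sub_comm]
        exact (abs_norm_sub_norm_le _ _).trans h1
      exact (h1.const_min 1).const_max 0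
    have hχB : ∀ q, |χ q| ≤ (σ - a).toNNReal := fun q => by
      rw [abs_of_nonneg (le_max_left _ _), Real.coe_toNNReal _ (sub_nonneg.2 hσ.1.le)]
      exact max_le (sub_nonneg.2 hσ.1.le) (by linarith [abs_nonneg (q.1 - a)])
    have hηB : ∀ q, |η q| ≤ (1 : ℝ≥0) := fun q => by
      rw [abs_of_nonneg (le_max_left _ _)]
      exact max_le zero_le_one (min_le_left _ _)
    have hHL := lipschitzWith_mul_of_bounded
      (lipschitzWith_mul_of_bounded hχL hηL hχB hηB) hg (B := (σ - a).toNNReal * 1) (B' := 1)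
      (fun q => by
        rw [abs_mul]; push_cast
        exact mul_le_mul (hχB q) (hηB q) (abs_nonneg _) (NNReal.coe_nonneg _)) (by simpa using hgb)
    set H : ℝ × Phase D → ℝ := fun q => χ q * η q * g q with hH
    have hH0 : ∀ t z, σ ≤ t → H (t, z) = 0 := fun t z ht => by
      have : χ (t, z) = 0 := by
        simp only [hχ]
        rw [max_eq_left]
        linarith [le_abs_self (t - a)]
      simp only [hH, this, zero_mul]
    have hHc : HasCompactSupport H := by
      refine HasCompactSupport.intro (K := Icc (a - (σ - a)) σ ×ˢ Metric.closedBall 0 (R + 2))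
        (isCompact_Icc.prod (isCompact_closedBall _ _)) fun q hq => ?_
      by_contra hne
      refine hq ⟨?_, ?_⟩
      · have : χ q ≠ 0 := fun h => hne (by simp only [hH, h, zero_mul])
        have h2 : 0 < σ - a - |q.1 - a| := by
          by_contra hcon
          exact this (max_eq_left (not_lt.1 hcon))
        have h3 := abs_lt.1 (sub_pos.1 h2)
        exact ⟨by linarith [h3.1], by linarith [h3.2]⟩
      · have : η q ≠ 0 := fun h => hne (by simp only [hH, h, zero_mul, mul_zero])
        rw [mem_closedBall_zero_iff]
        by_contra hcon
        refine this (max_eq_left ((min_le_right _ _).trans ?_))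
        linarith
    have hweak := weakEquation_of_lipschitz hab hμ hac hB hL hw hHL hHc
      (hσ.2.trans_le hτb) hH0
    have hhaar : (volume : Measure (Phase D)).IsAddHaarMeasure :=
      Measure.prod.instIsAddHaarMeasure _ _
    have hhaar' : (volume : Measure (ℝ × Phase D)).IsAddHaarMeasure :=
      Measure.prod.instIsAddHaarMeasure _ _
    have hdiff : ∀ᵐ t : ℝ, ∀ᵐ z : Phase D, DifferentiableAt ℝ H (t, z) := by
      have := hHL.ae_differentiableAt (μ := (volume : Measure (ℝ × Phase D)))
      rw [Measure.volume_eq_prod] at this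
      exact Measure.ae_ae_of_ae_prod this
    -- Where H is differentiable, its derivative in direction (1, B) is the right derivative of H
    -- along the trajectory through the point, which can be computed explicitly.
    have hval : ∀ t ∈ Ico a σ, ∀ z, ‖z‖ ≤ R → DifferentiableAt ℝ H (t, z) →
        fderiv ℝ H (t, z) (1, B t z) = - g (t, z) := by
      intro t ht z hz hd
      obtain ⟨x, hx0, hx, hxg⟩ := hconst t ⟨ht.1, ht.2.trans hσ.2⟩ z
      have h1 : HasDerivWithinAt (fun s => H (s, x s)) (fderiv ℝ H (t, z) (1, B t z)) (Ici t) t := by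
        have h2 : HasDerivWithinAt (fun s => (s, x s)) ((1 : ℝ), B t z) (Ici t) t :=
          (hasDerivWithinAt_id t _).prodMk hx
        have h3 : HasFDerivAt H (fderiv ℝ H (t, z)) (t, x t) := by rw [hx0]; exact hd.hasFDerivAt
        exact h3.comp_hasDerivWithinAt t h2
      have h4 : HasDerivWithinAt (fun s => H (s, x s)) (- g (t, z)) (Ici t) t := by
        have h5 : HasDerivWithinAt (fun s => (σ - s) * g (t, z)) (- g (t, z)) (Ici t) t := by
          have := ((hasDerivWithinAt_id t (Ici t)).const_sub σ).mul_const (g (t, z))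
          simpa using this
        have hnear : ∀ᶠ s in 𝓝[Ici t] t, ‖x s‖ < R + 1 :=
          (hx.continuousWithinAt.norm).eventually (gt_mem_nhds (by simp only [hx0]; linarith))
        refine h5.congr_of_eventuallyEq ?_ ?_
        · filter_upwards [hnear, Ico_mem_nhdsGE ht.2] with s hs hs'
          have e1 : χ (s, x s) = σ - s := by
            simp only [hχ]
            rw [abs_of_nonneg (by linarith [ht.1, hs'.1]), max_eq_right (by linarith [hs'.2])]
            ring
          have e2 : η (s, x s) = 1 := by
            simp only [hη]
            rw [min_eq_left (by linarith), max_eq_right zero_le_one]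
          simp only [hH]
          rw [e1, e2, mul_one, hxg s ⟨hs'.1, hs'.2.le.trans hσ.2.le⟩]
        · have e1 : χ (t, x t) = σ - t := by
            simp only [hχ]
            rw [abs_of_nonneg (by linarith [ht.1]), max_eq_right (by linarith [ht.2])]
            ring
          have e2 : η (t, x t) = 1 := by
            simp only [hη]
            rw [hx0, min_eq_left (by linarith), max_eq_right zero_le_one]
          simp only [hH]
          rw [e1, e2, mul_one, hx0]
      exact (uniqueDiffWithinAt_Ici t).eq_deriv _ h1 h4
    have hlate : ∀ t, σ < t → ∀ z, fderiv ℝ H (t, z) = 0 := fun t ht z => by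
      have : H =ᶠ[𝓝 (t, z)] fun _ => 0 := by
        filter_upwards [continuous_fst.continuousAt.eventually (lt_mem_nhds ht)] with q hq
        exact hH0 q.1 q.2 hq.le
      rw [this.fderiv_eq]
      simp
    have hint : ∫ t in a..b, ∫ z, fderiv ℝ H (t, z) (1, B t z) ∂(μ t) = - ∫ t in a..σ, m t := by
      rw [intervalIntegral.integral_of_le hab, intervalIntegral.integral_of_le hσ.1.le,
        ← integral_neg,
        ← inter_eq_self_of_subset_right (Ioc_subset_Ioc_right (hσ.2.le.trans hτb) : Ioc a σ ⊆ Ioc a b),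
        ← setIntegral_indicator measurableSet_Ioc]
      refine setIntegral_congr_ae measurableSet_Ioc ?_
      have hne : ∀ᵐ t : ℝ, t ≠ σ := by simp [ae_iff]
      filter_upwards [hdiff, hne] with t ht htne htI
      have htI' := Ioc_subset_Icc_self htI
      rcases lt_or_gt_of_ne htne with h | h
      · rw [indicator_of_mem (show t ∈ Ioc a σ from ⟨htI.1, h.le⟩), hm, ← integral_neg]
        refine integral_congr_ae ?_
        filter_upwards [(hac t htI').ae_le ht, hμ.carried t htI'] with z hz hzR
        exact hval t ⟨htI.1.le, h⟩ z hzR hz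
      · rw [indicator_of_notMem (fun hc => absurd hc.2 (not_le.2 h))]
        simp [hlate t h]
    have hinit : ∫ z, H (a, z) ∂(μ a) = (σ - a) * m a := by
      rw [hm, ← integral_const_mul]
      refine integral_congr_ae ?_
      filter_upwards [hμ.carried a (left_mem_Icc.2 hab)] with z hz
      have e1 : χ (a, z) = σ - a := by
        simp only [hχ]
        rw [sub_self, abs_zero, sub_zero, max_eq_right (by linarith [hσ.1])]
      have e2 : η (a, z) = 1 := by
        simp only [hη]
        rw [min_eq_left (by linarith), max_eq_right zero_le_one]
      simp only [hH]
      rw [e1, e2, mul_one]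
    unfold WeakEquation at hweak
    rw [hint, hinit] at hweak
    linarith
  -- Differentiating the identity in σ gives m(σ) = m(a) in the open interval; continuity of m
  -- extends it to τ.
  have hEq : EqOn m (fun _ => m a) (Ioo a τ) := by
    intro σ hσ
    have hIcc : Icc a b ∈ 𝓝 σ := Icc_mem_nhds hσ.1 (hσ.2.trans_le hτb)
    have h1 : HasDerivAt (fun s => ∫ t in a..s, m t) (m σ) σ := by
      refine intervalIntegral.integral_hasDerivAt_right ?_ ?_ (hmc.continuousAt hIcc)
      · refine (hmc.mono ?_).intervalIntegrable
        rw [uIcc_of_le hσ.1.le]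
        exact Icc_subset_Icc_right (hσ.2.le.trans hτb)
      · exact ⟨Icc a b, hIcc, hmc.aestronglyMeasurable measurableSet_Icc⟩
    have h2 : HasDerivAt (fun s => ∫ t in a..s, m t) (m a) σ := by
      have h3 : HasDerivAt (fun s => (s - a) * m a) (m a) σ := by
        simpa using ((hasDerivAt_id σ).sub_const a).mul_const (m a)
      refine h3.congr_of_eventuallyEq ?_
      filter_upwards [Ioo_mem_nhds hσ.1 hσ.2] with s hs using key s hs
    exact h1.unique h2
  have hcl := hEq.of_subset_closure (t := Icc a τ) (hmc.mono (Icc_subset_Icc_right hτb))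
    continuousOn_const Ioo_subset_Icc_self (closure_Ioo haτ.ne).ge
  exact hcl (right_mem_Icc.2 haτ.le)

/-- Absolutely continuous weak solutions of the continuity equation for a bounded Lipschitz field
are transported by the flow of the field. -/
theorem eq_map_of_weakEquation {B : ℝ → Phase D → Phase D} {a b R : ℝ} {K L : ℝ≥0} (hab : a ≤ b)
    {μ : ℝ → Measure (Phase D)} (hμ : CarriedCurve a b R μ)
    (hac : ∀ t ∈ Icc a b, μ t ≪ volume)
    (hB : ContinuousOn (Function.uncurry B) (Icc a b ×ˢ univ))
    (hK : ∀ t ∈ Icc a b, LipschitzWith K (B t)) (hL : ∀ t ∈ Icc a b, ∀ z, ‖B t z‖ ≤ L)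
    (hw : ∀ h : ℝ × Phase D → ℝ, ContDiff ℝ ∞ h → HasCompactSupport h →
      tsupport h ⊆ Iio b ×ˢ univ → WeakEquation B a b μ h)
    {X : ℝ → Phase D → Phase D} (hX0 : ∀ z, X a z = z)
    (hX : ∀ z, IsSolutionOn B a b (fun t => X t z)) {τ : ℝ} (hτ : τ ∈ Icc a b)
    (hXm : Measurable (X τ)) : μ τ = (μ a).map (X τ) := by
  have hsub : Icc a τ ⊆ Icc a b := Icc_subset_Icc_right hτ.2
  have hc : ∀ x, ContinuousOn (B · x) (Icc a τ) := fun x =>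
    hB.comp (f := fun t => (t, x)) (continuousOn_id.prodMk continuousOn_const)
      fun t ht => ⟨hsub ht, mem_univ _⟩
  -- G(s, z) is the position at time τ of the trajectory through z at time s. Hence ψ ∘ G is
  -- Lipschitz, constant along trajectories, and interpolates between ψ ∘ X τ at time a and ψ at
  -- time τ.
  obtain ⟨G, C, hGC, hG⟩ := exists_lipschitz_final hτ.1 (fun t ht => hK t (hsub ht)) hc
    (fun t ht => hL t (hsub ht))
  have := hμ.prob τ hτ
  have := hμ.prob a (left_mem_Icc.2 hab)
  have := Measure.isProbabilityMeasure_map (μ := μ a) hXm.aemeasurable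
  refine measure_ext_of_lipschitz fun ψ C' hψ hψ1 => ?_
  rw [integral_map hXm.aemeasurable hψ.continuous.aestronglyMeasurable]
  have e1 : ∀ z, G (τ, z) = z := fun z =>
    hG τ ⟨hτ.1, le_rfl⟩ (fun _ => z) (isSolutionOn_singleton _ _ _)
  have e2 : ∀ z, G (a, z) = X τ z := fun z => by
    have := hG a ⟨le_rfl, hτ.1⟩ (fun t => X t z) ((hX z).mono le_rfl hτ.2)
    rwa [hX0] at this
  rcases hτ.1.eq_or_lt with h | h
  · subst h
    simp only [hX0]
  · have := integral_eq_of_constant_along hμ hac hB hL hw h hτ.2 (hψ.comp hGC)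
      (fun q => hψ1 _) fun t ht z => by
        have hsub' : Icc t τ ⊆ Icc a τ := Icc_subset_Icc_left ht.1
        obtain ⟨x, hx0, hx⟩ := exists_isSolutionOn_of_bounded ht.2.le
          (fun s hs => hK s (hsub (hsub' hs))) (fun x => (hc x).mono hsub')
          (fun s hs => hL s (hsub (hsub' hs))) z
        refine ⟨x, hx0, ?_, fun s hs => ?_⟩
        · have := hx.hasDerivWithinAt_Ici t ⟨le_rfl, ht.2⟩
          rwa [hx0] at this
        · simp only [Function.comp_apply]
          have h1 := hG s (hsub' hs) x (hx.mono hs.1 le_rfl)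
          have h2 := hG t ⟨ht.1, ht.2.le⟩ x hx
          rw [hx0] at h2
          rw [h1, h2]
    simpa only [Function.comp_apply, e1, e2] using this

end

section

variable {D M : ℕ}

/-! ### Weak measure solutions and nonlinear flows -/

lemma IsWeakMeasureSolution.carriedCurve {P : Model D} {a b R : ℝ} {d : ℝ → Tuple D M}
    {ρ : ℝ → Measure (Phase D)} (h : IsWeakMeasureSolution P a b d ρ)
    (hR : ∀ t ∈ Icc a b, ∀ᵐ z ∂(ρ t), ‖z‖ ≤ R) : CarriedCurve a b R ρ where
  prob t ht := (h.1.1 t ht).1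
  carried := hR
  cont φ hφ hφb := by
    obtain ⟨C, hC⟩ := hφb
    refine h.1.2 φ hφ ⟨C, fun z => (hC z).trans ?_⟩
    have hC0 : 0 ≤ C := (abs_nonneg _).trans (hC z)
    nlinarith [mul_nonneg hC0 (norm_nonneg z)]

/-- Absolutely continuous weak measure solutions within a ball are transported by a nonlinear
flow. -/
theorem IsWeakMeasureSolution.exists_isFlow {P : Model D} (hα : 0 < P.α) (hA₁ : AssumptionA P.Φ₁)
    (hA₂ : AssumptionA P.Φ₂) {a b R : ℝ} (hab : a ≤ b) {d : ℝ → Tuple D M}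
    (hd : ContinuousOn d (Icc a b)) {ρ : ℝ → Measure (Phase D)}
    (h : IsWeakMeasureSolution P a b d ρ) (hac : ∀ t ∈ Icc a b, ρ t ≪ volume)
    (hR : ∀ t ∈ Icc a b, ∀ᵐ z ∂(ρ t), ‖z‖ ≤ R) :
    ∃ Z, IsFlow P a b d (ρ a) Z ∧ ∀ t ∈ Icc a b, ρ t = (ρ a).map (Z t) := by
  have hcurve := h.carriedCurve hR
  have htame := hcurve.isTameField hα hA₁ hA₂ hd
  obtain ⟨A, hA, hg⟩ := htame.growth
  have hex := fun z => exists_isSolutionOn hab htame z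
  choose Y hY0 hY using hex
  have hYm : ∀ t ∈ Icc a b, Measurable fun z => Y z t := fun t ht =>
    (continuous_flow hab htame (Z := fun t z => Y z t) hY0 hY ht).measurable
  -- Trajectories starting in the ball of radius R stay within radius r, and the measures never
  -- leave the ball of radius R ≤ r. Truncating the field at r thus affects neither, while it makes
  -- the field bounded and globally Lipschitz.
  set r := |gronwallBound R A A (b - a)| + |R| + 1 with hr
  have hr0 : 0 < r := by positivity
  have hRr : R ≤ r := by
    have := le_abs_self R
    have := abs_nonneg (gronwallBound R A A (b - a))
    linarith
  obtain ⟨K, hK⟩ := htame.lipschitz r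
  have hmem : ∀ z : Phase D, radialRetract r z ∈ Metric.closedBall (0 : Phase D) r := fun z => by
    simpa using norm_radialRetract_le hr0 z
  set B : ℝ → Phase D → Phase D := fun t z => meanField P (ρ t) (d t) (radialRetract r z) with hBdef
  have hBK : ∀ t ∈ Icc a b, LipschitzWith (K * 2) (B t) := fun t ht => by
    have := (hK t ht).comp (lipschitzWith_radialRetract hr0).lipschitzOnWith
      (s := univ) (fun x _ => hmem x)
    exact lipschitzOnWith_univ.1 this
  have hBL : ∀ t ∈ Icc a b, ∀ z, ‖B t z‖ ≤ (A * (1 + r)).toNNReal := fun t ht z => by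
    rw [Real.coe_toNNReal _ (by positivity)]
    exact (hg t ht _).trans (by gcongr; exact norm_radialRetract_le hr0 z)
  have hBg : ∀ t ∈ Icc a b, ∀ z, ‖B t z‖ ≤ A * (1 + ‖z‖) := fun t ht z =>
    (hg t ht _).trans (by gcongr; exact norm_radialRetract_le_norm hr0 z)
  have hBtame : IsTameField B a b :=
    ⟨fun _ => ⟨K * 2, fun t ht => (hBK t ht).lipschitzOnWith⟩,
      fun z => htame.continuousOn (radialRetract r z), A, hA, hBg⟩
  have hexB := fun z => exists_isSolutionOn hab hBtame z
  choose X hX0 hX using hexB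
  have hXm : ∀ t ∈ Icc a b, Measurable fun z => X z t := fun t ht =>
    (continuous_flow hab hBtame (Z := fun t z => X z t) hX0 hX ht).measurable
  have hXY : ∀ z, ‖z‖ ≤ R → ∀ t ∈ Icc a b, X z t = Y z t := fun z hz => by
    have hb : ∀ t ∈ Icc a b, ‖X z t‖ ≤ r := fun t ht => by
      refine (norm_le_of_linearGrowth hA (hX z) (fun s hs => hBg s hs _) (r := R)
        (by rwa [hX0]) t ht).trans ?_
      have := le_abs_self (gronwallBound R A A (b - a))
      have := abs_nonneg R
      linarith
    exact IsSolutionOn.eqOn htame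
      ((hX z).congr fun t ht => by rw [hBdef]; simp only [radialRetract_of_norm_le hr0 (hb t ht)])
      (hY z) (by rw [hX0, hY0])
  have hw : ∀ φ : ℝ × Phase D → ℝ, ContDiff ℝ ∞ φ → HasCompactSupport φ →
      tsupport φ ⊆ Iio b ×ˢ univ → WeakEquation B a b ρ φ := fun φ h1 h2 h3 => by
    rw [WeakEquation, ← h.2 φ h1 h2 h3]
    congr 1
    refine intervalIntegral.integral_congr fun t ht => ?_
    rw [uIcc_of_le hab] at ht
    refine integral_congr_ae ?_
    filter_upwards [hR t ht] with z hz
    rw [hBdef]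
    simp only [radialRetract_of_norm_le hr0 (hz.trans hRr)]
    rfl
  have hmap : ∀ t ∈ Icc a b, ρ t = (ρ a).map (fun z => Y z t) := fun t ht => by
    rw [eq_map_of_weakEquation hab hcurve hac hBtame.continuousOn_uncurry hBK hBL hw
      (X := fun t z => X z t) hX0 hX ht (hXm t ht)]
    refine Measure.map_congr ?_
    filter_upwards [hR a (left_mem_Icc.2 hab)] with z hz using hXY z hz t ht
  -- The field was frozen along ρ; since ρ is now known to be the push-forward by Y, the linear flow
  -- is a nonlinear one.
  exact ⟨fun t z => Y z t, ⟨hYm, hY0, fun z => (hY z).congr fun t ht => by rw [← hmap t ht]⟩, hmap⟩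

/-- Nonlinear flows transport compactly supported measures along weak measure solutions. -/
theorem IsFlow.isWeakMeasureSolution {P : Model D} (hα : 0 < P.α) (hA₁ : AssumptionA P.Φ₁)
    (hA₂ : AssumptionA P.Φ₂) {a b R : ℝ} (hab : a ≤ b) {d : ℝ → Tuple D M}
    (hd : ContinuousOn d (Icc a b)) {ν : Measure (Phase D)} [IsProbabilityMeasure ν]
    (hν : ∀ᵐ z ∂ν, ‖z‖ ≤ R) {Z : ℝ → Phase D → Phase D} (h : IsFlow P a b d ν Z) :
    IsWeakMeasureSolution P a b d (fun t => ν.map (Z t)) := by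
  obtain ⟨R', hcurve⟩ := h.exists_carriedCurve hα hA₁ hA₂ hν
  have htame := hcurve.isTameField hα hA₁ hA₂ hd
  obtain ⟨A, hA, hg⟩ := htame.growth
  refine ⟨⟨fun t ht => ⟨hcurve.prob t ht, ?_⟩, fun φ hφ _ => ?_⟩, fun φ hφ hφc hφs => ?_⟩
  · have := hcurve.prob t ht
    refine Integrable.of_bound continuous_norm.aestronglyMeasurable R' ?_
    filter_upwards [hcurve.carried t ht] with z hz using by rwa [norm_norm]
  · exact hcurve.continuousOn_integral_uncurry (g := fun _ z => φ z)
      (hφ.comp continuous_snd).continuousOn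
  set g : ℝ → Phase D → ℝ := fun t z =>
    fderiv ℝ φ (t, z) (1, meanField P (ν.map (Z t)) (d t) z) with hgdef
  have hgc : ContinuousOn (Function.uncurry g) (Icc a b ×ˢ univ) :=
    ((hφ.continuous_fderiv (by simp)).continuousOn).clm_apply
      (continuousOn_const.prodMk htame.continuousOn_uncurry)
  have hgt : ∀ t ∈ Icc a b, Continuous (g t) := fun t ht =>
    hgc.comp_continuous (continuous_const.prodMk continuous_id) fun z => ⟨ht, mem_univ _⟩
  have hφt : ∀ t, Continuous fun z : Phase D => φ (t, z) := fun t =>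
    hφ.continuous.comp (continuous_const.prodMk continuous_id)
  obtain ⟨r, hrb⟩ : ∃ r, ∀ z, ‖z‖ ≤ R → ∀ t ∈ Icc a b, ‖Z t z‖ ≤ r :=
    ⟨gronwallBound R A A (b - a), fun z hz =>
      norm_le_of_linearGrowth hA (h.deriv z) (fun s hs => hg s hs _) (by rwa [h.init])⟩
  obtain ⟨c, hc⟩ := (isCompact_Icc.prod (isCompact_closedBall (0 : Phase D) r))
    |>.exists_bound_of_continuousOn (hgc.mono (prod_mono_right (subset_univ _)))
  obtain ⟨c', hc'⟩ := hφc.exists_bound_of_continuous hφ.continuous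
  have hgi : ContinuousOn (fun t => ∫ z, g t z ∂(ν.map (Z t))) (Icc a b) :=
    hcurve.continuousOn_integral_uncurry hgc
  have hφi : ContinuousOn (fun t => ∫ z, φ (t, z) ∂(ν.map (Z t))) (Icc a b) :=
    hcurve.continuousOn_integral_uncurry (g := fun t z => φ (t, z)) hφ.continuous.continuousOn
  -- Pulled back to ν, the integrand is φ along a trajectory, whose derivative is given by the chain
  -- rule. It is bounded by the maximum of |g| on the compact set that the trajectories from the
  -- carrier of ν do not leave.
  have hderiv : ∀ t ∈ Ioo a b, HasDerivAt (fun t => ∫ z, φ (t, z) ∂(ν.map (Z t)))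
      (∫ z, g t z ∂(ν.map (Z t))) t := by
    intro t ht
    have htI := Ioo_subset_Icc_self ht
    have key := (hasDerivAt_integral_of_dominated_loc_of_deriv_le (μ := ν) (𝕜 := ℝ)
      (F := fun s z => φ (s, Z s z)) (F' := fun s z => g s (Z s z)) (x₀ := t) (s := Ioo a b)
      (bound := fun _ => c) (Ioo_mem_nhds ht.1 ht.2) ?_ ?_ ?_ ?_ (integrable_const c) ?_).2
    · rw [integral_map (h.measurable t htI).aemeasurable (hgt t htI).aestronglyMeasurable]
      refine key.congr_of_eventuallyEq ?_
      filter_upwards [Ioo_mem_nhds ht.1 ht.2] with s hs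
      exact integral_map (h.measurable s (Ioo_subset_Icc_self hs)).aemeasurable
        (hφt s).aestronglyMeasurable
    · filter_upwards [Ioo_mem_nhds ht.1 ht.2] with s hs
      exact ((hφt s).measurable.comp (h.measurable s (Ioo_subset_Icc_self hs))).aestronglyMeasurable
    · exact Integrable.of_bound
        ((hφt t).measurable.comp (h.measurable t htI)).aestronglyMeasurable c'
        (Eventually.of_forall fun z => hc' _)
    · exact ((hgt t htI).measurable.comp (h.measurable t htI)).aestronglyMeasurable
    · filter_upwards [hν] with z hz s hs
      have hs' := Ioo_subset_Icc_self hs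
      exact hc (s, Z s z) ⟨hs', by simpa using hrb z hz s hs'⟩
    · refine Eventually.of_forall fun z s hs => ?_
      have h1 : HasDerivAt (fun r => Z r z) (meanField P (ν.map (Z s)) (d s) (Z s z)) s :=
        (h.deriv z s (Ioo_subset_Icc_self hs)).hasDerivAt (Icc_mem_nhds hs.1 hs.2)
      exact ((hφ.differentiable (by simp)) (s, Z s z)).hasFDerivAt.comp_hasDerivAt s
        ((hasDerivAt_id s).prodMk h1)
  have hftc := intervalIntegral.integral_eq_sub_of_hasDerivAt_of_le hab hφi hderiv
    (by rw [← uIcc_of_le hab] at hgi; exact hgi.intervalIntegrable)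
  -- The support of φ lies strictly before b, so only the boundary term at a remains.
  have hend : ∀ z, φ (b, z) = 0 := fun z => by
    by_contra hne
    exact lt_irrefl b (hφs (subset_tsupport _ hne)).1
  show (∫ t in a..b, ∫ z, g t z ∂(ν.map (Z t))) + ∫ z, φ (a, z) ∂(ν.map (Z a)) = 0
  rw [hftc]
  simp [hend]

end

section

variable {D M : ℕ}

/-! ### Densities -/

lemma aemeasurable_ofReal_coeFn (f : PhaseL2 D) :
    AEMeasurable (fun z => ENNReal.ofReal (f z)) (volume : Measure (Phase D)) :=
  (Lp.aestronglyMeasurable f).aemeasurable.ennreal_ofReal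

lemma densityMeasure_absolutelyContinuous (f : PhaseL2 D) : densityMeasure f ≪ volume :=
  withDensity_absolutelyContinuous _ _

/-- The measure only sees the positive part of the density, which is the density itself because of
the sign condition. -/
lemma eq_of_densityMeasure_eq {f g : PhaseL2 D} (hf : ∀ᵐ z, 0 ≤ f z) (hg : ∀ᵐ z, 0 ≤ g z)
    (h : densityMeasure f = densityMeasure g) : f = g := by
  have hσ : SigmaFinite (volume : Measure (Phase D)) := Measure.prod.instSigmaFinite
  refine Lp.ext ?_
  filter_upwards [(withDensity_eq_iff_of_sigmaFinite (aemeasurable_ofReal_coeFn f)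
    (aemeasurable_ofReal_coeFn g)).1 h, hf, hg] with z h1 h2 h3
  exact (ENNReal.ofReal_eq_ofReal_iff h2 h3).1 h1

lemma ae_eq_zero_of_densityMeasure_eq_zero {f : PhaseL2 D} (hf : ∀ᵐ z, 0 ≤ f z) {S : Set (Phase D)}
    (hS : MeasurableSet S) (h : densityMeasure f S = 0) : ∀ᵐ z, z ∈ S → f z = 0 := by
  rw [densityMeasure, withDensity_apply _ hS, lintegral_eq_zero_iff'
    (aemeasurable_ofReal_coeFn f).restrict] at h
  filter_upwards [(ae_restrict_iff' hS).1 h, hf] with z h1 h2 hz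
  exact le_antisymm (ENNReal.ofReal_eq_zero.1 (h1 hz)) h2

lemma ae_densityMeasure_mem {f : PhaseL2 D} {S : Set (Phase D)}
    (h : ∀ᵐ z, z ∉ S → f z = 0) : ∀ᵐ z ∂(densityMeasure f), z ∈ S := by
  rw [densityMeasure, ae_withDensity_iff' (aemeasurable_ofReal_coeFn f)]
  filter_upwards [h] with z hz hne
  by_contra hcon
  exact hne (by rw [hz hcon, ENNReal.ofReal_zero])

lemma integral_densityMeasure {V : Type*} [NormedAddCommGroup V] [NormedSpace ℝ V] {f : PhaseL2 D}
    (hf : ∀ᵐ z, 0 ≤ f z) (g : Phase D → V) :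
    ∫ z, g z ∂(densityMeasure f) = ∫ z, f z • g z := by
  rw [densityMeasure, integral_withDensity_eq_integral_toReal_smul₀ (aemeasurable_ofReal_coeFn f)
    (Eventually.of_forall fun _ => ENNReal.ofReal_lt_top)]
  refine integral_congr_ae ?_
  filter_upwards [hf] with z hz
  rw [ENNReal.toReal_ofReal hz]

lemma meanFieldMean_eq {X : Type*} [MeasurableSpace X] {ν : Measure X} {f : PhaseL2 D}
    (hf : ∀ᵐ z, 0 ≤ f z) {β : X → Phase D} (hβ : Measurable β)
    (h : densityMeasure f = ν.map β) : meanFieldMean f = ∫ x, (β x).1 ∂ν := by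
  rw [meanFieldMean, ← integral_densityMeasure hf, h,
    integral_map hβ.aemeasurable continuous_fst.aestronglyMeasurable]

lemma meanFieldVar_eq {X : Type*} [MeasurableSpace X] {ν : Measure X} {f : PhaseL2 D}
    (hf : ∀ᵐ z, 0 ≤ f z) {β : X → Phase D} (hβ : Measurable β)
    (h : densityMeasure f = ν.map β) :
    meanFieldVar f = ∫ x, ‖(β x).1 - ∫ y, (β y).1 ∂ν‖ ^ 2 ∂ν := by
  have h1 : Continuous fun z : Phase D => ‖z.1 - ∫ y, (β y).1 ∂ν‖ ^ 2 := by fun_prop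
  have h2 := integral_densityMeasure hf fun z : Phase D => ‖z.1 - ∫ y, (β y).1 ∂ν‖ ^ 2
  rw [h, integral_map hβ.aemeasurable h1.aestronglyMeasurable] at h2
  rw [h2, meanFieldVar, meanFieldMean_eq hf hβ h]
  exact integral_congr_ae (Eventually.of_forall fun z => mul_comm _ _)

/-! ### Concatenation of controls -/

lemma agentPath_eq_controlPath (d₀ : Tuple D M) (w : ℝ → Tuple D M) :
    agentPath d₀ w = controlPath 0 d₀ w := rfl

lemma IsControl.piecewise {U : Type*} [NormedAddCommGroup U] {S : Set U} {a c b : ℝ}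
    (hcb : c ≤ b) {u v : ℝ → U} (hu : IsControl S a c u) (hv : IsControl S c b v) :
    IsControl S a b ((Iic c).piecewise u v) := by
  classical
  have e1 : Iic c ∩ Icc a b = Icc a c := by
    ext t; exact ⟨fun h => ⟨h.2.1, h.1⟩, fun h => ⟨h.2, h.1, h.2.trans hcb⟩⟩
  have e2 : (Iic c)ᶜ ∩ Icc a b ⊆ Icc c b := fun t h => ⟨(not_le.1 fun hle => h.1 (mem_Iic.2 hle)).le, h.2.2⟩
  refine ⟨MemLp.piecewise measurableSet_Iic ?_ ?_, ?_⟩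
  · rw [Measure.restrict_restrict measurableSet_Iic, e1]
    exact hu.1
  · rw [Measure.restrict_restrict measurableSet_Iic.compl]
    exact hv.1.mono_measure (Measure.restrict_mono e2 le_rfl)
  · rw [ae_restrict_iff' measurableSet_Icc]
    filter_upwards [(ae_restrict_iff' measurableSet_Icc).1 hu.2,
      (ae_restrict_iff' measurableSet_Icc).1 hv.2] with t h1 h2 ht
    rcases le_or_gt t c with h | h
    · rw [piecewise_eq_of_mem _ _ _ (mem_Iic.2 h)]
      exact h1 ⟨ht.1, h⟩
    · rw [piecewise_eq_of_notMem _ _ _ (by simpa using h)]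
      exact h2 ⟨h.le, ht.2⟩

section ControlPath

variable {U : Type*} [NormedAddCommGroup U] [InnerProductSpace ℝ U] [FiniteDimensional ℝ U]

lemma controlPath_piecewise_of_le {a c t : ℝ} (hat : a ≤ t) (htc : t ≤ c) (d₀ : U) (u v : ℝ → U) :
    controlPath a d₀ ((Iic c).piecewise u v) t = controlPath a d₀ u t := by
  rw [controlPath, controlPath]
  congr 1
  refine intervalIntegral.integral_congr fun s hs => ?_
  rw [uIcc_of_le hat] at hs
  exact piecewise_eq_of_mem _ _ _ (mem_Iic.2 (hs.2.trans htc))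

lemma controlPath_piecewise_of_ge {S : Set U} {a c b t : ℝ} (hac : a ≤ c) (hct : c ≤ t)
    (htb : t ≤ b) (d₀ : U) {u v : ℝ → U} (hu : IsControl S a c u) (hv : IsControl S c b v) :
    controlPath a d₀ ((Iic c).piecewise u v) t = controlPath c (controlPath a d₀ u c) v t := by
  have hw := hu.piecewise (hct.trans htb) hv
  have hc : c ∈ Icc a b := ⟨hac, hct.trans htb⟩
  rw [← controlPath_piecewise_of_le hac le_rfl d₀ u v, controlPath, controlPath, controlPath,
    add_assoc, ← intervalIntegral.integral_add_adjacent_intervals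
      (intervalIntegrable_of_memLp hw.1 ⟨le_rfl, hac.trans hc.2⟩ hc)
      (intervalIntegrable_of_memLp hw.1 hc ⟨hac.trans hct, htb⟩)]
  congr 2
  rw [intervalIntegral.integral_of_le hct, intervalIntegral.integral_of_le hct]
  refine setIntegral_congr_fun measurableSet_Ioc fun s hs => ?_
  exact piecewise_eq_of_notMem _ _ _ (by simpa using hs.1)

end ControlPath

lemma isControl_zero (P : Model D) (humax : 0 ≤ P.umax) (a b : ℝ) :
    IsControl (controlSet P M) a b 0 :=
  ⟨MemLp.zero', Eventually.of_forall fun _ => zero_mem_controlSet P humax⟩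

/-! ### Reachable states -/

/-- The state `p` is reached at time `τ` by the nonlinear flow of a control on `[0, τ]`. -/
def IsReached (P : Model D) (f₀ : PhaseL2 D) (d₀ : Tuple D M) (τ : ℝ) (p : MeanFieldState D M) :
    Prop :=
  IsProbDensity p.1 ∧ ∃ w, Admissible P 0 τ w ∧ agentPath d₀ w τ = p.2 ∧
    ∃ Z, IsFlow P 0 τ (agentPath d₀ w) (densityMeasure f₀) Z ∧
      densityMeasure p.1 = (densityMeasure f₀).map (Z τ)

lemma isReached_zero {P : Model D} (humax : 0 ≤ P.umax) {f₀ : PhaseL2 D} {d₀ : Tuple D M}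
    (hB : AssumptionB P f₀ d₀) : IsReached P f₀ d₀ 0 (f₀, d₀) := by
  refine ⟨hB.density, 0, isControl_zero P humax 0 0, by simp [agentPath], fun _ z => z,
    isFlow_id P 0 _ _, ?_⟩
  exact Measure.map_id.symm

lemma AssumptionB.exists_norm_le {P : Model D} {f₀ : PhaseL2 D} {d₀ : Tuple D M}
    (hB : AssumptionB P f₀ d₀) : ∃ R, ∀ᵐ z ∂(densityMeasure f₀), ‖z‖ ≤ R := by
  obtain ⟨C, hC, h⟩ := hB.compactSupport
  obtain ⟨R, hR⟩ := hC.isBounded.exists_norm_le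
  exact ⟨R, (ae_densityMeasure_mem h).mono fun z hz => hR z hz⟩

lemma IsReached.exists_norm_le {P : Model D} (hα : 0 < P.α) (hA₁ : AssumptionA P.Φ₁)
    (hA₂ : AssumptionA P.Φ₂) {f₀ : PhaseL2 D} {d₀ : Tuple D M} (hB : AssumptionB P f₀ d₀) {τ : ℝ}
    (hτ : 0 ≤ τ) {p : MeanFieldState D M} (h : IsReached P f₀ d₀ τ p) :
    ∃ R, ∀ᵐ z ∂(densityMeasure p.1), ‖z‖ ≤ R := by
  obtain ⟨-, w, -, -, Z, hZ, hp⟩ := h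
  obtain ⟨R, hR⟩ := hB.exists_norm_le
  have := hB.density.2
  obtain ⟨R', hcurve⟩ := hZ.exists_carriedCurve hα hA₁ hA₂ hR
  exact ⟨R', hp ▸ hcurve.carried τ (right_mem_Icc.2 hτ)⟩

/-- Continuation of a reaching flow. -/
lemma IsReached.exists_trans {P : Model D} {f₀ : PhaseL2 D} {d₀ : Tuple D M} {a b : ℝ}
    (ha : 0 ≤ a) (hab : a ≤ b) {p : MeanFieldState D M} (h : IsReached P f₀ d₀ a p)
    {w' : ℝ → Tuple D M} (hw' : Admissible P a b w') {Z' : ℝ → Phase D → Phase D}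
    (hZ' : IsFlow P a b (controlPath a p.2 w') (densityMeasure p.1) Z') :
    ∃ w, Admissible P 0 b w ∧ (∀ t ∈ Icc a b, agentPath d₀ w t = controlPath a p.2 w' t) ∧
      ∃ Z, IsFlow P 0 b (agentPath d₀ w) (densityMeasure f₀) Z ∧
        ∀ t ∈ Icc a b, (densityMeasure p.1).map (Z' t) = (densityMeasure f₀).map (Z t) := by
  obtain ⟨-, w, hw, hd, Z, hZ, hp⟩ := h
  have hpath : ∀ t ∈ Icc a b, agentPath d₀ ((Iic a).piecewise w w') t = controlPath a p.2 w' t :=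
    fun t ht => by
      rw [agentPath_eq_controlPath, controlPath_piecewise_of_ge (S := controlSet P M) ha ht.1 ht.2
        d₀ hw hw', ← agentPath_eq_controlPath, hd]
  have h1 : IsFlow P 0 a (agentPath d₀ ((Iic a).piecewise w w')) (densityMeasure f₀) Z :=
    hZ.congr fun t ht => (controlPath_piecewise_of_le ht.1 ht.2 d₀ w w').symm
  have h2 : IsFlow P a b (agentPath d₀ ((Iic a).piecewise w w'))
      ((densityMeasure f₀).map (Z a)) Z' :=
    hp ▸ hZ'.congr fun t ht => (hpath t ht).symm
  refine ⟨_, IsControl.piecewise (S := controlSet P M) hab hw hw', hpath, _, h1.trans ha hab h2,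
    fun t ht => ?_⟩
  rw [hp, Measure.map_map (hZ'.measurable t ht) (hZ.measurable a (right_mem_Icc.2 ha))]
  congr 1
  funext z
  rcases ht.1.eq_or_lt with rfl | hlt
  · simp [hZ'.init]
  · simp [not_le.2 hlt]

lemma IsWeakMeasureSolution.congr {P : Model D} {a b : ℝ} (hab : a ≤ b) {d e : ℝ → Tuple D M}
    {μ ν : ℝ → Measure (Phase D)} (h : IsWeakMeasureSolution P a b d μ)
    (hde : ∀ t ∈ Icc a b, d t = e t) (hμν : ∀ t ∈ Icc a b, μ t = ν t) :
    IsWeakMeasureSolution P a b e ν := by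
  refine ⟨⟨fun t ht => hμν t ht ▸ h.1.1 t ht, fun φ hφ hb =>
    (h.1.2 φ hφ hb).congr fun t ht => by simp only [hμν t ht]⟩, fun φ h1 h2 h3 => ?_⟩
  rw [← h.2 φ h1 h2 h3, hμν a (left_mem_Icc.2 hab)]
  congr 1
  refine intervalIntegral.integral_congr fun t ht => ?_
  rw [uIcc_of_le hab] at ht
  simp only [hμν t ht, hde t ht]

/-- Every control on a time slice has a feasible state that follows its nonlinear flow. -/
lemma IsReached.exists_feasible {P : Model D} (hα : 0 < P.α) (humax : 0 ≤ P.umax)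
    (hA₁ : AssumptionA P.Φ₁) (hA₂ : AssumptionA P.Φ₂) {f₀ : PhaseL2 D} {d₀ : Tuple D M}
    (hB : AssumptionB P f₀ d₀) {Ω : Set (Phase D)} (hΩo : IsOpen Ω)
    (hΩ : ContainsDynamics P Ω f₀ d₀) {a b : ℝ} (ha : 0 ≤ a) (hab : a ≤ b) (hbT : b ≤ P.T)
    {p : MeanFieldState D M} (h : IsReached P f₀ d₀ a p) {w : ℝ → Tuple D M}
    (hw : Admissible P a b w) {Z : ℝ → Phase D → Phase D}
    (hZ : IsFlow P a b (controlPath a p.2 w) (densityMeasure p.1) Z) :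
    ∃ q, MeanFieldFeasible P Ω a b p q w ∧
      ∀ t ∈ Icc a b, densityMeasure (q t).1 = (densityMeasure p.1).map (Z t) := by
  have hpd := h.1.1
  have := h.1.2
  obtain ⟨R, hR⟩ := h.exists_norm_le hα hA₁ hA₂ hB ha
  obtain ⟨W, hW, hWd, Y, hY, hYm⟩ := h.exists_trans ha hab hw hZ
  have h0b := ha.trans hab
  obtain ⟨R₀, hR₀⟩ := hB.exists_norm_le
  have := hB.density.2
  obtain ⟨R₁, hcurve⟩ := hY.exists_carriedCurve hα hA₁ hA₂ hR₀
  have hb : b ∈ Icc 0 b := right_mem_Icc.2 h0b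
  have := hcurve.prob b hb
  -- Assumption (B) and the property of Ω speak of controls on all of [0, T], so the control is
  -- continued by zero after b and the flow is continued accordingly.
  have hzero := isControl_zero (M := M) P humax b P.T
  obtain ⟨Z'', hZ''⟩ := exists_isFlow hα hA₁ hA₂ hbT
    (hzero.continuousOn_controlPath (agentPath d₀ W b)) (hcurve.carried b hb)
  have hV : Admissible P 0 P.T ((Iic b).piecewise W 0) :=
    IsControl.piecewise (S := controlSet P M) hbT hW hzero
  have hX : IsFlow P 0 P.T (agentPath d₀ ((Iic b).piecewise W 0)) (densityMeasure f₀)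
      (fun t z => if t ≤ b then Y t z else Z'' t (Y b z)) :=
    (hY.congr fun t ht => (controlPath_piecewise_of_le ht.1 ht.2 d₀ W 0).symm).trans h0b hbT
      (hZ''.congr fun t ht => by
        rw [agentPath_eq_controlPath, controlPath_piecewise_of_ge (S := controlSet P M) h0b ht.1
          ht.2 d₀ hW hzero])
  have hX' := isFlow_iff_isNonlinearFlow.1 hX
  obtain ⟨-, f, ⟨f', hf⟩, hfm⟩ := hB.flow _ hV _ hX'
  have hΩm := hΩ _ hV _ hX'
  have hsub : Icc a b ⊆ Icc 0 P.T := Icc_subset_Icc ha hbT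
  have hmap : ∀ t ∈ Icc a b, densityMeasure (f t) = (densityMeasure p.1).map (Z t) := fun t ht => by
    rw [← (hfm t (hsub ht)).2, hYm t ht]
    congr 1
    funext z
    simp [ht.2]
  have haI : a ∈ Icc a b := left_mem_Icc.2 hab
  have hpath : ContinuousOn (controlPath a p.2 w) (Icc a b) :=
    IsControl.continuousOn_controlPath (S := controlSet P M) hw p.2
  have hweak := hZ.isWeakMeasureSolution hα hA₁ hA₂ hab hpath hR
  refine ⟨fun t => (f t, controlPath a p.2 w t), ⟨⟨⟨f', hf.mono ha hbT⟩, fun t ht => ?_⟩,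
    fun t ht => ⟨(hfm t (hsub ht)).1, ?_⟩, ?_, ?_, ?_, hw⟩, hmap⟩
  · refine ae_eq_zero_of_densityMeasure_eq_zero (hfm t (hsub ht)).1 hΩo.measurableSet.compl ?_
    rw [← (hfm t (hsub ht)).2]
    exact hΩm t (hsub ht)
  · show IsProbabilityMeasure (densityMeasure (f t))
    rw [hmap t ht]
    exact Measure.isProbabilityMeasure_map (hZ.measurable t ht).aemeasurable
  · exact hweak.congr hab (fun _ _ => rfl) fun t ht => (hmap t ht).symm
  · exact ⟨hw.1, fun t _ => by simp [controlPath]⟩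
  · refine Prod.ext (eq_of_densityMeasure_eq (hfm a (hsub haI)).1 hpd ?_) (by simp [controlPath])
    rw [hmap a haI, show Z a = id from funext hZ.init, Measure.map_id]

/-- Feasible states follow nonlinear flows. -/
lemma MeanFieldFeasible.exists_isFlow {P : Model D} (hα : 0 < P.α)
    (hA₁ : AssumptionA P.Φ₁) (hA₂ : AssumptionA P.Φ₂) {Ω : Set (Phase D)}
    (hΩb : Bornology.IsBounded Ω) {a b : ℝ} (hab : a ≤ b)
    {p : MeanFieldState D M} {q : ℝ → MeanFieldState D M} {w : ℝ → Tuple D M}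
    (h : MeanFieldFeasible P Ω a b p q w) :
    (∀ t ∈ Icc a b, (q t).2 = controlPath a p.2 w t) ∧
    ∃ Z, IsFlow P a b (controlPath a p.2 w) (densityMeasure p.1) Z ∧
      ∀ t ∈ Icc a b, densityMeasure (q t).1 = (densityMeasure p.1).map (Z t) := by
  obtain ⟨⟨-, hΩ⟩, -, hweak, hd, rfl, -⟩ := h
  obtain ⟨R, hR⟩ := hΩb.exists_norm_le
  have hpath : ∀ t ∈ Icc a b, (q t).2 = controlPath a (q a).2 w t := hd.2
  -- Feasible states have densities and live in the bounded set Ω, which is what the transport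
  -- theorem requires.
  obtain ⟨Z, hZ, hm⟩ := hweak.exists_isFlow hα hA₁ hA₂ hab hd.continuousOn
    (fun t _ => densityMeasure_absolutelyContinuous _)
    (fun t ht => (ae_densityMeasure_mem (hΩ t ht)).mono fun z hz => hR z hz)
  exact ⟨hpath, Z, hZ.congr hpath, hm⟩

/-- Feasible states lead from reachable states to reachable states. -/
lemma MeanFieldFeasible.isReached {P : Model D} (hα : 0 < P.α)
    (hA₁ : AssumptionA P.Φ₁) (hA₂ : AssumptionA P.Φ₂) {f₀ : PhaseL2 D} {d₀ : Tuple D M}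
    {Ω : Set (Phase D)} (hΩb : Bornology.IsBounded Ω) {a b : ℝ} (ha : 0 ≤ a) (hab : a ≤ b)
    {p : MeanFieldState D M} {q : ℝ → MeanFieldState D M} {w : ℝ → Tuple D M}
    (h : MeanFieldFeasible P Ω a b p q w) (hp : IsReached P f₀ d₀ a p) :
    IsReached P f₀ d₀ b (q b) := by
  obtain ⟨hpath, Z, hZ, hm⟩ := h.exists_isFlow hα hA₁ hA₂ hΩb hab
  obtain ⟨W, hW, hWd, Y, hY, hYm⟩ := hp.exists_trans ha hab h.2.2.2.2.2 hZ
  have hb : b ∈ Icc a b := right_mem_Icc.2 hab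
  exact ⟨h.2.1 b hb, W, hW, by rw [hWd b hb, hpath b hb], Y, hY, by rw [hm b hb, hYm b hb]⟩

end

section

variable {D M : ℕ}

/-! ### Mean-field costs on the label space -/

section LabelCost

variable {X : Type*} [TopologicalSpace X] [CompactSpace X] [MeasurableSpace X] [BorelSpace X]
  (ν : Measure X) [IsProbabilityMeasure ν]

lemma norm_integral_continuousMap_le {V : Type*} [NormedAddCommGroup V] [NormedSpace ℝ V]
    (γ : C(X, V)) : ‖∫ x, γ x ∂ν‖ ≤ ‖γ‖ := by
  simpa using norm_integral_le_of_norm_le_const (μ := ν)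
    (Eventually.of_forall fun x => γ.norm_coe_le_norm x)

lemma continuous_integral_continuousMap {V : Type*} [NormedAddCommGroup V] [NormedSpace ℝ V]
    [SecondCountableTopology V] :
    Continuous fun γ : C(X, V) => ∫ x, γ x ∂ν := by
  have hi : ∀ γ : C(X, V), Integrable γ ν := fun γ =>
    Integrable.of_bound γ.continuous.aestronglyMeasurable ‖γ‖
      (Eventually.of_forall fun x => γ.norm_coe_le_norm x)
  refine (LipschitzWith.of_dist_le_mul (K := 1) fun γ δ => ?_).continuous
  rw [dist_eq_norm, dist_eq_norm, ← integral_sub (hi γ) (hi δ), NNReal.coe_one, one_mul]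
  exact norm_integral_continuousMap_le ν (γ - δ)

/-- The centre of mass of labelled phase space points. -/
def labelMean (β : C(X, Phase D)) : Space D := ∫ x, (β x).1 ∂ν

/-- The variance of labelled phase space points. -/
def labelVar (β : C(X, Phase D)) : ℝ := ∫ x, ‖(β x).1 - labelMean ν β‖ ^ 2 ∂ν

lemma norm_labelMean_le (β : C(X, Phase D)) : ‖labelMean ν β‖ ≤ ‖β‖ := by
  simpa [labelMean] using norm_integral_le_of_norm_le_const (μ := ν)
    (Eventually.of_forall fun x => (norm_fst_le (β x)).trans (β.norm_coe_le_norm x))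

lemma continuous_labelMean : Continuous (labelMean (D := D) ν) :=
  (continuous_integral_continuousMap ν).comp
    (ContinuousMap.continuous_postcomp (⟨Prod.fst, continuous_fst⟩ : C(Phase D, Space D)))

lemma abs_labelVar_le (β : C(X, Phase D)) : |labelVar ν β| ≤ (2 * ‖β‖) ^ 2 := by
  have h : ∀ x, ‖‖(β x).1 - labelMean ν β‖ ^ 2‖ ≤ (2 * ‖β‖) ^ 2 := fun x => by
    rw [norm_pow, norm_norm]
    gcongr
    refine (norm_sub_le _ _).trans ?_
    have h1 := (norm_fst_le (β x)).trans (β.norm_coe_le_norm x)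
    have h2 := norm_labelMean_le ν β
    linarith
  simpa [labelVar] using norm_integral_le_of_norm_le_const (μ := ν) (Eventually.of_forall h)

/-- The integrand is jointly continuous in the labelling and the label, so it depends continuously
on the labelling in the supremum norm; integration is continuous for that norm. -/
lemma continuous_labelVar : Continuous (labelVar (D := D) ν) := by
  have h0 := continuous_labelMean (D := D) ν
  have h1 : Continuous fun q : C(X, Phase D) × X => ‖(q.1 q.2).1 - labelMean ν q.1‖ ^ 2 := by
    fun_prop
  let Ψ : C(X, Phase D) → C(X, ℝ) := fun β =>
    ⟨fun x => ‖(β x).1 - labelMean ν β‖ ^ 2, by fun_prop⟩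
  have h2 : Continuous Ψ := ContinuousMap.continuous_of_continuous_uncurry Ψ h1
  exact (continuous_integral_continuousMap ν).comp h2

/-- The running cost of the mean-field problem. -/
def labelCost (P : Model D) (β : C(X, Phase D)) : ℝ :=
  P.σ₁ / (4 * P.T) * |labelVar ν β - P.VbarInf| ^ 2
    + P.σ₂ / (2 * P.T) * ‖labelMean ν β - P.Edes‖ ^ 2

lemma continuous_labelCost (P : Model D) : Continuous (labelCost ν P) := by
  have h1 := continuous_labelMean (D := D) ν
  have h2 := continuous_labelVar (D := D) ν
  unfold labelCost
  fun_prop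

lemma exists_labelCost_le (P : Model D) (hT : 0 < P.T) (hσ₁ : 0 < P.σ₁) (hσ₂ : 0 < P.σ₂) (R : ℝ) :
    ∃ B, ∀ β : C(X, Phase D), ‖β‖ ≤ R → labelCost ν P β ≤ B := by
  refine ⟨P.σ₁ / (4 * P.T) * ((2 * R) ^ 2 + |P.VbarInf|) ^ 2
    + P.σ₂ / (2 * P.T) * (R + ‖P.Edes‖) ^ 2, fun β hβ => ?_⟩
  unfold labelCost
  gcongr
  · refine (abs_sub _ _).trans ?_
    gcongr
    refine (abs_labelVar_le ν β).trans ?_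
    gcongr
  · exact (norm_sub_le _ _).trans (by gcongr; exact (norm_labelMean_le ν β).trans hβ)

end LabelCost

/-- Along a nonlinear flow, the cost of a mean-field state is the cost of its labelled points. -/
lemma meanFieldCost_eq {X : Type*} [TopologicalSpace X] [CompactSpace X] [MeasurableSpace X]
    [BorelSpace X] {ν : Measure X} (P : Model D) {a b : ℝ} (hab : a ≤ b)
    {q : ℝ → MeanFieldState D M} (w : ℝ → Tuple D M) (hq : ∀ t ∈ Icc a b, ∀ᵐ z, 0 ≤ (q t).1 z)
    {β : ℝ → C(X, Phase D)} (h : ∀ t ∈ Icc a b, densityMeasure (q t).1 = ν.map (β t)) :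
    meanFieldCost P a b q w = controlCost (labelCost ν P) (P.σ₃ / (2 * (M : ℝ))) a b β w := by
  refine intervalIntegral.integral_congr fun t ht => ?_
  rw [uIcc_of_le hab] at ht
  have h1 := meanFieldMean_eq (hq t ht) (β t).continuous.measurable (h t ht)
  have h2 := meanFieldVar_eq (hq t ht) (β t).continuous.measurable (h t ht)
  simp only [h1, h2]
  rfl

/-- Existence of optimal pairs for the mean-field problem on one time slice, from reachable initial
values. -/
theorem IsReached.exists_meanFieldOptimal {P : Model D} (hα : 0 < P.α) (hT : 0 < P.T)
    (humax : 0 ≤ P.umax) (hσ₁ : 0 < P.σ₁) (hσ₂ : 0 < P.σ₂) (hσ₃ : 0 < P.σ₃)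
    (hA₁ : AssumptionA P.Φ₁) (hA₂ : AssumptionA P.Φ₂) {f₀ : PhaseL2 D} {d₀ : Tuple D M}
    (hB : AssumptionB P f₀ d₀) {Ω : Set (Phase D)} (hΩo : IsOpen Ω)
    (hΩb : Bornology.IsBounded Ω) (hΩ : ContainsDynamics P Ω f₀ d₀) {a b : ℝ} (ha : 0 ≤ a)
    (hab : a ≤ b) (hbT : b ≤ P.T) {p : MeanFieldState D M} (h : IsReached P f₀ d₀ a p) :
    ∃ q w, MeanFieldOptimal P Ω a b p q w := by
  have := h.1.2
  obtain ⟨R, hR⟩ := h.exists_norm_le hα hA₁ hA₂ hB ha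
  have hprob := isProbabilityMeasure_ballMeasure hR
  set ν := ballMeasure (densityMeasure p.1) R with hν
  -- A feasible state and its flow produce a state of the label system with the same control and the
  -- same cost, so optimality can be decided on labels.
  have hstate : ∀ w, Admissible P a b w →
      ∀ Z, IsFlow P a b (controlPath a p.2 w) (densityMeasure p.1) Z →
      ∀ q, MeanFieldFeasible P Ω a b p q w →
      (∀ t ∈ Icc a b, densityMeasure (q t).1 = (densityMeasure p.1).map (Z t)) →
      ∃ β, IsState (meanSystem hA₁ hA₂ ν) a b (ballInclusion D R) p.2 β w ∧
        meanFieldCost P a b q w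
          = controlCost (labelCost ν P) (P.σ₃ / (2 * (M : ℝ))) a b β w := by
    intro w hw Z hZ q hq hqZ
    obtain ⟨β, hβ0, hβ, hβZ⟩ := hZ.exists_isSolutionOn hα hA₁ hA₂ hab
      (IsControl.continuousOn_controlPath (S := controlSet P M) hw p.2) hR
    refine ⟨β, ⟨hβ0, hβ⟩, meanFieldCost_eq P hab w (fun t ht => (hq.2.1 t ht).1) fun t ht => ?_⟩
    rw [hqZ t ht, ← map_ballMeasure hR (hZ.measurable t ht), funext (hβZ t ht)]
  have hκ : 0 ≤ P.σ₃ / (2 * (M : ℝ)) := by positivity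
  have hc0 : ∀ β, 0 ≤ labelCost ν P β := fun β => by unfold labelCost; positivity
  obtain ⟨u, hu, hopt⟩ := exists_optimal_control
    (isTameSystem_meanSystem (M := M) hα hA₁ hA₂ ν) (continuous_labelCost ν P) hc0
    (exists_labelCost_le ν P hT hσ₁ hσ₂) hκ (convex_controlSet P) (isClosed_controlSet P)
    (isBounded_controlSet P humax) ⟨0, zero_mem_controlSet P humax⟩ hab (ballInclusion D R) p.2
  have hu' := admissible_iff_isControl.2 hu
  obtain ⟨Z, hZ⟩ := exists_isFlow hα hA₁ hA₂ hab (hu.continuousOn_controlPath p.2) hR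
  obtain ⟨q, hq, hqZ⟩ := h.exists_feasible hα humax hA₁ hA₂ hB hΩo hΩ ha hab hbT hu' hZ
  obtain ⟨β, hβ, hcost⟩ := hstate u hu' Z hZ q hq hqZ
  refine ⟨q, u, hq, fun q' w' hq' => ?_⟩
  have hw' := hq'.2.2.2.2.2
  -- Every competitor, whatever its origin, is transported by a nonlinear flow and therefore also
  -- appears in the label problem.
  obtain ⟨-, Z', hZ', hqZ'⟩ := hq'.exists_isFlow hα hA₁ hA₂ hΩb hab
  obtain ⟨β', hβ', hcost'⟩ := hstate w' hw' Z' hZ' q' hq' hqZ'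
  rw [hcost, hcost']
  exact hopt β hβ β' w' (admissible_iff_isControl.1 hw') hβ'

/-- The initial values produced by chains of optimal mean-field pairs are reachable. -/
lemma MeanFieldChain.isReached {P : Model D} (hα : 0 < P.α) (humax : 0 ≤ P.umax)
    (hA₁ : AssumptionA P.Φ₁) (hA₂ : AssumptionA P.Φ₂) {f₀ : PhaseL2 D} {d₀ : Tuple D M}
    (hB : AssumptionB P f₀ d₀) {Ω : Set (Phase D)} (hΩb : Bornology.IsBounded Ω) {t : ℕ → ℝ}
    (ht0 : t 0 = 0) {k : ℕ} (ht : ∀ j < k, t j < t (j + 1)) {p : ℕ → ℝ → MeanFieldState D M}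
    {w : ℕ → ℝ → Tuple D M} (h : MeanFieldChain P Ω t (f₀, d₀) k p w) :
    0 ≤ t k ∧ IsReached P f₀ d₀ (t k) (sliceStart t (f₀, d₀) p k) := by
  induction k with
  | zero => exact ⟨ht0.ge, by rw [ht0]; exact isReached_zero humax hB⟩
  | succ k ih =>
    obtain ⟨h0, hr⟩ := ih (fun j hj => ht j (by omega)) fun j hj => h j (by omega)
    have hk := ht k k.lt_succ_self
    exact ⟨h0.trans hk.le, (h k k.lt_succ_self).1.isReached hα hA₁ hA₂ hΩb h0 hk.le hr⟩

end

end Herding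

end

theorem mainTheorem1
    (D N M K : ℕ) (hD : 0 < D) (hN : 0 < N) (hM : 0 < M)
    (P : Herding.Model D)
    (hα : 0 < P.α) (hT : 0 < P.T) (humax : 0 ≤ P.umax)
    (hσ₁ : 0 < P.σ₁) (hσ₂ : 0 < P.σ₂) (hσ₃ : 0 < P.σ₃)
    (t : ℕ → ℝ) (ht0 : t 0 = 0) (htK : t K = P.T) (htmono : ∀ k < K, t k < t (k + 1))
    (x₀ v₀ : Herding.Tuple D N) (d₀ : Herding.Tuple D M) (f₀ : Herding.PhaseL2 D)
    (hA₁ : Herding.AssumptionA P.Φ₁) (hA₂ : Herding.AssumptionA P.Φ₂)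
    (hB : Herding.AssumptionB P f₀ d₀)
    (Ω : Set (Herding.Phase D)) (hΩo : IsOpen Ω) (hΩb : Bornology.IsBounded Ω)
    (hΩc : Convex ℝ Ω) (hΩ : Herding.ContainsDynamics P Ω f₀ d₀) :
    ((∃ y u, Herding.MicroChain P t (x₀, v₀, d₀) K y u) ∧
      ∀ k < K, ∀ y u, Herding.MicroChain P t (x₀, v₀, d₀) k y u →
        ∃ y' u', Herding.MicroOptimal P (t k) (t (k + 1))
          (Herding.sliceStart t (x₀, v₀, d₀) y k) y' u') ∧
    ((∃ p w, Herding.MeanFieldChain P Ω t (f₀, d₀) K p w) ∧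
      ∀ k < K, ∀ p w, Herding.MeanFieldChain P Ω t (f₀, d₀) k p w →
        ∃ p' w', Herding.MeanFieldOptimal P Ω (t k) (t (k + 1))
          (Herding.sliceStart t (f₀, d₀) p k) p' w') := by
  have hstart : ∀ k ≤ K, t k ≤ P.T := fun k hk => by
    induction hk using Nat.decreasingInduction with
    | self => exact htK.le
    | of_succ k hk ih => exact (htmono k hk).le.trans ih
  have hmicro : ∀ k < K, ∀ ya : Herding.MicroState D N M,
      ∃ y u, Herding.MicroOptimal P (t k) (t (k + 1)) ya y u := fun k hk ya =>
    Herding.exists_microOptimal P hα hT humax hσ₁ hσ₂ hσ₃ hA₁ hA₂ (htmono k hk).le ya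
  -- Unlike the particle problem, which is solvable from every initial value, this one needs a
  -- reachable initial value; the preceding chain supplies it.
  have hmean : ∀ k < K, ∀ p w, Herding.MeanFieldChain P Ω t (f₀, d₀) k p w →
      ∃ p' w', Herding.MeanFieldOptimal P Ω (t k) (t (k + 1))
        (Herding.sliceStart t (f₀, d₀) p k) p' w' := fun k hk p w hpw => by
    obtain ⟨h0, hr⟩ := hpw.isReached hα humax hA₁ hA₂ hB hΩb ht0
      fun j hj => htmono j (hj.trans hk)
    exact hr.exists_meanFieldOptimal hα hT humax hσ₁ hσ₂ hσ₃ hA₁ hA₂ hB hΩo hΩb hΩ h0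
      (htmono k hk).le (hstart (k + 1) hk)
  exact ⟨⟨Herding.exists_chain t _ (fun j => Herding.MicroOptimal P (t j) (t (j + 1))) K
      fun k hk _ _ _ => hmicro k hk _, fun k hk _ _ _ => hmicro k hk _⟩,
    ⟨Herding.exists_chain t _ (fun j => Herding.MeanFieldOptimal P Ω (t j) (t (j + 1))) K
      hmean, hmean⟩⟩
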